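/- Let $m\ge 1$ be an integer and $\delta>0$. Let $p\in(0,1)$ and $d\ge 1$, let $S$ be a $d$-dimensional sphere of surface area $1$ with Euclidean distance $D$, and let $r$ be such that $\{y\in S: D(x,y)\le r\}$ has area $p$ for every $x\in S$. The geometric preferential attachment graph is built as follows. Start from the empty graph. At step $n\ge1$ a vertex $V_n$ is placed uniformly on $S$, independently of the past, and then $m$ edges $(V_n,v_{n,1}),\dots,(V_n,v_{n,m})$ are added one after the other. Let $GPM_{n,i}$ be the graph after the first $i$ of them, and $\deg_{n,i}(k)$ the degree of $V_k$ in it (self-loops count twice). For $0\le i<m$, $$\mathbb P(v_{n,i+1}=V_k\mid GPM_{n,i})=\begin{cases}\dfrac{\mathbf 1_{\{D(V_n,V_k)\le r\}}\,(\deg_{n,i}(k)+m\delta)}{Z_{n,i}}, & 1\le k\le n-1,\\[2ex] \dfrac{\deg_{n,i}(n)+m\delta+m-i}{Z_{n,i}}, & k=n,\end{cases}\qquad Z_{n,i}=\sum_{j\le n,\ D(V_n,V_j)\le r}(\deg_{n,i}(j)+m\delta)+m-i ,$$ where $GPM_{n,i}$ includes the positions of $V_1,\dots,V_n$. **Theorem.**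 There is a constant $c>0$, depending only on $m$ and $\delta$, such that for every $p\in(0,1)$ and every integer $k\ge1$ there is a constant $C$, depending only on $m,\delta,p,k$, with the following property. Let $d\ge 1$ and $n\ge 1$, let $1\le a_i\le b_i\le n$ and $1\le t_i\le m$ for $1\le i\le k$, and suppose that the pairs $(b_i,t_i)$ are distinct. Put $a'=\min_{1\le i\le k} a_i$ and $A=\{D(V_{a_i},V_{b_i})\le r\ \text{for all } 1\le i\le k\}$. Then there is a real number $\varepsilon$ with $|\varepsilon|\le C\,(a')^{-c}$ such that $$\mathbb P\big(v_{b_i,t_i}=V_{a_i}\ \text{for all } 1\le i\le k\big)=(1+\varepsilon)\,\mathbb P(A)\prod_{i=1}^{k}\frac{(1+\delta)m+\#\{j: 1\le j<i,\ a_j=a_i\}}{(2+\delta)m\,p}\; b_i^{-\frac{1+\delta}{2+\delta}}\,a_i^{-\frac{1}{2+\delta}} .$$ -/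

import Mathlib

open MeasureTheory

noncomputable section

namespace GPM

/-- The `d`-dimensional sphere, with the Euclidean distance of the ambient space as its `dist`.
The model only sees distances through the relation `dist ≤ r`, where `r` is fixed by the relative
area of a cap, so the radius of the sphere is irrelevant and is taken to be one. -/
abbrev Sphere (d : ℕ) : Type :=
  Metric.sphere (0 : EuclideanSpace ℝ (Fin (d + 1))) 1

/-- The surface measure of the sphere, normalized to total area one: the uniform distribution. -/
def area (d : ℕ) : Measure (Sphere d) :=
  ((volume : Measure (EuclideanSpace ℝ (Fin (d + 1)))).toSphere Set.univ)⁻¹ •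
    (volume : Measure (EuclideanSpace ℝ (Fin (d + 1)))).toSphere

/-- The label in `{1, …, n}` of a vertex: `j : Fin n` stands for the vertex `V_{j+1}`. -/
def label {n : ℕ} (j : Fin n) : ℕ := j + 1

/-- An edge configuration `e` records by `e b i` the end point of the edge number `i + 1`
sent out by the vertex `b`, for each of the `n` vertices and each `i < m`. -/
abbrev Edges (n m : ℕ) : Type := Fin n → Fin m → Fin n

/-- The degree of the vertex `j` in the graph `GPM_{b,i}`, formed by all the edges of the vertices
before `b` and the first `i` edges of `b`. A self-loop counts twice. -/
def degree {n m : ℕ} (e : Edges n m) (b : Fin n) (i : Fin m) (j : Fin n) : ℕ :=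
  ∑ u : Fin n, ∑ s : Fin m,
    if u < b ∨ (u = b ∧ s < i) then
      (if u = j then 1 else 0) + (if e u s = j then 1 else 0)
    else 0

/-- The common denominator of the edge probabilities: the total weight of the vertices present
within distance `r` of `b` (including `b` itself), plus `m - i`. -/
def totalWeight {d n m : ℕ} (δ r : ℝ) (x : Fin n → Sphere d) (e : Edges n m)
    (b : Fin n) (i : Fin m) : ℝ :=
  (∑ j : Fin n, if j ≤ b ∧ dist (x b) (x j) ≤ r then (degree e b i j : ℝ) + m * δ else 0)
    + ((m : ℝ) - (i : ℕ))

/-- The conditional probability, given `GPM_{b,i}` and the positions, that the next edge of `b`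
(its edge number `i + 1`) ends at `k`. -/
def edgeProb {d n m : ℕ} (δ r : ℝ) (x : Fin n → Sphere d) (e : Edges n m)
    (b : Fin n) (i : Fin m) (k : Fin n) : ℝ :=
  if k < b then
    (if dist (x b) (x k) ≤ r then (degree e b i k : ℝ) + m * δ else 0) / totalWeight δ r x e b i
  else if k = b then
    ((degree e b i b : ℝ) + m * δ + ((m : ℝ) - (i : ℕ))) / totalWeight δ r x e b i
  else 0

/-- The joint law of the positions of the first `n` vertices and of all their edges: the positions
are independent and uniform, and the edges are added one after the other according to `edgeProb`.
By the chain rule its density with respect to (uniform positions) × (counting measure on edge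
configurations) is the product of the successive conditional probabilities. -/
def law (d n m : ℕ) (δ r : ℝ) : Measure ((Fin n → Sphere d) × Edges n m) :=
  ((Measure.pi fun _ : Fin n => area d).prod Measure.count).withDensity fun ω =>
    ENNReal.ofReal (∏ b : Fin n, ∏ i : Fin m, edgeProb δ r ω.1 ω.2 b i (ω.2 b i))

lemma isProb_area (d : ℕ) : IsProbabilityMeasure (area d) := by
  constructor
  have h0 : (volume : Measure (EuclideanSpace ℝ (Fin (d + 1)))).toSphere Set.univ ≠ 0 := by
    rw [Measure.measure_univ_ne_zero]
    exact Measure.toSphere_ne_zero _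
  simp only [area, Measure.smul_apply, smul_eq_mul]
  exact ENNReal.inv_mul_cancel h0 (measure_ne_top _ _)

lemma totalWeight_pos {d n m : ℕ} {δ r : ℝ} (hδ : 0 < δ) (x : Fin n → Sphere d)
    (e : Edges n m) (b : Fin n) (i : Fin m) : 0 < totalWeight δ r x e b i := by
  unfold totalWeight
  have : ((i : ℕ) : ℝ) < m := by exact_mod_cast i.2
  have h : 0 ≤ ∑ j : Fin n, if j ≤ b ∧ dist (x b) (x j) ≤ r
      then (degree e b i j : ℝ) + m * δ else 0 :=
    Finset.sum_nonneg fun j _ => by split_ifs <;> positivity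
  linarith

lemma edgeProb_nonneg {d n m : ℕ} {δ r : ℝ} (hδ : 0 < δ) (x : Fin n → Sphere d)
    (e : Edges n m) (b : Fin n) (i : Fin m) (k : Fin n) : 0 ≤ edgeProb δ r x e b i k := by
  have h := totalWeight_pos (r := r) hδ x e b i
  have : ((i : ℕ) : ℝ) < m := by exact_mod_cast i.2
  have h2 : 0 ≤ (m : ℝ) - (i : ℕ) := by linarith
  unfold edgeProb
  split_ifs <;> positivity

/-- The probabilities of the possible end points of an edge add up to one. -/
lemma sum_edgeProb {d n m : ℕ} {δ r : ℝ} (hδ : 0 < δ) (hr : 0 ≤ r) (x : Fin n → Sphere d)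
    (e : Edges n m) (b : Fin n) (i : Fin m) : ∑ k, edgeProb δ r x e b i k = 1 := by
  have h := totalWeight_pos (r := r) hδ x e b i
  have key : ∀ k, edgeProb δ r x e b i k * totalWeight δ r x e b i =
      (if k ≤ b ∧ dist (x b) (x k) ≤ r then (degree e b i k : ℝ) + m * δ else 0)
        + (if k = b then (m : ℝ) - (i : ℕ) else 0) := by
    intro k
    unfold edgeProb
    rcases lt_trichotomy k b with hk | hk | hk
    · simp [hk, hk.le, hk.ne, h.ne']
    · subst hk
      simp [h.ne', hr]
    · simp [hk.not_gt, hk.ne', hk.not_ge]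
  have : (∑ k, edgeProb δ r x e b i k) * totalWeight δ r x e b i
      = totalWeight δ r x e b i := by
    rw [Finset.sum_mul, Finset.sum_congr rfl fun k _ => key k, Finset.sum_add_distrib]
    simp [totalWeight]
  exact mul_right_cancel₀ h.ne' (by simpa using this)

/-- Summing out a sequence of choices one after the other. -/
lemma sum_prod_chain {K : Type*} [Fintype K] [Nonempty K] :
    ∀ (N : ℕ) (q : Fin N → (Fin N → K) → K → ℝ),
      (∀ s f g, (∀ u, u < s → f u = g u) → q s f = q s g) → (∀ s f, ∑ k, q s f k = 1) →
      ∑ f : Fin N → K, ∏ s, q s f (f s) = 1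
  | 0, q, _, _ => by simp
  | N + 1, q, hq, h1 => by
    have k0 : K := Classical.arbitrary K
    rw [← (Fin.snocEquiv fun _ => K).sum_comp, Fintype.sum_prod_type_right]
    have hstep : ∀ g : Fin N → K, ∑ k : K, ∏ s, q s (Fin.snocEquiv (fun _ => K) (k, g))
        (Fin.snocEquiv (fun _ => K) (k, g) s) =
        ∏ s : Fin N, q s.castSucc (Fin.snoc (α := fun _ => K) g k0) (g s) := by
      intro g
      have : ∀ k : K, ∏ s, q s (Fin.snocEquiv (fun _ => K) (k, g))
          (Fin.snocEquiv (fun _ => K) (k, g) s) =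
          (∏ s : Fin N, q s.castSucc (Fin.snoc (α := fun _ => K) g k0) (g s)) *
            q (Fin.last N) (Fin.snoc (α := fun _ => K) g k0) k := by
        intro k
        have hc : ∀ u : Fin (N + 1), u < Fin.last N →
            (Fin.snoc (α := fun _ => K) g k : Fin (N + 1) → K) u
              = (Fin.snoc (α := fun _ => K) g k0 : Fin (N + 1) → K) u := by
          intro u hu
          obtain ⟨v, rfl⟩ := Fin.exists_castSucc_eq.2 hu.ne
          simp
        rw [Fin.prod_univ_castSucc]
        simp only [Fin.snocEquiv, Equiv.coe_fn_mk, Fin.snoc_castSucc, Fin.snoc_last]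
        congr 1
        · refine Finset.prod_congr rfl fun s _ => ?_
          rw [hq _ _ _ fun u hu => hc u (hu.trans (Fin.castSucc_lt_last s))]
        · rw [hq _ _ _ hc]
      rw [Finset.sum_congr rfl fun k _ => this k, ← Finset.mul_sum, h1, mul_one]
    rw [Finset.sum_congr rfl fun g _ => hstep g]
    refine sum_prod_chain N (fun s g k => q s.castSucc (Fin.snoc (α := fun _ => K) g k0) k) ?_ ?_
    · intro s f g hfg
      have := hq s.castSucc (Fin.snoc (α := fun _ => K) f k0) (Fin.snoc (α := fun _ => K) g k0) ?_
      · simp only [this]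
      · intro u hu
        obtain ⟨v, rfl⟩ := Fin.exists_castSucc_eq.2 (hu.trans (Fin.castSucc_lt_last s)).ne
        simpa using hfg v (by simpa using hu)
    · intro s f
      exact h1 _ _

lemma degree_congr {n m : ℕ} (e e' : Edges n m) (b : Fin n) (i : Fin m)
    (h : ∀ u s, u < b ∨ (u = b ∧ s < i) → e u s = e' u s) : degree e b i = degree e' b i := by
  funext j
  unfold degree
  refine Finset.sum_congr rfl fun u _ => Finset.sum_congr rfl fun s _ => ?_
  split_ifs with h1 <;> simp_all

lemma edgeProb_congr {d n m : ℕ} (δ r : ℝ) (x : Fin n → Sphere d) (e e' : Edges n m) (b : Fin n)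
    (i : Fin m) (h : ∀ u s, u < b ∨ (u = b ∧ s < i) → e u s = e' u s) :
    edgeProb δ r x e b i = edgeProb δ r x e' b i := by
  funext k
  simp only [edgeProb, totalWeight, degree_congr e e' b i h]

lemma sum_prod_edgeProb {d n m : ℕ} {δ r : ℝ} (hδ : 0 < δ) (hr : 0 ≤ r) (x : Fin n → Sphere d) :
    ∑ e : Edges n m, ∏ b, ∏ i, edgeProb δ r x e b i (e b i) = 1 := by
  rcases Nat.eq_zero_or_pos n with rfl | hn
  · simp
  have : Nonempty (Fin n) := ⟨⟨0, hn⟩⟩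
  let φ : (Fin (n * m) → Fin n) ≃ Edges n m :=
    (finProdFinEquiv.symm.arrowCongr (Equiv.refl (Fin n))).trans (Equiv.curry _ _ _)
  have hφ : ∀ f u s, φ f u s = f (finProdFinEquiv (u, s)) := fun f u s => rfl
  rw [← φ.sum_comp]
  rw [← sum_prod_chain (n * m) (fun s f => edgeProb δ r x (φ f) (finProdFinEquiv.symm s).1
    (finProdFinEquiv.symm s).2) ?_ (fun s f => sum_edgeProb hδ hr x _ _ _)]
  · refine Finset.sum_congr rfl fun f _ => ?_
    rw [← finProdFinEquiv.prod_comp, Fintype.prod_prod_type]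
    simp [hφ]
  · intro s f g hfg
    refine edgeProb_congr δ r x _ _ _ _ fun u v huv => ?_
    rw [hφ, hφ]
    apply hfg
    obtain ⟨⟨b, i⟩, rfl⟩ := finProdFinEquiv.surjective s
    simp only [Equiv.symm_apply_apply] at huv
    rw [Fin.lt_def]
    simp only [finProdFinEquiv_apply_val]
    rcases huv with h | ⟨rfl, h⟩
    · have h1 : (u : ℕ) + 1 ≤ b := h
      have h2 := v.2
      nlinarith [Nat.mul_le_mul_left m h1]
    · simpa using h

lemma measurable_density {d n m : ℕ} (δ r : ℝ) :
    Measurable fun ω : (Fin n → Sphere d) × Edges n m =>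
      ∏ b : Fin n, ∏ i : Fin m, edgeProb δ r ω.1 ω.2 b i (ω.2 b i) := by
  refine measurable_from_prod_countable_left fun e => ?_
  have hm : ∀ j k : Fin n, MeasurableSet {x : Fin n → Sphere d | dist (x j) (x k) ≤ r} :=
    fun j k => measurableSet_le (by fun_prop) measurable_const
  have hw : ∀ b i, Measurable fun x : Fin n → Sphere d => totalWeight δ r x e b i := by
    intro b i
    unfold totalWeight
    refine Measurable.add_const (Finset.measurable_sum _ fun j _ => ?_) _
    exact Measurable.ite ((MeasurableSet.const _).inter (hm b j)) measurable_const measurable_const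
  refine Finset.measurable_prod _ fun b _ => Finset.measurable_prod _ fun i _ => ?_
  unfold edgeProb
  dsimp only
  refine Measurable.ite (MeasurableSet.const (e b i < b)) (Measurable.div ?_ (hw b i)) ?_
  · exact Measurable.ite (hm _ _) measurable_const measurable_const
  · exact Measurable.ite (MeasurableSet.const (e b i = b)) (measurable_const.div (hw b i)) measurable_const

/-- The law of the model is a probability measure. -/
theorem isProbabilityMeasure_law {d n m : ℕ} {δ r : ℝ} (hδ : 0 < δ) (hr : 0 ≤ r) :
    IsProbabilityMeasure (law d n m δ r) := by
  have := isProb_area d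
  constructor
  rw [law, withDensity_apply _ MeasurableSet.univ, Measure.restrict_univ,
    lintegral_prod _ (measurable_density δ r).ennreal_ofReal.aemeasurable]
  have : ∀ x : Fin n → Sphere d, ∫⁻ e : Edges n m, ENNReal.ofReal
      (∏ b, ∏ i, edgeProb δ r x e b i (e b i)) ∂Measure.count = 1 := by
    intro x
    rw [lintegral_count, tsum_fintype, ← ENNReal.ofReal_sum_of_nonneg fun e _ =>
      Finset.prod_nonneg fun b _ => Finset.prod_nonneg fun i _ => edgeProb_nonneg hδ x e b i _,
      sum_prod_edgeProb hδ hr x, ENNReal.ofReal_one]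
  simp [this]

end GPM

end

/-! The plan is to fix the positions of the end points `a i`, `b i` of the prescribed edges, to
compute the probability of the edges given these positions, and to average. Nothing is lost by
this, since the probability vanishes (`expect_pinnedLaw_eq_zero`) unless the end points of each
prescribed edge are within reach of each other, and on that event it turns out not to depend on the
positions to leading order (`exists_abs_expect_pinnedLaw_sub_le`).

Given the positions, the edges of a new vertex are draws from a Pólya urn: the `m - i` in the
definition of the model makes the new vertex an ordinary colour of initial weight `(1 + δ) m`. For
an urn, the expectation of a product of rising factorials of the final weights, on the event that
some of the draws have prescribed colours, is an explicit product (`sum_urn`). Therefore the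
`potential`, which is the indicator of the prescribed edges that have been decided, times rising
factorials of the weights of the targets of the others, is multiplied in each step, on average, by
an explicit `potentialFactor` (`stepExpect_potential`). It interpolates between the constant
`∏ c, rise ((1 + δ) * m) (number of prescribed edges into c)` and the indicator of all the
prescribed edges.

The factor of a step depends on the past through the total weight in the cap around the new vertex.
If that weight is close to its typical value `p (2 + δ) m (j + 1)`, then the factor, averaged over
the position if the new vertex is not an end point, is close to `stepFactor`: the reciprocal of the
typical weight for each prescribed edge sent out in the step, times `((j + 1) / j) ^ (1 / (2 + δ))`
for each prescribed edge which has a target but no source yet. The product of these telescopes to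
the main term (`prod_stepFactor`, `mainTerm_eq`).

So the weight in caps has to be concentrated (`exists_expect_badInd_le`). The weight in the cap
around `y` is a sum of drifts and of a martingale with bounded increments, whose exponential
moments are those of a random walk (`expect_exp_fluct_le`). Up to bounded terms, the drift deviates
from its typical value by at most `1 / ((2 + δ) (j + 1))` times the deviation of the weight at `y`
and a mean of the deviations at the other points (`abs_drift_sub_le`). As the fractions of weight
that enter this mean integrate to `p` (`integral_share`), the mean deviation over the sphere
satisfies a linear recursion with the coefficient `2 / ((2 + δ) (j + 1))`. Because
`2 / (2 + δ) < 1`, a discrete Grönwall inequality keeps the deviations of smaller order than `j`,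
first on average and then at every point (`exists_abs_gap_le`). The positions of the at most `2 k`
end points are not random, but they only multiply the exponential moments by a constant.

The relative errors are of order `j ^ (-1 - c)` for a step of an ordinary vertex, since its
position is averaged, and of order `j ^ (-c)` for the at most `2 k` steps of end points. From the
first target on, these errors add up to the order `(min a) ^ (-c)` (`abs_sub_le_of_recursion`). The
exponent is `c = errExp δ`. -/

noncomputable section

namespace GPM

/-! ### Pólya urns with prescribed draws -/

/-- The rising factorial `w (w + 1) ⋯ (w + l - 1)`. -/
def rise (w : ℝ) (l : ℕ) : ℝ := ∏ q ∈ Finset.range l, (w + q)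

@[simp] lemma rise_zero (w : ℝ) : rise w 0 = 1 := by simp [rise]

lemma rise_succ (w : ℝ) (l : ℕ) : rise w (l + 1) = rise w l * (w + l) := by
  simp [rise, Finset.prod_range_succ]

lemma rise_succ' (w : ℝ) (l : ℕ) : rise w (l + 1) = w * rise (w + 1) l := by
  simp only [rise, Finset.prod_range_succ', Nat.cast_zero, add_zero]
  rw [mul_comm]
  congr 1
  refine Finset.prod_congr rfl fun q _ => ?_
  push_cast
  ring

section Urn

variable {K : Type*} [DecidableEq K]

/-- The number of draws of the colour `k`. -/
def drawCount {m : ℕ} (f : Fin m → K) (k : K) : ℕ := (Finset.univ.filter fun s => f s = k).card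

/-- The number of balls of colour `k` in a Pólya urn after the draws `f 0, …, f (i - 1)`. -/
def urnWeight {m : ℕ} (w : K → ℝ) (f : Fin m → K) (i : Fin m) (k : K) : ℝ :=
  w k + (Finset.univ.filter fun s => s < i ∧ f s = k).card

/-- The probability that the draw number `i` of a Pólya urn, which is restricted to the colours in
`B`, has the colour `k`. -/
def urnProb {m : ℕ} (B : Finset K) (w : K → ℝ) (f : Fin m → K) (i : Fin m) (k : K) : ℝ :=
  if k ∈ B then urnWeight w f i k / ∑ j ∈ B, urnWeight w f i j else 0

lemma drawCount_cons {m : ℕ} (k₀ : K) (f : Fin m → K) (k : K) :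
    drawCount (Fin.cons k₀ f : Fin (m + 1) → K) k = (if k₀ = k then 1 else 0) + drawCount f k := by
  simp only [drawCount, Finset.card_filter, Fin.sum_univ_succ, Fin.cons_zero, Fin.cons_succ]

lemma urnWeight_cons_succ {m : ℕ} (w : K → ℝ) (k₀ : K) (f : Fin m → K) (i : Fin m) :
    urnWeight w (Fin.cons k₀ f : Fin (m + 1) → K) i.succ =
      urnWeight (fun k => w k + if k₀ = k then 1 else 0) f i := by
  funext k
  simp only [urnWeight, Finset.card_filter, Fin.sum_univ_succ, Fin.cons_zero, Fin.cons_succ,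
    Fin.succ_lt_succ_iff, Fin.succ_pos, true_and]
  push_cast
  ring

lemma urnWeight_zero {m : ℕ} (w : K → ℝ) (f : Fin (m + 1) → K) : urnWeight w f 0 = w := by
  funext k
  simp [urnWeight]

lemma urnProb_cons_succ {m : ℕ} (B : Finset K) (w : K → ℝ) (k₀ : K) (f : Fin m → K) (i : Fin m) :
    urnProb B w (Fin.cons k₀ f : Fin (m + 1) → K) i.succ =
      urnProb B (fun k => w k + if k₀ = k then 1 else 0) f i := by
  funext k
  simp only [urnProb, urnWeight_cons_succ]

/-- The factor contributed by the draw number `i` to the expectation in `sum_urn`: a prescribed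
draw `spec i = some a` contributes the reciprocal of the number of balls. -/
def urnFactor {m : ℕ} (B : Finset K) (Z : ℝ) (spec : Fin m → Option K) (l : K → ℕ)
    (i : Fin m) : ℝ :=
  (spec i).elim
    (1 + (∑ k ∈ B, (l k + (Finset.univ.filter fun s => i < s ∧ spec s = some k).card : ℝ))
      / (Z + (i : ℕ)))
    (fun a => (if a ∈ B then 1 else 0) / (Z + (i : ℕ)))

/-- The expectation, for a Pólya urn, of a product of rising factorials of the final numbers of
balls, on the event that the prescribed draws occur. Rising factorials are the functions which
the transition of the urn multiplies by a constant. -/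
lemma sum_urn [Fintype K] {m : ℕ} (B : Finset K) (w : K → ℝ) (hZ : 0 < ∑ k ∈ B, w k)
    (spec : Fin m → Option K) (l : K → ℕ) :
    ∑ f : Fin m → K, (∏ i, urnProb B w f i (f i)) *
        ((if ∀ i a, spec i = some a → f i = a then 1 else 0) *
          ∏ k, rise (w k + drawCount f k) (l k)) =
      (∏ k, rise (w k) (l k + (Finset.univ.filter fun s => spec s = some k).card)) *
        ∏ i, urnFactor B (∑ k ∈ B, w k) spec l i := by
  induction m generalizing w with
  | zero => simp [drawCount]
  | succ m ih =>
    set Z := ∑ k ∈ B, w k with hZdef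
    set L : K → ℕ := fun k => l k + (Finset.univ.filter fun s => spec (Fin.succ s) = some k).card
      with hL
    set P := ∏ k, rise (w k) (L k) with hP
    set Φ := ∏ i : Fin m, urnFactor B Z spec l i.succ with hΦ
    have hcompat : ∀ (k₀ : K) (f : Fin m → K),
        (∀ i a, spec i = some a → (Fin.cons k₀ f : Fin (m + 1) → K) i = a) ↔
        ((∀ a, spec 0 = some a → k₀ = a) ∧ ∀ i a, spec (Fin.succ i) = some a → f i = a) := by
      intro k₀ f
      rw [Fin.forall_fin_succ]
      simp
    rw [← (Fin.consEquiv fun _ => K).sum_comp, Fintype.sum_prod_type]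
    have hinner : ∀ k₀ : K, (∑ f : Fin m → K, (∏ i, urnProb B w (Fin.cons k₀ f : Fin (m + 1) → K) i
          ((Fin.cons k₀ f : Fin (m + 1) → K) i)) *
        ((if ∀ i a, spec i = some a → (Fin.cons k₀ f : Fin (m + 1) → K) i = a then 1 else 0) *
          ∏ k, rise (w k + drawCount (Fin.cons k₀ f : Fin (m + 1) → K) k) (l k))) =
        (if k₀ ∈ B then (if ∀ a, spec 0 = some a → k₀ = a then 1 else 0) * (w k₀ / Z) *
          (∏ k, rise (w k + if k₀ = k then 1 else 0) (L k)) * Φ else 0) := by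
      intro k₀
      by_cases hk : k₀ ∈ B
      · rw [if_pos hk]
        have hZ' : ∑ k ∈ B, (w k + if k₀ = k then (1 : ℝ) else 0) = Z + 1 := by
          simp [Finset.sum_add_distrib, hk, hZdef]
        have hI := ih (fun k => w k + if k₀ = k then 1 else 0) (by rw [hZ']; linarith)
          (fun i => spec i.succ)
        have hF : ∏ i, urnFactor B (Z + 1) (fun i => spec i.succ) l i = Φ := by
          refine Finset.prod_congr rfl fun i _ => ?_
          simp only [urnFactor, Finset.card_filter, Fin.sum_univ_succ, Fin.succ_lt_succ_iff,
            Fin.not_lt_zero, false_and, if_false, zero_add, Fin.val_succ, Nat.cast_add,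
            Nat.cast_one, add_assoc, add_comm (1 : ℝ)]
        rw [hZ', hF] at hI
        rw [mul_assoc _ _ Φ, ← hI, Finset.mul_sum]
        refine Finset.sum_congr rfl fun f _ => ?_
        rw [Fin.prod_univ_succ]
        simp only [Fin.cons_zero, Fin.cons_succ, urnProb_cons_succ, drawCount_cons, hcompat]
        rw [urnProb, if_pos hk, urnWeight_zero, ← hZdef]
        push_cast
        simp only [add_assoc, ite_and]
        split_ifs <;> ring
      · rw [if_neg hk]
        refine Finset.sum_eq_zero fun f _ => ?_
        rw [Fin.prod_univ_succ]
        simp [urnProb, hk]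
    refine (Finset.sum_congr rfl fun k₀ _ => (Finset.sum_congr rfl fun f _ => ?_).trans
      (hinner k₀)).trans ?_
    · congr
    have hrise : ∀ k₀, w k₀ * (∏ k, rise (w k + if k₀ = k then 1 else 0) (L k)) =
        P * (w k₀ + L k₀) := by
      intro k₀
      have h1 : ∀ k ∈ Finset.univ.erase k₀,
          rise (w k + if k₀ = k then 1 else 0) (L k) = rise (w k) (L k) := by
        intro k hk
        rw [if_neg (Finset.ne_of_mem_erase hk).symm, add_zero]
      rw [hP, ← Finset.mul_prod_erase _ _ (Finset.mem_univ k₀), Finset.prod_congr rfl h1,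
        ← Finset.mul_prod_erase (a := k₀) Finset.univ (fun k => rise (w k) (L k))
          (Finset.mem_univ k₀), if_pos rfl, ← mul_assoc, ← rise_succ', rise_succ]
      ring
    rw [← Finset.sum_filter, Finset.filter_mem_eq_inter, Finset.univ_inter, Fin.prod_univ_succ]
    have hcard : ∀ k, (Finset.univ.filter fun s => spec s = some k).card =
        (if spec 0 = some k then 1 else 0) +
          (Finset.univ.filter fun s => spec (Fin.succ s) = some k).card := by
      intro k
      simp only [Finset.card_filter, Fin.sum_univ_succ]
    have hterm : ∀ k₀, (if ∀ a, spec 0 = some a → k₀ = a then (1 : ℝ) else 0) * (w k₀ / Z) *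
          (∏ k, rise (w k + if k₀ = k then 1 else 0) (L k)) * Φ =
        (if ∀ a, spec 0 = some a → k₀ = a then 1 else 0) * (P * (w k₀ + L k₀) / Z * Φ) := by
      intro k₀
      rw [← hrise]
      ring
    rw [Finset.sum_congr rfl fun k₀ _ => hterm k₀]
    rw [← hΦ]
    rcases h0 : spec 0 with _ | a
    · have hcard2 : ∀ k,
          (Finset.univ.filter fun s => (0 : Fin (m + 1)) < s ∧ spec s = some k).card
          = (Finset.univ.filter fun s => spec (Fin.succ s) = some k).card := by
        intro k
        simp only [Finset.card_filter, Fin.sum_univ_succ, Fin.succ_pos, true_and, lt_irrefl,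
          false_and, if_false, zero_add]
      have hU : urnFactor B Z spec l 0 = 1 + (∑ k ∈ B, (L k : ℝ)) / Z := by
        simp only [urnFactor, h0, Option.elim_none, hcard2, Fin.val_zero, Nat.cast_zero, add_zero,
          hL, Nat.cast_add]
      have hR : ∏ k, rise (w k) (l k + (Finset.univ.filter fun s => spec s = some k).card) = P := by
        simp only [hcard, h0, reduceCtorEq, if_false, zero_add, hP, hL]
      rw [hU, hR]
      simp only [reduceCtorEq, false_imp_iff, forall_true_iff, if_true, one_mul]
      rw [← Finset.sum_mul, ← Finset.sum_div, ← Finset.mul_sum, Finset.sum_add_distrib, ← hZdef]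
      field_simp
    · have hU : urnFactor B Z spec l 0 = (if a ∈ B then 1 else 0) / Z := by
        simp only [urnFactor, h0, Option.elim_some, Fin.val_zero, Nat.cast_zero, add_zero]
      have hR : ∏ k, rise (w k) (l k + (Finset.univ.filter fun s => spec s = some k).card) =
          P * (w a + L a) := by
        have h1 : ∀ k ∈ Finset.univ.erase a, rise (w k) (l k +
            (Finset.univ.filter fun s => spec s = some k).card) = rise (w k) (L k) := by
          intro k hk
          rw [hcard, h0, if_neg (by simpa using (Finset.ne_of_mem_erase hk).symm), zero_add]
        rw [hP, ← Finset.mul_prod_erase _ _ (Finset.mem_univ a),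
          ← Finset.mul_prod_erase (a := a) Finset.univ (fun k => rise (w k) (L k))
          (Finset.mem_univ a), Finset.prod_congr rfl h1, hcard, h0, if_pos rfl, add_left_comm,
          add_comm 1, rise_succ]
        ring
      rw [hU, hR]
      simp only [Option.some.injEq, forall_eq', ite_mul, one_mul, zero_mul]
      rw [Finset.sum_ite_eq']
      split_ifs <;> ring

end Urn

/-! ### Weights and the transition probabilities -/

section Weights

variable {d n m : ℕ}

/-- The number of edges into `k` sent out by the vertices of index less than `j`. -/
def indegree (j : ℕ) (e : Edges n m) (k : Fin n) : ℕ :=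
  ∑ u : Fin n, ∑ s : Fin m, if (u : ℕ) < j ∧ e u s = k then 1 else 0

/-- The attractiveness of the vertex `k` when the vertices of index less than `j` have sent out
their edges. A vertex starts with weight `(1 + δ) m`. -/
def weight (δ : ℝ) (j : ℕ) (e : Edges n m) (k : Fin n) : ℝ := (1 + δ) * m + indegree j e k

/-- The vertices to which `b` may send its edges. -/
def near (r : ℝ) (x : Fin n → Sphere d) (b : Fin n) : Finset (Fin n) :=
  Finset.univ.filter fun k => k ≤ b ∧ dist (x b) (x k) ≤ r

/-- The edge configurations without edges to later vertices. -/
def Valid (e : Edges n m) : Prop := ∀ u s, e u s ≤ u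

/-- The conditional probability that the edges of `b` are given by `f`. -/
def stepProb (δ r : ℝ) (x : Fin n → Sphere d) (e : Edges n m) (b : Fin n) (f : Fin m → Fin n) : ℝ :=
  ∏ i, edgeProb δ r x (Function.update e b f) b i (f i)

lemma mem_near {r : ℝ} {x : Fin n → Sphere d} {b k : Fin n} :
    k ∈ near r x b ↔ k ≤ b ∧ dist (x b) (x k) ≤ r := by
  simp [near]

lemma self_mem_near {r : ℝ} (hr : 0 ≤ r) (x : Fin n → Sphere d) (b : Fin n) : b ∈ near r x b := by
  simp [near, hr]

/-- The degree of a vertex counts the edges which it has sent out and those which it has received.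
-/
lemma degree_eq (e : Edges n m) (b : Fin n) (i : Fin m) (k : Fin n) :
    degree e b i k = (if k < b then m else 0) + (if k = b then (i : ℕ) else 0) + indegree b e k +
      (Finset.univ.filter fun s => s < i ∧ e b s = k).card := by
  have h : ∀ (u : Fin n) (s : Fin m), (if u < b ∨ (u = b ∧ s < i) then
      (if u = k then 1 else 0) + (if e u s = k then 1 else 0) else 0) =
      (if u = k then (if k < b then 1 else 0) else 0)
      + (if u = k then (if k = b then (if s < i then 1 else 0) else 0) else 0)
      + (if (u : ℕ) < (b : ℕ) ∧ e u s = k then 1 else 0)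
      + (if u = b then (if s < i ∧ e u s = k then 1 else 0) else 0) := by
    intro u s
    by_cases h1 : u < b
    · have h2 : u ≠ b := h1.ne
      by_cases h3 : u = k
      · subst h3
        simp [h1, h2]
      · simp [h1, h2, h3]
    · by_cases h2 : u = b
      · subst h2
        by_cases h3 : u = k
        · subst h3
          by_cases h4 : s < i <;> simp [h4]
        · by_cases h4 : s < i <;> simp [h4, h3]
      · by_cases h3 : u = k
        · subst h3
          simp [h1, h2]
        · simp [h1, h2, h3]
  unfold degree indegree
  simp only [h, Finset.sum_add_distrib]
  congr 1
  · congr 1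
    congr 1
    · rw [Finset.sum_comm]
      simp only [Finset.sum_ite_eq', Finset.mem_univ, if_true]
      split_ifs <;> simp
    · rw [Finset.sum_comm]
      simp only [Finset.sum_ite_eq', Finset.mem_univ, if_true]
      split_ifs
      · rw [← Finset.card_filter, show Finset.univ.filter (fun s => s < i) = Finset.Iio i by
          ext; simp, Fin.card_Iio]
      · simp
  · rw [Finset.sum_comm]
    simp only [Finset.sum_ite_eq', Finset.mem_univ, if_true, Finset.card_filter]

lemma indegree_congr {j : ℕ} {e e' : Edges n m} (h : ∀ u : Fin n, (u : ℕ) < j → e u = e' u) :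
    indegree j e = indegree j e' := by
  funext k
  unfold indegree
  refine Finset.sum_congr rfl fun u _ => Finset.sum_congr rfl fun s _ => ?_
  by_cases hu : (u : ℕ) < j
  · rw [h u hu]
  · simp [hu]

lemma weight_congr {δ : ℝ} {j : ℕ} {e e' : Edges n m}
    (h : ∀ u : Fin n, (u : ℕ) < j → e u = e' u) : weight δ j e = weight δ j e' := by
  funext k
  rw [weight, weight, indegree_congr h]

lemma indegree_update (e : Edges n m) (b : Fin n) (f : Fin m → Fin n) {j : ℕ} (hj : j ≤ b) :
    indegree j (Function.update e b f) = indegree j e :=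
  indegree_congr fun u hu => Function.update_of_ne (Fin.ne_of_lt (by omega)) _ _

lemma indegree_succ (e : Edges n m) (b : Fin n) (k : Fin n) :
    indegree (b + 1) e k = indegree b e k + drawCount (e b) k := by
  unfold indegree drawCount
  rw [Finset.card_filter]
  have h : ∀ (u : Fin n) (s : Fin m), (if (u : ℕ) < b + 1 ∧ e u s = k then 1 else 0) =
      (if (u : ℕ) < b ∧ e u s = k then 1 else 0) +
        (if u = b then (if e u s = k then 1 else 0) else 0) := by
    intro u s
    by_cases h2 : u = b
    · subst h2
      simp
    · have : (u : ℕ) ≠ b := fun h => h2 (Fin.ext h)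
      have : (u : ℕ) < b + 1 ↔ (u : ℕ) < b := by omega
      simp [this, h2]
  simp only [h, Finset.sum_add_distrib]
  congr 1
  rw [Finset.sum_comm]
  simp only [Finset.sum_ite_eq', Finset.mem_univ, if_true]

lemma weight_succ_update (δ : ℝ) (e : Edges n m) (b : Fin n) (f : Fin m → Fin n) (k : Fin n) :
    weight δ (b + 1) (Function.update e b f) k = weight δ b e k + drawCount f k := by
  rw [weight, indegree_succ, indegree_update e b f le_rfl, Function.update_self, weight]
  push_cast
  ring

lemma indegree_eq_zero {e : Edges n m} (he : Valid e) {j : ℕ} {k : Fin n} (hk : j ≤ k) :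
    indegree j e k = 0 := by
  unfold indegree
  refine Finset.sum_eq_zero fun u _ => Finset.sum_eq_zero fun s _ => if_neg ?_
  rintro ⟨h1, h2⟩
  have h3 : (e u s : ℕ) ≤ u := he u s
  rw [h2] at h3
  omega

lemma weight_eq {δ : ℝ} {e : Edges n m} (he : Valid e) {j : ℕ} {k : Fin n} (hk : j ≤ k) :
    weight δ j e k = (1 + δ) * m := by
  simp [weight, indegree_eq_zero he hk]

lemma weight_nonneg {δ : ℝ} (hδ : 0 < δ) (j : ℕ) (e : Edges n m) (k : Fin n) :
    0 ≤ weight δ j e k := by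
  unfold weight
  positivity

lemma weight_ge {δ : ℝ} (j : ℕ) (e : Edges n m) (k : Fin n) :
    (1 + δ) * m ≤ weight δ j e k := by
  unfold weight
  have : (0 : ℝ) ≤ indegree j e k := by positivity
  linarith

lemma indegree_le (j : ℕ) (hj : j ≤ n) (e : Edges n m) (k : Fin n) : indegree j e k ≤ m * j := by
  unfold indegree
  calc _ ≤ ∑ u : Fin n, ∑ _s : Fin m, (if (u : ℕ) < j then 1 else 0) := by
        refine Finset.sum_le_sum fun u _ => Finset.sum_le_sum fun s _ => ?_
        split_ifs <;> simp_all
    _ = m * j := by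
        simp only [Finset.sum_const, Finset.card_univ, Fintype.card_fin, smul_eq_mul,
          ← Finset.mul_sum]
        congr 1
        rw [← Finset.card_filter, Fin.card_filter_val_lt]
        omega

/-- The edges of a vertex are draws from a Pólya urn. The term `m - i` in the weight of the new
vertex makes up for the edges which it has not sent out yet, so that it, too, is a colour of the
urn with the initial weight `(1 + δ) m`. -/
lemma edgeProb_update_eq {δ r : ℝ} (x : Fin n → Sphere d) (hr : 0 ≤ r) (e : Edges n m) (b : Fin n)
    (f : Fin m → Fin n) (i : Fin m) (k : Fin n) :
    edgeProb δ r x (Function.update e b f) b i k = urnProb (near r x b) (weight δ b e) f i k := by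
  have hdeg : ∀ k, k ≤ b → (degree (Function.update e b f) b i k : ℝ) + m * δ +
      (if k = b then (m : ℝ) - (i : ℕ) else 0) = urnWeight (weight δ b e) f i k := by
    intro k hk
    rw [degree_eq, indegree_update e b f le_rfl, Function.update_self, urnWeight, weight]
    rcases hk.lt_or_eq with h | h
    · simp only [h, h.ne, if_true, if_false]
      push_cast
      ring
    · subst h
      simp only [lt_irrefl, if_true, if_false]
      push_cast
      ring
  have htot : totalWeight δ r x (Function.update e b f) b i =
      ∑ j ∈ near r x b, urnWeight (weight δ b e) f i j := by
    have h1 : ∑ j ∈ near r x b, (if j = b then (m : ℝ) - (i : ℕ) else 0) = (m : ℝ) - (i : ℕ) := by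
      rw [Finset.sum_ite_eq', if_pos (self_mem_near hr x b)]
    rw [← Finset.sum_congr rfl fun j hj => hdeg j (mem_near.1 hj).1, Finset.sum_add_distrib, h1,
      totalWeight, near, Finset.sum_filter]
  unfold edgeProb urnProb
  rw [htot]
  rcases lt_trichotomy k b with hk | hk | hk
  · rw [if_pos hk, ← hdeg k hk.le, if_neg hk.ne, add_zero]
    simp only [mem_near, hk.le, true_and]
    split_ifs <;> simp
  · subst hk
    rw [if_neg (lt_irrefl _), if_pos rfl, if_pos (self_mem_near hr x k), ← hdeg k le_rfl,
      if_pos rfl]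
  · rw [if_neg hk.not_gt, if_neg hk.ne', if_neg]
    simp [mem_near, hk]

lemma stepProb_eq {δ r : ℝ} (x : Fin n → Sphere d) (hr : 0 ≤ r) (e : Edges n m) (b : Fin n)
    (f : Fin m → Fin n) :
    stepProb δ r x e b f = ∏ i, urnProb (near r x b) (weight δ b e) f i (f i) :=
  Finset.prod_congr rfl fun i _ => edgeProb_update_eq x hr e b f i (f i)

/-- The total weight of the vertices to which `b` may send its first edge. -/
def capWeight (δ r : ℝ) (x : Fin n → Sphere d) (e : Edges n m) (b : Fin n) : ℝ :=
  ∑ k ∈ near r x b, weight δ b e k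

lemma capWeight_ge {δ r : ℝ} (hδ : 0 < δ) (hr : 0 ≤ r) (x : Fin n → Sphere d)
    (e : Edges n m) (b : Fin n) : (1 + δ) * m ≤ capWeight δ r x e b :=
  (weight_ge b e b).trans (Finset.single_le_sum
    (f := fun k => weight δ b e k) (fun k _ => weight_nonneg hδ b e k) (self_mem_near hr x b))

lemma stepProb_nonneg {δ r : ℝ} (hδ : 0 < δ) (x : Fin n → Sphere d)
    (e : Edges n m) (b : Fin n) (f : Fin m → Fin n) : 0 ≤ stepProb δ r x e b f :=
  Finset.prod_nonneg fun i _ => edgeProb_nonneg hδ x _ b i _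

/-- `sum_urn`, for the edges of one vertex. -/
lemma sum_stepProb_mul {δ r : ℝ} (hδ : 0 < δ) (hr : 0 ≤ r) (hm : 1 ≤ m) (x : Fin n → Sphere d)
    (e : Edges n m) (b : Fin n) (spec : Fin m → Option (Fin n)) (l : Fin n → ℕ) :
    ∑ f : Fin m → Fin n, stepProb δ r x e b f *
        ((if ∀ i a, spec i = some a → f i = a then 1 else 0) *
          ∏ k, rise (weight δ (b + 1) (Function.update e b f) k) (l k)) =
      (∏ k, rise (weight δ b e k)
        (l k + (Finset.univ.filter fun s => spec s = some k).card)) *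
        ∏ i, urnFactor (near r x b) (capWeight δ r x e b) spec l i := by
  have h0 : (0 : ℝ) < m := by exact_mod_cast hm
  have hZ : 0 < ∑ k ∈ near r x b, weight δ b e k :=
    lt_of_lt_of_le (by positivity) (capWeight_ge hδ hr x e b)
  simp only [stepProb_eq x hr, weight_succ_update]
  convert sum_urn _ _ hZ spec l using 6
  rfl

lemma sum_stepProb {δ r : ℝ} (hδ : 0 < δ) (hr : 0 ≤ r) (hm : 1 ≤ m) (x : Fin n → Sphere d)
    (e : Edges n m) (b : Fin n) : ∑ f : Fin m → Fin n, stepProb δ r x e b f = 1 := by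
  have h := sum_stepProb_mul hδ hr hm x e b (fun _ => none) (fun _ => 0)
  simpa [urnFactor] using h

/-- The expected number of the edges of `b` into `k`: the edges are not independent, but each of
them ends at `k` with the same probability. -/
lemma sum_stepProb_drawCount {δ r : ℝ} (hδ : 0 < δ) (hr : 0 ≤ r) (hm : 1 ≤ m)
    (x : Fin n → Sphere d) (e : Edges n m) (b k : Fin n) :
    ∑ f : Fin m → Fin n, stepProb δ r x e b f * drawCount f k =
      m * ((if k ∈ near r x b then weight δ b e k else 0) / capWeight δ r x e b) := by
  have h0 : (0 : ℝ) < m := by exact_mod_cast hm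
  have hZ : 0 < capWeight δ r x e b :=
    lt_of_lt_of_le (by positivity) (capWeight_ge hδ hr x e b)
  have h := sum_stepProb_mul hδ hr hm x e b (fun _ => none) (fun j => if j = k then 1 else 0)
  have hr1 : ∀ w : Fin n → ℝ, ∏ j, rise (w j) (if j = k then 1 else 0) = w k := by
    intro w
    rw [Finset.prod_eq_single k]
    · simp [rise]
    · intro j _ hj
      simp [hj]
    · simp
  have htel : ∀ M : ℕ, ∏ i : Fin M, (1 + 1 / (capWeight δ r x e b + (i : ℕ))) =
      (capWeight δ r x e b + M) / capWeight δ r x e b := by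
    intro M
    induction M with
    | zero => simp [hZ.ne']
    | succ M ih =>
      rw [Fin.prod_univ_castSucc]
      simp only [Fin.val_castSucc, Fin.val_last]
      rw [ih]
      have : capWeight δ r x e b + M ≠ 0 := by positivity
      field_simp
      push_cast
      ring
  simp only [reduceCtorEq, false_imp_iff, forall_true_iff, if_true, one_mul,
    Finset.filter_false, Finset.card_empty, add_zero, hr1, urnFactor, Option.elim_none, and_false,
    Nat.cast_zero, weight_succ_update, mul_add, Finset.sum_add_distrib, ← Finset.sum_mul,
    sum_stepProb hδ hr hm, one_mul] at h
  have hsum : (∑ j ∈ near r x b, (((if j = k then 1 else 0 : ℕ)) : ℝ)) =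
      if k ∈ near r x b then 1 else 0 := by
    push_cast
    rw [Finset.sum_ite_eq']
  rw [hsum] at h
  by_cases hk : k ∈ near r x b
  · simp only [hk, if_true, htel] at h ⊢
    have : (capWeight δ r x e b + m) / capWeight δ r x e b = 1 + m / capWeight δ r x e b := by
      field_simp
    rw [this] at h
    linear_combination h
  · simp only [hk, if_false, zero_div, add_zero, Finset.prod_const_one] at h ⊢
    linarith

lemma stepProb_eq_zero {δ r : ℝ} (x : Fin n → Sphere d) (e : Edges n m) (b : Fin n)
    {f : Fin m → Fin n} {i : Fin m} (hf : b < f i) : stepProb δ r x e b f = 0 :=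
  Finset.prod_eq_zero (Finset.mem_univ i) (by
    simp [edgeProb, hf.not_gt, hf.ne'])

end Weights

/-! ### Expectations and the tower property -/

section Expectation

variable {d n m : ℕ} {δ r : ℝ}

/-- A bounded measurable function of the positions and the edges. -/
structure Nice (G : (Fin n → Sphere d) → Edges n m → ℝ) : Prop where
  meas : ∀ e, Measurable fun x => G x e
  bdd : ∃ C, ∀ x e, |G x e| ≤ C

/-- `G` is a function of the positions and the edges of the vertices of index less than `j`. -/
def DependsBefore (j : ℕ) (G : (Fin n → Sphere d) → Edges n m → ℝ) : Prop :=
  ∀ x x' e e', (∀ u : Fin n, (u : ℕ) < j → x u = x' u) → (∀ u : Fin n, (u : ℕ) < j → e u = e' u) →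
    G x e = G x' e'

lemma DependsBefore.mono {j j' : ℕ} (h : j ≤ j') {G : (Fin n → Sphere d) → Edges n m → ℝ}
    (hG : DependsBefore j G) : DependsBefore j' G :=
  fun x x' e e' hx he => hG x x' e e' (fun u hu => hx u (by omega)) (fun u hu => he u (by omega))

lemma DependsBefore.update {j : ℕ} {G : (Fin n → Sphere d) → Edges n m → ℝ}
    (hG : DependsBefore j G) {b : Fin n} (hb : j ≤ b) (x : Fin n → Sphere d) (e : Edges n m)
    (y : Sphere d) (f : Fin m → Fin n) :
    G (Function.update x b y) (Function.update e b f) = G x e :=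
  hG _ _ _ _ (fun u hu => Function.update_of_ne (Fin.ne_of_lt (by omega)) _ _)
    (fun u hu => Function.update_of_ne (Fin.ne_of_lt (by omega)) _ _)

lemma measurable_edgeProb (e : Edges n m) (b : Fin n) (i : Fin m) (k : Fin n) :
    Measurable fun x : Fin n → Sphere d => edgeProb δ r x e b i k := by
  have hm : ∀ j k : Fin n, MeasurableSet {x : Fin n → Sphere d | dist (x j) (x k) ≤ r} :=
    fun j k => measurableSet_le (by fun_prop) measurable_const
  have hw : Measurable fun x : Fin n → Sphere d => totalWeight δ r x e b i := by
    unfold totalWeight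
    refine Measurable.add_const (Finset.measurable_sum _ fun j _ => ?_) _
    exact Measurable.ite ((MeasurableSet.const _).inter (hm b j)) measurable_const measurable_const
  unfold edgeProb
  refine Measurable.ite (MeasurableSet.const (k < b)) (Measurable.div ?_ hw) ?_
  · exact Measurable.ite (hm _ _) measurable_const measurable_const
  · exact Measurable.ite (MeasurableSet.const (k = b)) (measurable_const.div hw) measurable_const

lemma measurable_stepProb (e : Edges n m) (b : Fin n) (f : Fin m → Fin n) :
    Measurable fun x : Fin n → Sphere d => stepProb δ r x e b f :=
  Finset.measurable_prod _ fun i _ => measurable_edgeProb _ b i _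

/-- The density of the positions and edges when the vertices of index less than `j` have sent out
their edges. The vertices which have not yet done so get only self-loops. -/
def density (δ r : ℝ) (j : ℕ) (x : Fin n → Sphere d) (e : Edges n m) : ℝ :=
  ∏ b : Fin n, if (b : ℕ) < j then ∏ i, edgeProb δ r x e b i (e b i)
    else if e b = fun _ => b then 1 else 0

lemma measurable_density' (j : ℕ) (e : Edges n m) :
    Measurable fun x : Fin n → Sphere d => density δ r j x e := by
  refine Finset.measurable_prod _ fun b _ => ?_
  split_ifs
  · exact Finset.measurable_prod _ fun i _ => measurable_edgeProb _ b i _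
  · exact measurable_const
  · exact measurable_const

lemma density_nonneg (hδ : 0 < δ) (j : ℕ) (x : Fin n → Sphere d) (e : Edges n m) :
    0 ≤ density δ r j x e := by
  refine Finset.prod_nonneg fun b _ => ?_
  split_ifs
  · exact Finset.prod_nonneg fun i _ => edgeProb_nonneg hδ x _ b i _
  · exact zero_le_one
  · exact le_rfl

lemma edgeProb_le_one (hδ : 0 < δ) (hr : 0 ≤ r) (x : Fin n → Sphere d) (e : Edges n m) (b : Fin n)
    (i : Fin m) (k : Fin n) : edgeProb δ r x e b i k ≤ 1 := by
  rw [← sum_edgeProb hδ hr x e b i]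
  exact Finset.single_le_sum (f := fun k => edgeProb δ r x e b i k)
    (fun k _ => edgeProb_nonneg hδ x e b i k) (Finset.mem_univ k)

lemma density_le_one (hδ : 0 < δ) (hr : 0 ≤ r) (j : ℕ) (x : Fin n → Sphere d) (e : Edges n m) :
    density δ r j x e ≤ 1 := by
  refine Finset.prod_le_one (fun b _ => ?_) fun b _ => ?_
  · split_ifs
    · exact Finset.prod_nonneg fun i _ => edgeProb_nonneg hδ x _ b i _
    · exact zero_le_one
    · exact le_rfl
  · split_ifs
    · exact Finset.prod_le_one (fun i _ => edgeProb_nonneg hδ x _ b i _)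
        fun i _ => edgeProb_le_one hδ hr x _ b i _
    · exact le_rfl
    · exact zero_le_one

lemma density_eq_zero (j : ℕ) (x : Fin n → Sphere d) {e : Edges n m} (he : ¬ Valid e) :
    density δ r j x e = 0 := by
  simp only [Valid, not_forall, not_le] at he
  obtain ⟨u, s, hus⟩ := he
  refine Finset.prod_eq_zero (Finset.mem_univ u) ?_
  split_ifs with h1 h2
  · exact Finset.prod_eq_zero (Finset.mem_univ s) (by simp [edgeProb, hus.not_gt, hus.ne'])
  · rw [h2] at hus
    exact absurd hus (lt_irrefl _)
  · rfl

lemma edgeProb_congr_pos {x x' : Fin n → Sphere d} (e : Edges n m) {b : Fin n}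
    (h : ∀ k, k ≤ b → x k = x' k) (i : Fin m) (k : Fin n) :
    edgeProb δ r x e b i k = edgeProb δ r x' e b i k := by
  have hw : totalWeight δ r x e b i = totalWeight δ r x' e b i := by
    unfold totalWeight
    congr 1
    refine Finset.sum_congr rfl fun j _ => ?_
    by_cases hj : j ≤ b
    · rw [h b le_rfl, h j hj]
    · simp [hj]
  unfold edgeProb
  rw [hw]
  by_cases hk : k < b
  · rw [h b le_rfl, h k hk.le]
  · simp [hk]

lemma density_update (x : Fin n → Sphere d) (b : Fin n) (y : Sphere d) (e : Edges n m) :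
    density δ r b (Function.update x b y) e = density δ r b x e := by
  unfold density
  refine Finset.prod_congr rfl fun u _ => ?_
  by_cases hu : (u : ℕ) < b
  · simp only [hu, if_true]
    refine Finset.prod_congr rfl fun i _ => ?_
    refine edgeProb_congr_pos _ (fun k hk => ?_) _ _
    rw [Function.update_of_ne]
    rintro rfl
    exact absurd (show (k : ℕ) ≤ u from hk) (by omega)
  · simp only [hu, if_false]

/-- One step multiplies the density by the conditional probability of the new edges. -/
lemma density_succ (x : Fin n → Sphere d) (b : Fin n) (e : Edges n m) (y : Sphere d)
    (f : Fin m → Fin n) :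
    (if e b = fun _ => b then density δ r (b + 1) x (Function.update e b f) else 0) =
      density δ r b (Function.update x b y) e * stepProb δ r x e b f := by
  have h1 : ∀ u : Fin n, u ≠ b → (if (u : ℕ) < b + 1 then
      ∏ i, edgeProb δ r x (Function.update e b f) u i (Function.update e b f u i)
    else if Function.update e b f u = fun _ => u then 1 else 0) =
      (if (u : ℕ) < b then ∏ i, edgeProb δ r (Function.update x b y) e u i (e u i)
    else if e u = fun _ => u then 1 else 0) := by
    intro u hu
    have h2 : (u : ℕ) ≠ b := fun h => hu (Fin.ext h)
    have h3 : (u : ℕ) < b + 1 ↔ (u : ℕ) < b := by omega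
    rw [Function.update_of_ne hu]
    simp only [h3]
    refine ite_congr rfl (fun h => Finset.prod_congr rfl fun i _ => ?_) fun _ => rfl
    rw [edgeProb_congr δ r x _ e u i]
    · refine edgeProb_congr_pos _ (fun k hk => ?_) _ _
      rw [Function.update_of_ne]
      rintro rfl
      exact absurd (show (k : ℕ) ≤ u from hk) (by omega)
    · intro v s hv
      rw [Function.update_of_ne]
      rintro rfl
      rcases hv with hv | ⟨hv, -⟩
      · exact absurd (show (v : ℕ) < u from hv) (by omega)
      · exact hu hv.symm
  unfold density
  rw [← Finset.mul_prod_erase _ _ (Finset.mem_univ b),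
    ← Finset.mul_prod_erase _ (fun u : Fin n => if (u : ℕ) < b then
        ∏ i, edgeProb δ r (Function.update x b y) e u i (e u i)
      else if e u = fun _ => u then 1 else 0) (Finset.mem_univ b),
    Finset.prod_congr rfl fun u hu => h1 u (Finset.ne_of_mem_erase hu)]
  simp only [lt_add_iff_pos_right, Nat.lt_one_iff, if_true, lt_irrefl, if_false,
    Function.update_self, ite_mul, one_mul, zero_mul, stepProb]
  split_ifs
  · ring
  · rfl

/-- A sum over all edge configurations, with the edges of `b` chosen last. -/
lemma sum_edges (b : Fin n) (c : Fin m → Fin n) (h : Edges n m → ℝ) :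
    ∑ e, h e = ∑ e : Edges n m, ∑ f, if e b = c then h (Function.update e b f) else 0 := by
  rw [Finset.sum_comm, ← Finset.sum_fiberwise (Finset.univ : Finset (Edges n m)) (fun e => e b)]
  refine Finset.sum_congr rfl fun f _ => ?_
  rw [← Finset.sum_filter]
  refine Finset.sum_bij' (fun e _ => Function.update e b c) (fun e _ => Function.update e b f)
    ?_ ?_ ?_ ?_ ?_
  · intro e _
    simp
  · intro e _
    simp
  · intro e he
    simp only [Finset.mem_filter, Finset.mem_univ, true_and] at he
    simp [← he]
  · intro e he
    simp only [Finset.mem_filter, Finset.mem_univ, true_and] at he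
    simp [← he]
  · intro e he
    simp only [Finset.mem_filter, Finset.mem_univ, true_and] at he
    simp [← he]

variable (δ r) (μ : Fin n → Measure (Sphere d))

/-- The expectation of `G` when the vertices of index less than `j` have sent out their edges, and
the positions are independent with the laws `μ b`. -/
def expect (j : ℕ) (G : (Fin n → Sphere d) → Edges n m → ℝ) : ℝ :=
  ∫ x, ∑ e, density δ r j x e * G x e ∂Measure.pi μ

/-- The conditional expectation of `G` given everything but the position and the edges of `b`. -/
def stepExpect (b : Fin n) (G : (Fin n → Sphere d) → Edges n m → ℝ) (x : Fin n → Sphere d)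
    (e : Edges n m) : ℝ :=
  ∫ y, ∑ f, stepProb δ r (Function.update x b y) e b f *
    G (Function.update x b y) (Function.update e b f) ∂μ b

variable {δ r} {μ}
variable [∀ b, IsProbabilityMeasure (μ b)]

lemma measurePreserving_update (b : Fin n) :
    MeasurePreserving (fun z : (Fin n → Sphere d) × Sphere d => Function.update z.1 b z.2)
      ((Measure.pi μ).prod (μ b)) (Measure.pi μ) := by
  refine ⟨measurable_update', ?_⟩
  symm
  refine Measure.pi_eq fun s hs => ?_
  rw [Measure.map_apply measurable_update' (MeasurableSet.univ_pi hs)]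
  have : (fun z : (Fin n → Sphere d) × Sphere d => Function.update z.1 b z.2) ⁻¹' Set.univ.pi s =
      (Set.univ.pi (Function.update s b Set.univ)) ×ˢ s b := by
    ext ⟨x, y⟩
    simp only [Set.mem_preimage, Set.mem_pi, Set.mem_univ, true_imp_iff, Set.mem_prod]
    constructor
    · intro h
      refine ⟨fun i => ?_, by simpa using h b⟩
      by_cases hi : i = b
      · subst hi
        simp
      · simpa [hi] using h i
    · rintro ⟨h1, h2⟩ i
      by_cases hi : i = b
      · subst hi
        simpa using h2
      · simpa [hi] using h1 i
  rw [this, Measure.prod_prod, Measure.pi_pi, ← Finset.prod_erase_mul _ _ (Finset.mem_univ b),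
    ← Finset.prod_erase_mul _ (fun i => μ i (s i)) (Finset.mem_univ b)]
  simp only [Function.update_self, measure_univ, mul_one]
  congr 1
  refine Finset.prod_congr rfl fun i hi => ?_
  rw [Function.update_of_ne (Finset.ne_of_mem_erase hi)]

/-- The coordinate `b` may be resampled. -/
lemma integral_update (b : Fin n) {h : (Fin n → Sphere d) → ℝ} (hm : Measurable h)
    {C : ℝ} (hC : ∀ x, |h x| ≤ C) :
    ∫ x, h x ∂Measure.pi μ = ∫ x, ∫ y, h (Function.update x b y) ∂μ b ∂Measure.pi μ := by
  have hp := measurePreserving_update (μ := μ) b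
  rw [← hp.map_eq, integral_map hp.measurable.aemeasurable hm.aestronglyMeasurable, integral_prod,
    hp.map_eq]
  refine Integrable.of_bound (hm.comp measurable_update').aestronglyMeasurable C ?_
  exact Filter.Eventually.of_forall fun z => hC _

lemma Nice.integrable {G : (Fin n → Sphere d) → Edges n m → ℝ} (hG : Nice G) (hδ : 0 < δ)
    (hr : 0 ≤ r) (j : ℕ) (e : Edges n m) :
    Integrable (fun x => density δ r j x e * G x e) (Measure.pi μ) := by
  obtain ⟨C, hC⟩ := hG.bdd
  refine Integrable.of_bound ((measurable_density' j e).mul (hG.meas e)).aestronglyMeasurable C ?_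
  refine Filter.Eventually.of_forall fun x => ?_
  rw [Real.norm_eq_abs, abs_mul, abs_of_nonneg (density_nonneg hδ j x e)]
  exact (mul_le_of_le_one_left (abs_nonneg _) (density_le_one hδ hr j x e)).trans (hC x e)

lemma stepProb_le_one (hδ : 0 < δ) (hr : 0 ≤ r) (x : Fin n → Sphere d) (e : Edges n m) (b : Fin n)
    (f : Fin m → Fin n) : stepProb δ r x e b f ≤ 1 :=
  Finset.prod_le_one (fun i _ => edgeProb_nonneg hδ x _ b i _)
    fun i _ => edgeProb_le_one hδ hr x _ b i _

lemma Nice.measurable_step {G : (Fin n → Sphere d) → Edges n m → ℝ} (hG : Nice G) (b : Fin n)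
    (e : Edges n m) (f : Fin m → Fin n) :
    Measurable fun x => stepProb δ r x e b f * G x (Function.update e b f) :=
  (measurable_stepProb _ _ _).mul (hG.meas _)

lemma Nice.integrable_step {G : (Fin n → Sphere d) → Edges n m → ℝ} (hG : Nice G) (hδ : 0 < δ)
    (hr : 0 ≤ r) (b : Fin n) (x : Fin n → Sphere d) (e : Edges n m) (f : Fin m → Fin n)
    (ν : Measure (Sphere d)) [IsProbabilityMeasure ν] :
    Integrable (fun y => stepProb δ r (Function.update x b y) e b f *
      G (Function.update x b y) (Function.update e b f)) ν := by
  obtain ⟨C, hC⟩ := hG.bdd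
  refine Integrable.of_bound
    ((hG.measurable_step b e f).comp (measurable_update x)).aestronglyMeasurable C ?_
  refine Filter.Eventually.of_forall fun y => ?_
  rw [Real.norm_eq_abs, abs_mul, abs_of_nonneg (stepProb_nonneg hδ _ e b f)]
  exact (mul_le_of_le_one_left (abs_nonneg _) (stepProb_le_one hδ hr _ e b f)).trans (hC _ _)

lemma Nice.step {G : (Fin n → Sphere d) → Edges n m → ℝ} (hG : Nice G) (hδ : 0 < δ)
    (hr : 0 ≤ r) (hm : 1 ≤ m) (b : Fin n) : Nice (stepExpect δ r μ b G) := by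
  obtain ⟨C, hC⟩ := hG.bdd
  refine ⟨fun e => ?_, C, fun x e => ?_⟩
  · have : Measurable fun z : (Fin n → Sphere d) × Sphere d =>
        ∑ f, stepProb δ r (Function.update z.1 b z.2) e b f *
          G (Function.update z.1 b z.2) (Function.update e b f) :=
      Finset.measurable_sum _ fun f _ => (hG.measurable_step b e f).comp measurable_update'
    exact (this.stronglyMeasurable.integral_prod_right).measurable
  · rw [← Real.norm_eq_abs]
    refine (norm_integral_le_of_norm_le_const (C := C)
      (Filter.Eventually.of_forall fun y => ?_)).trans (by simp)
    rw [Real.norm_eq_abs]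
    refine (Finset.abs_sum_le_sum_abs _ _).trans ?_
    calc _ ≤ ∑ f, stepProb δ r (Function.update x b y) e b f * C := by
          refine Finset.sum_le_sum fun f _ => ?_
          rw [abs_mul, abs_of_nonneg (stepProb_nonneg hδ _ e b f)]
          exact mul_le_mul_of_nonneg_left (hC _ _) (stepProb_nonneg hδ _ e b f)
      _ = C := by rw [← Finset.sum_mul, sum_stepProb hδ hr hm, one_mul]

/-- The tower property. -/
lemma expect_succ {G : (Fin n → Sphere d) → Edges n m → ℝ} (hG : Nice G) (hδ : 0 < δ)
    (hr : 0 ≤ r) (b : Fin n) :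
    expect δ r μ (b + 1) G = expect δ r μ b (stepExpect δ r μ b G) := by
  obtain ⟨C, hC⟩ := hG.bdd
  have h1 : ∀ x, ∑ e, density δ r (b + 1) x e * G x e =
      ∑ e, ∑ f, density δ r b x e * (stepProb δ r x e b f * G x (Function.update e b f)) := by
    intro x
    rw [sum_edges b fun _ => b]
    refine Finset.sum_congr rfl fun e _ => Finset.sum_congr rfl fun f _ => ?_
    have := density_succ (δ := δ) (r := r) x b e (x b) f
    rw [Function.update_eq_self] at this
    rw [← mul_assoc, ← this]
    split_ifs <;> simp
  unfold expect
  simp only [h1]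
  rw [integral_update b (C := ∑ _e : Edges n m, ∑ _f : Fin m → Fin n, C)]
  · refine integral_congr_ae (Filter.Eventually.of_forall fun x => ?_)
    simp only [density_update, ← Finset.mul_sum]
    rw [integral_finsetSum]
    · refine Finset.sum_congr rfl fun e _ => ?_
      rw [integral_const_mul, stepExpect]
    · intro e _
      exact (integrable_finsetSum _ fun f _ => hG.integrable_step hδ hr b x e f _).const_mul _
  · exact Finset.measurable_sum _ fun e _ => Finset.measurable_sum _ fun f _ =>
      (measurable_density' _ e).mul (hG.measurable_step b e f)
  · intro x
    refine (Finset.abs_sum_le_sum_abs _ _).trans (Finset.sum_le_sum fun e _ => ?_)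
    refine (Finset.abs_sum_le_sum_abs _ _).trans (Finset.sum_le_sum fun f _ => ?_)
    rw [abs_mul, abs_mul, abs_of_nonneg (density_nonneg hδ _ x e),
      abs_of_nonneg (stepProb_nonneg hδ _ e b f)]
    exact (mul_le_of_le_one_left (by have := stepProb_nonneg (r := r) hδ x e b f; positivity)
      (density_le_one hδ hr _ x e)).trans ((mul_le_of_le_one_left (abs_nonneg _)
      (stepProb_le_one hδ hr x e b f)).trans (hC _ _))

lemma expect_mono (hδ : 0 < δ) (hr : 0 ≤ r) {j : ℕ} {G H : (Fin n → Sphere d) → Edges n m → ℝ}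
    (hG : Nice G) (hH : Nice H) (h : ∀ x e, Valid e → G x e ≤ H x e) :
    expect δ r μ j G ≤ expect δ r μ j H := by
  refine integral_mono (integrable_finsetSum _ fun e _ => hG.integrable hδ hr j e)
    (integrable_finsetSum _ fun e _ => hH.integrable hδ hr j e) fun x => ?_
  refine Finset.sum_le_sum fun e _ => ?_
  by_cases he : Valid e
  · exact mul_le_mul_of_nonneg_left (h x e he) (density_nonneg hδ j x e)
  · simp [density_eq_zero j x he]

omit [∀ b, IsProbabilityMeasure (μ b)] in
lemma expect_congr {j : ℕ} {G H : (Fin n → Sphere d) → Edges n m → ℝ}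
    (h : ∀ x e, Valid e → G x e = H x e) : expect δ r μ j G = expect δ r μ j H := by
  unfold expect
  congr 1
  funext x
  refine Finset.sum_congr rfl fun e _ => ?_
  by_cases he : Valid e
  · rw [h x e he]
  · simp [density_eq_zero j x he]

lemma expect_add (hδ : 0 < δ) (hr : 0 ≤ r) {j : ℕ} {G H : (Fin n → Sphere d) → Edges n m → ℝ}
    (hG : Nice G) (hH : Nice H) :
    expect δ r μ j (fun x e => G x e + H x e) = expect δ r μ j G + expect δ r μ j H := by
  unfold expect
  rw [← integral_add (integrable_finsetSum _ fun e _ => hG.integrable hδ hr j e)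
    (integrable_finsetSum _ fun e _ => hH.integrable hδ hr j e)]
  simp only [mul_add, Finset.sum_add_distrib]

omit [∀ b, IsProbabilityMeasure (μ b)] in
lemma expect_const_mul (j : ℕ) (c : ℝ) (G : (Fin n → Sphere d) → Edges n m → ℝ) :
    expect δ r μ j (fun x e => c * G x e) = c * expect δ r μ j G := by
  unfold expect
  rw [← integral_const_mul]
  simp only [mul_left_comm _ c, Finset.mul_sum]

lemma nice_const (c : ℝ) : Nice fun (_ : Fin n → Sphere d) (_ : Edges n m) => c :=
  ⟨fun _ => measurable_const, |c|, fun _ _ => le_rfl⟩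

lemma Nice.add {G H : (Fin n → Sphere d) → Edges n m → ℝ} (hG : Nice G) (hH : Nice H) :
    Nice fun x e => G x e + H x e := by
  obtain ⟨C, hC⟩ := hG.bdd
  obtain ⟨D, hD⟩ := hH.bdd
  exact ⟨fun e => (hG.meas e).add (hH.meas e), C + D, fun x e => (abs_add_le _ _).trans
    (add_le_add (hC x e) (hD x e))⟩

lemma Nice.mul {G H : (Fin n → Sphere d) → Edges n m → ℝ} (hG : Nice G) (hH : Nice H) :
    Nice fun x e => G x e * H x e := by
  obtain ⟨C, hC⟩ := hG.bdd
  obtain ⟨D, hD⟩ := hH.bdd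
  refine ⟨fun e => (hG.meas e).mul (hH.meas e), C * D, fun x e => ?_⟩
  rw [abs_mul]
  exact mul_le_mul (hC x e) (hD x e) (abs_nonneg _) ((abs_nonneg _).trans (hC x e))

lemma Nice.const_mul {G : (Fin n → Sphere d) → Edges n m → ℝ} (hG : Nice G) (c : ℝ) :
    Nice fun x e => c * G x e := (nice_const c).mul hG

lemma Nice.sum {ι : Type*} (s : Finset ι) {G : ι → (Fin n → Sphere d) → Edges n m → ℝ}
    (hG : ∀ i ∈ s, Nice (G i)) : Nice fun x e => ∑ i ∈ s, G i x e := by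
  classical
  induction s using Finset.induction_on with
  | empty => simpa using nice_const 0
  | insert a s ha ih =>
    simp only [Finset.sum_insert ha]
    exact (hG a (Finset.mem_insert_self a s)).add
      (ih fun i hi => hG i (Finset.mem_insert_of_mem hi))

/-- A bounded measurable function of a bounded measurable function. -/
lemma Nice.comp {G : (Fin n → Sphere d) → Edges n m → ℝ} (hG : Nice G) {φ : ℝ → ℝ}
    (hφ : Continuous φ) : Nice fun x e => φ (G x e) := by
  obtain ⟨C, hC⟩ := hG.bdd
  obtain ⟨D, hD⟩ := (isCompact_Icc (a := -C) (b := C)).exists_bound_of_continuousOn hφ.continuousOn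
  exact ⟨fun e => hφ.measurable.comp (hG.meas e), D, fun x e => hD _ (abs_le.1 (hC x e))⟩

lemma expect_sum (hδ : 0 < δ) (hr : 0 ≤ r) {j : ℕ} {ι : Type*} (s : Finset ι)
    {G : ι → (Fin n → Sphere d) → Edges n m → ℝ} (hG : ∀ i ∈ s, Nice (G i)) :
    expect δ r μ j (fun x e => ∑ i ∈ s, G i x e) = ∑ i ∈ s, expect δ r μ j (G i) := by
  classical
  induction s using Finset.induction_on with
  | empty => simp [expect]
  | insert a s ha ih =>
    simp only [Finset.sum_insert ha]
    rw [expect_add hδ hr (hG a (Finset.mem_insert_self a s))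
      (Nice.sum s fun i hi => hG i (Finset.mem_insert_of_mem hi)),
      ih fun i hi => hG i (Finset.mem_insert_of_mem hi)]

omit [∀ b, IsProbabilityMeasure (μ b)] in
lemma expect_zero (G : (Fin n → Sphere d) → Edges n m → ℝ) :
    expect δ r μ 0 G = ∫ x, G x (fun b _ => b) ∂Measure.pi μ := by
  unfold expect
  congr 1
  funext x
  rw [Finset.sum_eq_single (fun b _ => b)]
  · simp [density]
  · intro e _ he
    have : ∃ b, e b ≠ fun _ => b := by
      by_contra h
      push Not at h
      exact he (funext h)
    obtain ⟨b, hb⟩ := this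
    rw [density, Finset.prod_eq_zero (Finset.mem_univ b), zero_mul]
    simp [hb]
  · simp

lemma stepExpect_eq {G : (Fin n → Sphere d) → Edges n m → ℝ} (hδ : 0 < δ) (hr : 0 ≤ r)
    (hm : 1 ≤ m) {b : Fin n} (hG : DependsBefore b G) : stepExpect δ r μ b G = G := by
  funext x e
  unfold stepExpect
  simp only [hG.update le_rfl, ← Finset.sum_mul, sum_stepProb hδ hr hm, one_mul]
  simp

lemma expect_eq_of_dependsBefore {G : (Fin n → Sphere d) → Edges n m → ℝ} (hG : Nice G)
    (hδ : 0 < δ) (hr : 0 ≤ r) (hm : 1 ≤ m) {j j' : ℕ} (hj : j ≤ j') (hj' : j' ≤ n)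
    (hd : DependsBefore j G) : expect δ r μ j' G = expect δ r μ j G := by
  induction j', hj using Nat.le_induction with
  | base => rfl
  | succ i hi ih =>
    have := expect_succ (μ := μ) hG hδ hr ⟨i, hj'⟩
    simp only at this
    rw [this, stepExpect_eq hδ hr hm (hd.mono hi), ih (by omega)]

lemma expect_const (hδ : 0 < δ) (hr : 0 ≤ r) (hm : 1 ≤ m) {j : ℕ} (hj : j ≤ n) (c : ℝ) :
    expect δ r μ j (fun _ (_ : Edges n m) => c) = c := by
  rw [expect_eq_of_dependsBefore (nice_const c) hδ hr hm (Nat.zero_le j) hj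
    fun _ _ _ _ _ _ => rfl, expect_zero]
  simp

/-- Expectations commute with integrals over a parameter. -/
lemma expect_integral (hδ : 0 < δ) (hr : 0 ≤ r) {j : ℕ} {ν : Measure (Sphere d)}
    [IsProbabilityMeasure ν] {G : Sphere d → (Fin n → Sphere d) → Edges n m → ℝ}
    (hG : ∀ e, Measurable fun z : Sphere d × (Fin n → Sphere d) => G z.1 z.2 e)
    {C : ℝ} (hC : ∀ y x e, |G y x e| ≤ C) :
    expect δ r μ j (fun x e => ∫ y, G y x e ∂ν) = ∫ y, expect δ r μ j (G y) ∂ν := by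
  have hi : ∀ e, Integrable (fun z : Sphere d × (Fin n → Sphere d) =>
      density δ r j z.2 e * G z.1 z.2 e) (ν.prod (Measure.pi μ)) := by
    intro e
    refine Integrable.of_bound
      (((measurable_density' j e).comp measurable_snd).mul (hG e)).aestronglyMeasurable C ?_
    refine Filter.Eventually.of_forall fun z => ?_
    rw [Real.norm_eq_abs, abs_mul, abs_of_nonneg (density_nonneg hδ j _ e)]
    exact (mul_le_of_le_one_left (abs_nonneg _) (density_le_one hδ hr j _ e)).trans (hC _ _ e)
  unfold expect
  rw [integral_integral_swap (f := fun y x => ∑ e, density δ r j x e * G y x e)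
    (by exact integrable_finsetSum _ fun e _ => hi e)]
  congr 1
  funext x
  rw [integral_finsetSum]
  · exact Finset.sum_congr rfl fun e _ => (integral_const_mul _ _).symm
  · intro e _
    refine Integrable.const_mul (Integrable.of_bound
      ((hG e).comp measurable_prodMk_right).aestronglyMeasurable C ?_) _
    exact Filter.Eventually.of_forall fun y => hC _ _ _

lemma stepExpect_mono (hδ : 0 < δ) (hr : 0 ≤ r) {b : Fin n}
    {G H : (Fin n → Sphere d) → Edges n m → ℝ} (hG : Nice G) (hH : Nice H)
    {x : Fin n → Sphere d} {e : Edges n m}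
    (h : ∀ y f, (∀ i, f i ≤ b) → G (Function.update x b y) (Function.update e b f) ≤
      H (Function.update x b y) (Function.update e b f)) :
    stepExpect δ r μ b G x e ≤ stepExpect δ r μ b H x e := by
  refine integral_mono (integrable_finsetSum _ fun f _ => hG.integrable_step hδ hr b x e f _)
    (integrable_finsetSum _ fun f _ => hH.integrable_step hδ hr b x e f _) fun y => ?_
  refine Finset.sum_le_sum fun f _ => ?_
  by_cases hf : ∀ i, f i ≤ b
  · exact mul_le_mul_of_nonneg_left (h y f hf) (stepProb_nonneg hδ _ e b f)
  · push Not at hf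
    obtain ⟨i, hi⟩ := hf
    simp [stepProb_eq_zero _ e b hi]

end Expectation

/-! ### The weight in a cap and its martingale part -/

section Mass

variable {d n m : ℕ} {δ r p : ℝ}

/-- The total weight of the vertices of index less than `j` within distance `r` of `y`, when the
vertices of index less than `j` have sent out their edges. -/
def mass (δ r : ℝ) (j : ℕ) (y : Sphere d) (x : Fin n → Sphere d) (e : Edges n m) : ℝ :=
  ∑ k : Fin n, if (k : ℕ) < j ∧ dist y (x k) ≤ r then weight δ j e k else 0

/-- The fraction of the weight available to `b` which lies within distance `r` of `y`. -/
def share (δ r : ℝ) (b : Fin n) (y : Sphere d) (x : Fin n → Sphere d) (e : Edges n m) : ℝ :=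
  (∑ k ∈ near r x b, if dist y (x k) ≤ r then weight δ b e k else 0) / capWeight δ r x e b

/-- The conditional expectation of the increment of `mass` in the step of `b`, if `b` has a uniform
position. -/
def drift (δ r p : ℝ) (b : Fin n) (y : Sphere d) (x : Fin n → Sphere d) (e : Edges n m) : ℝ :=
  (1 + δ) * m * p + m * ∫ z, share δ r b y (Function.update x b z) e ∂area d

/-- The martingale part of `mass`. -/
def fluct (δ r p : ℝ) (j : ℕ) (y : Sphere d) (x : Fin n → Sphere d) (e : Edges n m) : ℝ :=
  mass δ r j y x e - ∑ b : Fin n, if (b : ℕ) < j then drift δ r p b y x e else 0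

lemma measurableSet_dist_le {α : Type*} [MeasurableSpace α] {f g : α → Sphere d}
    (hf : Measurable f) (hg : Measurable g) : MeasurableSet {a | dist (f a) (g a) ≤ r} :=
  measurableSet_le (hf.dist hg) measurable_const

lemma measurable_mass (j : ℕ) (e : Edges n m) :
    Measurable fun z : Sphere d × (Fin n → Sphere d) => mass δ r j z.1 z.2 e := by
  unfold mass
  refine Finset.measurable_sum _ fun k _ => Measurable.ite ?_ measurable_const measurable_const
  exact (MeasurableSet.const _).inter (measurableSet_dist_le measurable_fst (by fun_prop))

lemma measurable_capWeight (b : Fin n) (e : Edges n m) :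
    Measurable fun x : Fin n → Sphere d => capWeight δ r x e b := by
  unfold capWeight near
  simp only [Finset.sum_filter]
  refine Finset.measurable_sum _ fun k _ => Measurable.ite ?_ measurable_const measurable_const
  exact (MeasurableSet.const _).inter (measurableSet_dist_le (by fun_prop) (by fun_prop))

lemma measurable_share (b : Fin n) (e : Edges n m) :
    Measurable fun z : Sphere d × (Fin n → Sphere d) => share δ r b z.1 z.2 e := by
  unfold share
  refine Measurable.div ?_ ((measurable_capWeight b e).comp measurable_snd)
  unfold near
  simp only [Finset.sum_filter]
  refine Finset.measurable_sum _ fun k _ => Measurable.ite ?_ (Measurable.ite ?_ measurable_const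
    measurable_const) measurable_const
  · exact (MeasurableSet.const _).inter (measurableSet_dist_le (by fun_prop) (by fun_prop))
  · exact measurableSet_dist_le measurable_fst (by fun_prop)

lemma measurable_drift (b : Fin n) (e : Edges n m) :
    Measurable fun z : Sphere d × (Fin n → Sphere d) => drift δ r p b z.1 z.2 e := by
  have := isProb_area d
  unfold drift
  have hu : Measurable fun w : (Sphere d × (Fin n → Sphere d)) × Sphere d =>
      Function.update w.1.2 b w.2 :=
    measurable_update'.comp
      (f := fun w : (Sphere d × (Fin n → Sphere d)) × Sphere d => (w.1.2, w.2)) (by fun_prop)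
  have h : Measurable fun w : (Sphere d × (Fin n → Sphere d)) × Sphere d =>
      share δ r b w.1.1 (Function.update w.1.2 b w.2) e :=
    (measurable_share (d := d) (δ := δ) (r := r) b e).comp
      (f := fun w : (Sphere d × (Fin n → Sphere d)) × Sphere d =>
        (w.1.1, Function.update w.1.2 b w.2)) (measurable_fst.fst.prodMk hu)
  exact measurable_const.add (measurable_const.mul
    (h.stronglyMeasurable.integral_prod_right).measurable)

lemma measurable_fluct (j : ℕ) (e : Edges n m) :
    Measurable fun z : Sphere d × (Fin n → Sphere d) => fluct δ r p j z.1 z.2 e := by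
  unfold fluct
  refine (measurable_mass j e).sub (Finset.measurable_sum _ fun b _ => ?_)
  split_ifs
  · exact measurable_drift b e
  · exact measurable_const

lemma measurable_share_update (b : Fin n) (e : Edges n m) (y : Sphere d) (x : Fin n → Sphere d) :
    Measurable fun z : Sphere d => share δ r b y (Function.update x b z) e := by
  have hu : Measurable fun z : Sphere d => (y, Function.update x b z) :=
    measurable_const.prodMk (measurable_update x)
  exact (measurable_share (d := d) (δ := δ) (r := r) b e).comp
    (f := fun z : Sphere d => (y, Function.update x b z)) hu

lemma mass_nonneg (hδ : 0 < δ) (j : ℕ) (y : Sphere d) (x : Fin n → Sphere d) (e : Edges n m) :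
    0 ≤ mass δ r j y x e :=
  Finset.sum_nonneg fun k _ => by
    split_ifs
    · exact weight_nonneg hδ j e k
    · exact le_rfl

lemma weight_le {j : ℕ} (hj : j ≤ n) (e : Edges n m) (k : Fin n) :
    weight δ j e k ≤ (1 + δ) * m + m * j := by
  unfold weight
  have : (indegree j e k : ℝ) ≤ (m * j : ℕ) := by exact_mod_cast indegree_le j hj e k
  push_cast at this
  linarith

lemma abs_mass_le (hδ : 0 < δ) {j : ℕ} (hj : j ≤ n) (y : Sphere d) (x : Fin n → Sphere d)
    (e : Edges n m) : |mass δ r j y x e| ≤ n * ((1 + δ) * m + m * j) := by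
  rw [abs_of_nonneg (mass_nonneg hδ j y x e)]
  calc mass δ r j y x e ≤ ∑ _k : Fin n, ((1 + δ) * m + m * j) := by
        refine Finset.sum_le_sum fun k _ => ?_
        split_ifs
        · exact weight_le hj e k
        · positivity
    _ = _ := by simp [mul_add]

lemma share_nonneg (hδ : 0 < δ) (b : Fin n) (y : Sphere d) (x : Fin n → Sphere d)
    (e : Edges n m) : 0 ≤ share δ r b y x e := by
  refine div_nonneg (Finset.sum_nonneg fun k _ => ?_)
    (Finset.sum_nonneg fun k _ => weight_nonneg hδ _ e k)
  split_ifs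
  · exact weight_nonneg hδ _ e k
  · exact le_rfl

lemma share_le_one (hδ : 0 < δ) (b : Fin n) (y : Sphere d) (x : Fin n → Sphere d)
    (e : Edges n m) : share δ r b y x e ≤ 1 := by
  refine div_le_one_of_le₀ (Finset.sum_le_sum fun k _ => ?_)
    (Finset.sum_nonneg fun k _ => weight_nonneg hδ _ e k)
  split_ifs
  · exact le_rfl
  · exact weight_nonneg hδ _ e k

lemma integral_share_mem (hδ : 0 < δ) (b : Fin n) (y : Sphere d) (x : Fin n → Sphere d)
    (e : Edges n m) : ∫ z, share δ r b y (Function.update x b z) e ∂area d ∈ Set.Icc (0 : ℝ) 1 := by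
  have := isProb_area d
  refine ⟨integral_nonneg fun z => share_nonneg hδ b y _ e, ?_⟩
  have h : ‖∫ z, share δ r b y (Function.update x b z) e ∂area d‖ ≤ 1 * (area d).real Set.univ := by
    refine norm_integral_le_of_norm_le_const (Filter.Eventually.of_forall fun z => ?_)
    rw [Real.norm_eq_abs, abs_of_nonneg (share_nonneg hδ b y _ e)]
    exact share_le_one hδ b y _ e
  rw [probReal_univ, mul_one] at h
  exact (le_abs_self _).trans h

lemma drift_mem (hδ : 0 < δ) (hp : 0 ≤ p) (hp1 : p ≤ 1) (b : Fin n) (y : Sphere d)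
    (x : Fin n → Sphere d) (e : Edges n m) :
    drift δ r p b y x e ∈ Set.Icc (0 : ℝ) ((2 + δ) * m) := by
  obtain ⟨h0, h1⟩ := integral_share_mem (r := r) hδ b y x e
  have hm : (0 : ℝ) ≤ m := by positivity
  constructor
  · unfold drift
    positivity
  · unfold drift
    nlinarith [mul_le_mul_of_nonneg_left h1 hm,
      mul_le_mul_of_nonneg_left hp1 (by positivity : 0 ≤ (1 + δ) * (m : ℝ))]

lemma abs_fluct_le (hδ : 0 < δ) (hp : 0 ≤ p) (hp1 : p ≤ 1) {j : ℕ} (hj : j ≤ n) (y : Sphere d)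
    (x : Fin n → Sphere d) (e : Edges n m) :
    |fluct δ r p j y x e| ≤ n * ((1 + δ) * m + m * j) + n * ((2 + δ) * m) := by
  unfold fluct
  refine (abs_sub _ _).trans (add_le_add (abs_mass_le hδ hj y x e) ?_)
  refine (Finset.abs_sum_le_sum_abs _ _).trans ?_
  calc _ ≤ ∑ _b : Fin n, (2 + δ) * (m : ℝ) := by
        refine Finset.sum_le_sum fun b _ => ?_
        obtain ⟨h0, h1⟩ := drift_mem (r := r) hδ hp hp1 b y x e
        split_ifs
        · rwa [abs_of_nonneg h0]
        · rw [abs_zero]; positivity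
    _ = _ := by simp

lemma measurable_const_prodMk (y : Sphere d) :
    Measurable fun x : Fin n → Sphere d => (y, x) :=
  measurable_const.prodMk measurable_id

lemma nice_mass (hδ : 0 < δ) {j : ℕ} (hj : j ≤ n) (y : Sphere d) :
    Nice (n := n) (m := m) (mass δ r j y) :=
  ⟨fun e => (measurable_mass (d := d) (δ := δ) (r := r) j e).comp
    (f := fun x => (y, x)) (measurable_const_prodMk y), _, abs_mass_le hδ hj y⟩

lemma nice_fluct (hδ : 0 < δ) (hp : 0 ≤ p) (hp1 : p ≤ 1) {j : ℕ} (hj : j ≤ n) (y : Sphere d) :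
    Nice (n := n) (m := m) (fluct δ r p j y) :=
  ⟨fun e => (measurable_fluct (d := d) (δ := δ) (r := r) (p := p) j e).comp
    (f := fun x => (y, x)) (measurable_const_prodMk y), _,
    abs_fluct_le hδ hp hp1 hj y⟩

lemma dependsBefore_mass (j : ℕ) (y : Sphere d) :
    DependsBefore (n := n) (m := m) j (mass δ r j y) := by
  intro x x' e e' hx he
  refine Finset.sum_congr rfl fun k _ => ?_
  by_cases hk : (k : ℕ) < j
  · rw [hx k hk, weight_congr he]
  · simp [hk]

lemma dependsBefore_drift (b : Fin n) (y : Sphere d) :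
    DependsBefore (n := n) (m := m) b (drift δ r p b y) := by
  intro x x' e e' hx he
  have h : ∀ z k, k ≤ b → Function.update x b z k = Function.update x' b z k := by
    intro z k hk
    rcases eq_or_ne k b with rfl | h
    · simp
    · rw [Function.update_of_ne h, Function.update_of_ne h, hx k (Fin.lt_def.1 (lt_of_le_of_ne hk h))]
  have hn : ∀ z, near r (Function.update x b z) b = near r (Function.update x' b z) b := by
    intro z
    ext k
    simp only [mem_near]
    refine and_congr_right fun hk => ?_
    rw [h z b le_rfl, h z k hk]
  unfold drift share capWeight
  congr 2
  refine integral_congr_ae (Filter.Eventually.of_forall fun z => ?_)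
  simp only [hn, weight_congr he]
  congr 1
  refine Finset.sum_congr rfl fun k hk => ?_
  rw [h z k (mem_near.1 hk).1]

lemma dependsBefore_fluct (j : ℕ) (y : Sphere d) :
    DependsBefore (n := n) (m := m) j (fluct δ r p j y) := by
  intro x x' e e' hx he
  unfold fluct
  rw [dependsBefore_mass j y x x' e e' hx he]
  congr 1
  refine Finset.sum_congr rfl fun b _ => ?_
  by_cases hb : (b : ℕ) < j
  · rw [if_pos hb, if_pos hb, (dependsBefore_drift b y).mono hb.le x x' e e' hx he]
  · simp [hb]

/-- The increment of `fluct` is the increment of `mass` minus its conditional expectation. -/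
lemma fluct_succ (b : Fin n) (y : Sphere d) (x : Fin n → Sphere d) (e : Edges n m) :
    fluct δ r p (b + 1) y x e = mass δ r (b + 1) y x e - mass δ r b y x e + fluct δ r p b y x e
      - drift δ r p b y x e := by
  have h : ∀ u : Fin n, (if (u : ℕ) < b + 1 then drift δ r p u y x e else 0) =
      (if (u : ℕ) < b then drift δ r p u y x e else 0) +
        (if u = b then drift δ r p u y x e else 0) := by
    intro u
    by_cases h2 : u = b
    · subst h2
      simp
    · have : (u : ℕ) ≠ b := fun h => h2 (Fin.ext h)
      have : (u : ℕ) < b + 1 ↔ (u : ℕ) < b := by omega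
      simp [this, h2]
  unfold fluct
  simp only [h, Finset.sum_add_distrib]
  rw [Finset.sum_ite_eq', if_pos (Finset.mem_univ b)]
  ring

lemma sum_drawCount (f : Fin m → Fin n) : ∑ k, drawCount f k = m := by
  have := Finset.card_eq_sum_card_fiberwise (f := f) (s := Finset.univ) (t := Finset.univ)
    (by simp)
  simpa [drawCount] using this.symm

lemma mass_succ_update {e : Edges n m} (he : Valid e) (b : Fin n) {f : Fin m → Fin n}
    (hf : ∀ i, f i ≤ b) (y : Sphere d) (x : Fin n → Sphere d) :
    mass δ r (b + 1) y x (Function.update e b f) = mass δ r b y x e +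
      (if dist y (x b) ≤ r then (1 + δ) * m else 0) +
      ∑ k, if dist y (x k) ≤ r then (drawCount f k : ℝ) else 0 := by
  have h : ∀ k : Fin n, (if (k : ℕ) < b + 1 ∧ dist y (x k) ≤ r then
        weight δ (b + 1) (Function.update e b f) k else 0) =
      (if (k : ℕ) < b ∧ dist y (x k) ≤ r then weight δ b e k else 0) +
      (if k = b then (if dist y (x k) ≤ r then (1 + δ) * m else 0) else 0) +
      (if dist y (x k) ≤ r then (drawCount f k : ℝ) else 0) := by
    intro k
    rw [weight_succ_update]
    rcases lt_trichotomy (k : ℕ) b with hk | hk | hk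
    · have h1 : (k : ℕ) < b + 1 := by omega
      have h2 : k ≠ b := fun h => by rw [h] at hk; omega
      by_cases hd : dist y (x k) ≤ r <;> simp [hk, h1, h2, hd]
    · have hkb : k = b := Fin.ext hk
      subst hkb
      by_cases hd : dist y (x k) ≤ r <;> simp [hd, weight_eq he le_rfl]
    · have h1 : ¬ (k : ℕ) < b + 1 := by omega
      have h2 : k ≠ b := fun h => by rw [h] at hk; omega
      have h3 : ¬ (k : ℕ) < b := by omega
      have h4 : drawCount f k = 0 := by
        rw [drawCount, Finset.card_eq_zero, Finset.filter_eq_empty_iff]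
        rintro i - rfl
        have : (f i : ℕ) ≤ b := hf i
        omega
      simp [h1, h2, h3, h4]
  unfold mass
  simp only [h, Finset.sum_add_distrib]
  rw [Finset.sum_ite_eq', if_pos (Finset.mem_univ b)]

/-- The weight in a cap grows by at most `(2 + δ) m` in a step: the initial weight of the new
vertex, and one for each of its edges. -/
lemma mass_succ_sub_mem (hδ : 0 < δ) {e : Edges n m} (he : Valid e) (b : Fin n)
    {f : Fin m → Fin n} (hf : ∀ i, f i ≤ b) (y : Sphere d) (x : Fin n → Sphere d) :
    mass δ r (b + 1) y x (Function.update e b f) - mass δ r b y x e ∈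
      Set.Icc (0 : ℝ) ((2 + δ) * m) := by
  rw [mass_succ_update he b hf]
  have h1 : ∑ k, (if dist y (x k) ≤ r then (drawCount f k : ℝ) else 0) ≤ m := by
    have : ((∑ k, drawCount f k : ℕ) : ℝ) = m := by rw [sum_drawCount]
    rw [← this]
    push_cast
    refine Finset.sum_le_sum fun k _ => ?_
    split_ifs
    · exact le_rfl
    · positivity
  have h0 : 0 ≤ ∑ k, (if dist y (x k) ≤ r then (drawCount f k : ℝ) else 0) :=
    Finset.sum_nonneg fun k _ => by split_ifs <;> positivity
  have h2 : (if dist y (x b) ≤ r then (1 + δ) * m else 0) ∈ Set.Icc (0 : ℝ) ((1 + δ) * m) := by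
    split_ifs
    · exact ⟨by positivity, le_rfl⟩
    · exact ⟨le_rfl, by positivity⟩
  constructor
  · linarith [h2.1]
  · linarith [h2.2]

/-- All caps of radius `r` have area `p`. -/
def CapArea (d : ℕ) (r p : ℝ) : Prop :=
  ∀ y : Sphere d, ∫ z, (if dist y z ≤ r then (1 : ℝ) else 0) ∂area d = p

lemma integrable_area {g : Sphere d → ℝ} (hg : Measurable g) {C : ℝ} (hC : ∀ y, |g y| ≤ C) :
    Integrable g (area d) := by
  have := isProb_area d
  exact Integrable.of_bound hg.aestronglyMeasurable C (Filter.Eventually.of_forall hC)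

lemma integrable_cap (y : Sphere d) (c : ℝ) :
    Integrable (fun z => if dist y z ≤ r then c else 0) (area d) := by
  refine integrable_area (C := |c|) (Measurable.ite (measurableSet_dist_le measurable_const
    measurable_id) measurable_const measurable_const) fun z => ?_
  split_ifs
  · exact le_rfl
  · simp

lemma CapArea.integral (h : CapArea d r p) (y : Sphere d) (c : ℝ) :
    ∫ z, (if dist y z ≤ r then c else 0) ∂area d = c * p := by
  rw [← h y, ← integral_const_mul]
  simp

lemma CapArea.integral' (h : CapArea d r p) (y : Sphere d) (c : ℝ) :
    ∫ z, (if dist z y ≤ r then c else 0) ∂area d = c * p := by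
  simp only [dist_comm _ y]
  exact h.integral y c

variable {μ : Fin n → Measure (Sphere d)} [∀ b, IsProbabilityMeasure (μ b)]

omit [∀ b, IsProbabilityMeasure (μ b)] in
/-- `drift` is the conditional expectation of the increment of `mass`. -/
lemma stepExpect_mass (hcap : CapArea d r p) (hδ : 0 < δ) (hr : 0 ≤ r) (hm : 1 ≤ m)
    {e : Edges n m} (he : Valid e) (b : Fin n) (hb : μ b = area d) (y : Sphere d)
    (x : Fin n → Sphere d) :
    stepExpect δ r μ b (mass δ r (b + 1) y) x e = mass δ r b y x e + drift δ r p b y x e := by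
  have hprob := isProb_area d
  have h1 : ∀ z, ∑ f, stepProb δ r (Function.update x b z) e b f *
      mass δ r (b + 1) y (Function.update x b z) (Function.update e b f) =
      mass δ r b y x e + (if dist y z ≤ r then (1 + δ) * m else 0) +
        m * share δ r b y (Function.update x b z) e := by
    intro z
    set x' := Function.update x b z with hx'
    have h2 : ∀ f, stepProb δ r x' e b f * mass δ r (b + 1) y x' (Function.update e b f) =
        stepProb δ r x' e b f * (mass δ r b y x e + (if dist y z ≤ r then (1 + δ) * m else 0)) +
        ∑ k, if dist y (x' k) ≤ r then stepProb δ r x' e b f * drawCount f k else 0 := by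
      intro f
      by_cases hf : ∀ i, f i ≤ b
      · have h3 : mass δ r b y x' e = mass δ r b y x e :=
          dependsBefore_mass b y _ _ _ _ (fun u hu =>
            Function.update_of_ne (Fin.ne_of_lt (by omega)) _ _) fun _ _ => rfl
        rw [mass_succ_update he b hf, h3, hx', Function.update_self, mul_add, Finset.mul_sum]
        simp
      · push Not at hf
        obtain ⟨i, hi⟩ := hf
        simp [stepProb_eq_zero _ e b hi]
    simp only [h2, Finset.sum_add_distrib]
    rw [← Finset.sum_mul, sum_stepProb hδ hr hm, one_mul, Finset.sum_comm]
    congr 1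
    unfold share
    rw [Finset.sum_div, Finset.mul_sum, near, Finset.sum_filter]
    refine Finset.sum_congr rfl fun k _ => ?_
    by_cases hd : dist y (x' k) ≤ r
    · simp only [hd, if_true]
      rw [sum_stepProb_drawCount hδ hr hm]
      by_cases hk : k ∈ near r x' b
      · rw [if_pos hk, if_pos (mem_near.1 hk)]
      · rw [if_neg hk, if_neg (fun h => hk (mem_near.2 h))]
        simp
    · simp [hd]
  unfold stepExpect drift
  rw [hb]
  simp only [h1]
  have hi : Integrable (fun z => m * share δ r b y (Function.update x b z) e) (area d) := by
    refine integrable_area (C := m) ?_ fun z => ?_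
    · exact measurable_const.mul (measurable_share_update b e y x)
    · rw [abs_of_nonneg (by have := share_nonneg (r := r) hδ b y (Function.update x b z) e; positivity)]
      exact mul_le_of_le_one_right (by positivity) (share_le_one hδ b y _ e)
  have hsplit : ∫ z, (mass δ r b y x e + if dist y z ≤ r then (1 + δ) * m else 0) +
      m * share δ r b y (Function.update x b z) e ∂area d =
      (∫ z, (mass δ r b y x e + if dist y z ≤ r then (1 + δ) * m else 0) ∂area d) +
        ∫ z, m * share δ r b y (Function.update x b z) e ∂area d :=
    integral_add ((integrable_const _).add (integrable_cap y _)) hi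
  rw [hsplit, integral_add (integrable_const _) (integrable_cap y _), hcap.integral y, integral_const_mul]
  simp only [integral_const, probReal_univ, smul_eq_mul, one_mul]
  ring

lemma stepExpect_affine (hδ : 0 < δ) (hr : 0 ≤ r) (hm : 1 ≤ m) {G : (Fin n → Sphere d) → Edges n m → ℝ}
    (hG : Nice G) (b : Fin n) (A B : ℝ) (x : Fin n → Sphere d) (e : Edges n m) :
    stepExpect δ r μ b (fun x e => A + B * G x e) x e = A + B * stepExpect δ r μ b G x e := by
  unfold stepExpect
  simp only [mul_add, Finset.sum_add_distrib, mul_left_comm _ B, ← Finset.mul_sum, ← Finset.sum_mul,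
    sum_stepProb hδ hr hm, one_mul]
  rw [integral_add (integrable_const _), integral_const_mul]
  · simp
  · exact (integrable_finsetSum _ fun f _ => hG.integrable_step hδ hr b x e f _).const_mul _

lemma exp_le_of_abs_le_one {t : ℝ} (ht : |t| ≤ 1) : Real.exp t ≤ 1 + t + t ^ 2 := by
  have := (abs_le.1 (Real.abs_exp_sub_one_sub_id_le ht)).2
  linarith

/-- The exponential moments of the fluctuation grow at most like those of a random walk. -/
lemma stepExpect_exp_fluct (hcap : CapArea d r p) (hδ : 0 < δ) (hr : 0 ≤ r) (hm : 1 ≤ m)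
    (hp : 0 ≤ p) (hp1 : p ≤ 1) {e : Edges n m} (he : Valid e) (b : Fin n) (y : Sphere d)
    (x : Fin n → Sphere d) {t : ℝ} (ht : |t| * ((2 + δ) * m) ≤ 1) :
    stepExpect δ r μ b (fun x e => Real.exp (t * fluct δ r p (b + 1) y x e)) x e ≤
      Real.exp (|t| * ((2 + δ) * m)) * Real.exp (t * fluct δ r p b y x e) ∧
    (μ b = area d →
    stepExpect δ r μ b (fun x e => Real.exp (t * fluct δ r p (b + 1) y x e)) x e ≤
      Real.exp ((t * ((2 + δ) * m)) ^ 2) * Real.exp (t * fluct δ r p b y x e)) := by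
  have hN : Nice (n := n) (m := m) fun (x : Fin n → Sphere d) e =>
      Real.exp (t * fluct δ r p (b + 1) y x e) :=
    (nice_fluct hδ hp hp1 (by omega) y).comp (φ := fun s => Real.exp (t * s)) (by fun_prop)
  have hM : Nice (n := n) (m := m) (mass δ r (b + 1) y) := nice_mass hδ (by omega) y
  set c : ℝ := (2 + δ) * m with hc
  set F := fluct δ r p b y x e with hF
  -- the increment of the fluctuation
  have hinc : ∀ z f, fluct δ r p (b + 1) y (Function.update x b z) (Function.update e b f) =
      F + (mass δ r (b + 1) y (Function.update x b z) (Function.update e b f) - mass δ r b y x e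
        - drift δ r p b y x e) := by
    intro z f
    rw [fluct_succ, (dependsBefore_mass b y).update le_rfl,
      (dependsBefore_fluct b y).update le_rfl, (dependsBefore_drift b y).update le_rfl]
    ring
  have hbd : ∀ z f, (∀ i, f i ≤ b) → |t * (mass δ r (b + 1) y (Function.update x b z)
      (Function.update e b f) - mass δ r b y x e - drift δ r p b y x e)| ≤ |t| * c := by
    intro z f hf
    rw [abs_mul]
    refine mul_le_mul_of_nonneg_left ?_ (abs_nonneg t)
    have h1 := mass_succ_sub_mem (r := r) hδ he b hf y (Function.update x b z)
    have h2 := drift_mem (r := r) hδ hp hp1 b y x e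
    have h3 : mass δ r b y (Function.update x b z) e = mass δ r b y x e :=
      dependsBefore_mass b y _ _ _ _ (fun u hu =>
        Function.update_of_ne (Fin.ne_of_lt (by omega)) _ _) fun _ _ => rfl
    rw [h3] at h1
    rw [abs_le]
    constructor
    · linarith [h1.1, h2.2]
    · linarith [h1.2, h2.1]
  constructor
  · have h := stepExpect_mono (μ := μ) hδ hr (b := b) (x := x) (e := e) hN
      (nice_const (Real.exp (|t| * c) * Real.exp (t * F))) (fun z f hf => by
        rw [hinc, mul_add, Real.exp_add, mul_comm]
        exact mul_le_mul_of_nonneg_right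
          (Real.exp_le_exp.2 ((le_abs_self _).trans (hbd z f hf))) (Real.exp_pos _).le)
    rwa [stepExpect_eq (G := fun (_ : Fin n → Sphere d) (_ : Edges n m) => _) hδ hr hm
      (fun _ _ _ _ _ _ => rfl)] at h
  · intro hb
    have h := stepExpect_mono (μ := μ) hδ hr (b := b) (x := x) (e := e) hN
      ((nice_const (Real.exp (t * F) * (1 + (t * c) ^ 2 +
        t * (- mass δ r b y x e - drift δ r p b y x e)))).add
        (hM.const_mul (Real.exp (t * F) * t))) (fun z f hf => by
        rw [hinc, mul_add, Real.exp_add]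
        have h1 := hbd z f hf
        have h2 := exp_le_of_abs_le_one (h1.trans ht)
        have h3 := sq_le_sq' (abs_le.1 h1).1 (abs_le.1 h1).2
        rw [mul_pow |t|, sq_abs, ← mul_pow] at h3
        refine (mul_le_mul_of_nonneg_left (h2.trans (add_le_add_right h3 _))
          (Real.exp_pos _).le).trans (le_of_eq ?_)
        ring)
    rw [stepExpect_affine hδ hr hm hM, stepExpect_mass hcap hδ hr hm he b hb] at h
    refine h.trans ?_
    have h4 := Real.add_one_le_exp ((t * c) ^ 2)
    have h5 := mul_le_mul_of_nonneg_right h4 (Real.exp_pos (t * F)).le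
    refine le_trans (le_of_eq ?_) h5
    ring

/-- Exponential moments of the fluctuation. The positions of the vertices in `σ` need not be
uniform. -/
lemma expect_exp_fluct_le (hcap : CapArea d r p) (hδ : 0 < δ) (hr : 0 ≤ r) (hm : 1 ≤ m)
    (hp : 0 ≤ p) (hp1 : p ≤ 1) (σ : Finset (Fin n)) (hσ : ∀ b ∉ σ, μ b = area d) (y : Sphere d)
    {t : ℝ} (ht : |t| * ((2 + δ) * m) ≤ 1) {j : ℕ} (hj : j ≤ n) :
    expect δ r μ j (fun x (e : Edges n m) => Real.exp (t * fluct δ r p j y x e)) ≤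
      Real.exp (j * (t * ((2 + δ) * m)) ^ 2 + σ.card) := by
  suffices h : expect δ r μ j (fun x (e : Edges n m) => Real.exp (t * fluct δ r p j y x e)) ≤
      Real.exp (j * (t * ((2 + δ) * m)) ^ 2 + (σ.filter fun b : Fin n => (b : ℕ) < j).card) by
    refine h.trans (Real.exp_le_exp.2 ?_)
    have : ((σ.filter fun b : Fin n => (b : ℕ) < j).card : ℝ) ≤ σ.card := by
      exact_mod_cast Finset.card_filter_le _ _
    linarith
  induction j with
  | zero =>
    rw [expect_zero]
    simp [fluct, mass]
  | succ j ih =>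
    have ih := ih (by omega)
    set b : Fin n := ⟨j, hj⟩ with hb
    have hN : Nice (n := n) (m := m) fun (x : Fin n → Sphere d) e =>
        Real.exp (t * fluct δ r p (j + 1) y x e) :=
      (nice_fluct hδ hp hp1 hj y).comp (φ := fun s => Real.exp (t * s)) (by fun_prop)
    have hN' : Nice (n := n) (m := m) fun (x : Fin n → Sphere d) e =>
        Real.exp (t * fluct δ r p j y x e) :=
      (nice_fluct hδ hp hp1 (by omega) y).comp (φ := fun s => Real.exp (t * s)) (by fun_prop)
    have htow : expect δ r μ (j + 1)
          (fun x (e : Edges n m) => Real.exp (t * fluct δ r p (j + 1) y x e)) =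
        expect δ r μ j (stepExpect δ r μ b
          fun x (e : Edges n m) => Real.exp (t * fluct δ r p (j + 1) y x e)) :=
      expect_succ hN hδ hr b
    rw [htow]
    by_cases hbσ : b ∈ σ
    · have hcard : (σ.filter fun b : Fin n => (b : ℕ) < j + 1).card =
          (σ.filter fun b : Fin n => (b : ℕ) < j).card + 1 := by
        rw [← Finset.card_insert_of_notMem (a := b) (by simp [hb])]
        congr 1
        ext u
        simp only [Finset.mem_filter, Finset.mem_insert]
        constructor
        · rintro ⟨h1, h2⟩
          rcases Nat.lt_succ_iff_lt_or_eq.1 h2 with h3 | h3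
          · exact Or.inr ⟨h1, h3⟩
          · exact Or.inl (Fin.ext h3)
        · rintro (rfl | ⟨h1, h2⟩)
          · exact ⟨hbσ, by simp [hb]⟩
          · exact ⟨h1, by omega⟩
      refine (expect_mono hδ hr (hN.step hδ hr hm b) (hN'.const_mul (Real.exp 1))
        fun x e he => ((stepExpect_exp_fluct hcap hδ hr hm hp hp1 he b y x ht).1).trans
          (mul_le_mul_of_nonneg_right (Real.exp_le_exp.2 ht) (Real.exp_pos _).le)).trans ?_
      rw [expect_const_mul]
      refine (mul_le_mul_of_nonneg_left ih (Real.exp_pos _).le).trans ?_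
      rw [← Real.exp_add, hcard, Real.exp_le_exp]
      push_cast
      nlinarith [sq_nonneg (t * ((2 + δ) * m))]
    · have hcard : (σ.filter fun b : Fin n => (b : ℕ) < j + 1) =
          (σ.filter fun b : Fin n => (b : ℕ) < j) := by
        ext u
        simp only [Finset.mem_filter]
        refine and_congr_right fun h1 => ?_
        have : (u : ℕ) ≠ j := fun h => hbσ (by rwa [show b = u from Fin.ext h.symm])
        omega
      refine (expect_mono hδ hr (hN.step hδ hr hm b) (hN'.const_mul _)
        fun x e he => ((stepExpect_exp_fluct hcap hδ hr hm hp hp1 he b y x ht).2 (hσ b hbσ))).trans ?_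
      rw [expect_const_mul]
      refine (mul_le_mul_of_nonneg_left ih (Real.exp_pos _).le).trans ?_
      rw [← Real.exp_add, hcard, Real.exp_le_exp]
      push_cast
      linarith

end Mass

/-! ### Grönwall inequality and the recursion for the weight -/

section Gronwall

lemma rpow_sub_one_le {γ : ℝ} (h0 : 0 < γ) (h1 : γ ≤ 1) (i : ℕ) :
    γ * ((i : ℝ) + 1) ^ (γ - 1) ≤ ((i : ℝ) + 1) ^ γ - (i : ℝ) ^ γ := by
  have hi : (0 : ℝ) < (i : ℝ) + 1 := by positivity
  have h := rpow_one_add_le_one_add_mul_self (s := -1 / ((i : ℝ) + 1)) (p := γ)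
    (by rw [le_div_iff₀ hi]; linarith [(Nat.cast_nonneg i : (0 : ℝ) ≤ i)]) h0.le h1
  have h2 : 1 + -1 / ((i : ℝ) + 1) = i / ((i : ℝ) + 1) := by
    field_simp
    ring
  rw [h2, Real.div_rpow (by positivity) hi.le, div_le_iff₀ (by positivity)] at h
  rw [Real.rpow_sub_one hi.ne']
  have : (1 + γ * (-1 / ((i : ℝ) + 1))) * ((i : ℝ) + 1) ^ γ =
      ((i : ℝ) + 1) ^ γ - γ * (((i : ℝ) + 1) ^ γ / ((i : ℝ) + 1)) := by ring
  linarith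

lemma sum_rpow_sub_one_le {γ : ℝ} (h0 : 0 < γ) (h1 : γ ≤ 1) (j : ℕ) :
    ∑ i ∈ Finset.range j, ((i : ℝ) + 1) ^ (γ - 1) ≤ ((j : ℝ) + 1) ^ γ / γ := by
  rw [le_div_iff₀ h0, mul_comm, Finset.mul_sum]
  calc _ ≤ ∑ i ∈ Finset.range j, (((i + 1 : ℕ) : ℝ) ^ γ - (i : ℝ) ^ γ) := by
        refine Finset.sum_le_sum fun i _ => ?_
        push_cast
        exact rpow_sub_one_le h0 h1 i
    _ = (j : ℝ) ^ γ := by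
        rw [Finset.sum_range_sub (fun i : ℕ => (i : ℝ) ^ γ)]
        simp [Real.zero_rpow h0.ne']
    _ ≤ _ := Real.rpow_le_rpow (by positivity) (by linarith) h0.le

lemma sum_inv_le {γ : ℝ} (h0 : 0 < γ) (h1 : γ ≤ 1) (j : ℕ) :
    ∑ i ∈ Finset.range j, 1 / ((i : ℝ) + 1) ≤ ((j : ℝ) + 1) ^ γ / γ := by
  refine le_trans (Finset.sum_le_sum fun i _ => ?_) (sum_rpow_sub_one_le h0 h1 j)
  rw [one_div, ← Real.rpow_neg_one]
  exact Real.rpow_le_rpow_of_exponent_le (by linarith [(Nat.cast_nonneg i : (0 : ℝ) ≤ i)])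
    (by linarith)

/-- A discrete Grönwall inequality with the kernel `θ / (i + 1)`, whose homogeneous solutions grow
like `j ^ θ`. -/
lemma gronwall {a : ℕ → ℝ} {B θ γ : ℝ} (hB : 0 ≤ B) (hθ : 0 ≤ θ) (hθγ : θ < γ) (h1 : γ ≤ 1) {N : ℕ}
    (h : ∀ j ≤ N, a j ≤ B * ((j : ℝ) + 1) ^ γ + θ * ∑ i ∈ Finset.range j, a i / ((i : ℝ) + 1)) :
    ∀ j ≤ N, a j ≤ B * (γ / (γ - θ)) * ((j : ℝ) + 1) ^ γ := by
  have hγ : 0 < γ := by linarith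
  have hs : 0 < γ - θ := by linarith
  intro j
  induction j using Nat.strong_induction_on with
  | _ j ih =>
    intro hj
    refine (h j hj).trans ?_
    have h2 : ∑ i ∈ Finset.range j, a i / ((i : ℝ) + 1) ≤
        B * (γ / (γ - θ)) * (((j : ℝ) + 1) ^ γ / γ) := by
      calc _ ≤ ∑ i ∈ Finset.range j, B * (γ / (γ - θ)) * ((i : ℝ) + 1) ^ (γ - 1) := by
            refine Finset.sum_le_sum fun i hi => ?_
            have hi' := Finset.mem_range.1 hi
            have hi0 : (0 : ℝ) < (i : ℝ) + 1 := by positivity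
            rw [Real.rpow_sub_one hi0.ne', ← mul_div_assoc]
            exact div_le_div_of_nonneg_right (ih i hi' (by omega)) hi0.le
        _ ≤ _ := by
            rw [← Finset.mul_sum]
            exact mul_le_mul_of_nonneg_left (sum_rpow_sub_one_le hγ h1 j) (by positivity)
    refine (add_le_add_right (mul_le_mul_of_nonneg_left h2 hθ) _).trans (le_of_eq ?_)
    field_simp
    ring

end Gronwall

section Pathwise

variable {d n m : ℕ} {δ r p : ℝ}

/-- The deviation of the weight near `y` from its typical value. -/
def gap (δ r p : ℝ) (j : ℕ) (y : Sphere d) (x : Fin n → Sphere d) (e : Edges n m) : ℝ :=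
  mass δ r j y x e - p * ((2 + δ) * m * (j + 1))

/-- The mean of the deviation of the weight, with the factors which occur in the drift. -/
def shareGap (δ r p : ℝ) (b : Fin n) (y : Sphere d) (x : Fin n → Sphere d) (e : Edges n m) : ℝ :=
  ∫ z, share δ r b y (Function.update x b z) e * |gap δ r p b z x e| ∂area d

/-- A sum over the cap around `b`, when `b` is moved to `z`: the earlier vertices near `z`, and `b`
itself with its initial weight. -/
lemma sum_near_update {e : Edges n m} (he : Valid e) (hr : 0 ≤ r) (b : Fin n) (z : Sphere d)
    (x : Fin n → Sphere d) (g : Sphere d → ℝ) :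
    ∑ k ∈ near r (Function.update x b z) b, g (Function.update x b z k) * weight δ b e k =
      (∑ k : Fin n, if (k : ℕ) < b ∧ dist z (x k) ≤ r then g (x k) * weight δ b e k else 0) +
        g z * ((1 + δ) * m) := by
  have h : ∀ k : Fin n, (if k ≤ b ∧ dist (Function.update x b z b) (Function.update x b z k) ≤ r then
      g (Function.update x b z k) * weight δ b e k else 0) =
      (if (k : ℕ) < b ∧ dist z (x k) ≤ r then g (x k) * weight δ b e k else 0) +
        if k = b then g z * ((1 + δ) * m) else 0 := by
    intro k
    rw [Function.update_self]
    rcases lt_trichotomy k b with hk | hk | hk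
    · have hk' : (k : ℕ) < b := hk
      rw [Function.update_of_ne hk.ne]
      simp [hk.le, hk', hk.ne]
    · subst hk
      simp [hr, weight_eq he le_rfl]
    · have hk' : ¬ (k : ℕ) < b := by
        have : (b : ℕ) < k := hk
        omega
      simp [hk.not_ge, hk.ne', hk']
  rw [near, Finset.sum_filter, Finset.sum_congr rfl fun k _ => h k, Finset.sum_add_distrib,
    Finset.sum_ite_eq', if_pos (Finset.mem_univ b)]

lemma capWeight_update {e : Edges n m} (he : Valid e) (hr : 0 ≤ r) (b : Fin n) (z : Sphere d)
    (x : Fin n → Sphere d) :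
    capWeight δ r (Function.update x b z) e b = mass δ r b z x e + (1 + δ) * m := by
  have := sum_near_update (δ := δ) he hr b z x fun _ => 1
  simp only [one_mul] at this
  rw [capWeight, this, mass]

lemma share_mul_capWeight (hδ : 0 < δ) (hr : 0 ≤ r) (hm : 1 ≤ m) {e : Edges n m} (he : Valid e)
    (b : Fin n) (y z : Sphere d) (x : Fin n → Sphere d) :
    share δ r b y (Function.update x b z) e * (mass δ r b z x e + (1 + δ) * m) =
      (∑ k : Fin n, if (k : ℕ) < b ∧ dist z (x k) ≤ r then
        (if dist y (x k) ≤ r then 1 else 0) * weight δ b e k else 0) +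
      (if dist y z ≤ r then 1 else 0) * ((1 + δ) * m) := by
  have h0 : (0 : ℝ) < m := by exact_mod_cast hm
  have hZ : 0 < capWeight δ r (Function.update x b z) e b :=
    lt_of_lt_of_le (by positivity) (capWeight_ge hδ hr _ e b)
  rw [← sum_near_update he hr b z x fun w => if dist y w ≤ r then 1 else 0,
    ← capWeight_update he hr, share, div_mul_cancel₀ _ hZ.ne']
  simp

/-- The weight available to `b` cancels the denominator of its share. This identity is what makes
the drift linear in the deviation of the weight. -/
lemma integral_share_mul (hcap : CapArea d r p) (hδ : 0 < δ) (hr : 0 ≤ r) (hm : 1 ≤ m)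
    {e : Edges n m} (he : Valid e) (b : Fin n) (y : Sphere d) (x : Fin n → Sphere d) :
    ∫ z, share δ r b y (Function.update x b z) e * (mass δ r b z x e + (1 + δ) * m) ∂area d =
      p * (mass δ r b y x e + (1 + δ) * m) := by
  simp only [share_mul_capWeight hδ hr hm he]
  have h1 : ∀ k : Fin n, Integrable (fun z => if (k : ℕ) < b ∧ dist z (x k) ≤ r then
      (if dist y (x k) ≤ r then (1 : ℝ) else 0) * weight δ b e k else 0) (area d) := by
    intro k
    by_cases hk : (k : ℕ) < b
    · simp only [hk, true_and, dist_comm _ (x k)]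
      exact integrable_cap _ _
    · simp [hk]
  have h2 : Integrable (fun z => (if dist y z ≤ r then (1 : ℝ) else 0) * ((1 + δ) * m)) (area d) :=
    (integrable_cap y 1).mul_const _
  rw [integral_add (integrable_finsetSum _ fun k _ => h1 k) h2, integral_finsetSum _ fun k _ => h1 k,
    integral_mul_const, hcap.integral y, one_mul, mul_add, mass, Finset.mul_sum]
  congr 1
  refine Finset.sum_congr rfl fun k _ => ?_
  by_cases hk : (k : ℕ) < b
  · simp only [hk, true_and]
    rw [hcap.integral']
    split_ifs <;> ring
  · simp [hk]

/-- The fractions of the weight add up to the area of a cap. This conservation law is the reason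
why deviations of the weight spread without being amplified. -/
lemma integral_share (hcap : CapArea d r p) (hδ : 0 < δ) (hr : 0 ≤ r) (hm : 1 ≤ m)
    (e : Edges n m) (b : Fin n) (x : Fin n → Sphere d) : ∫ y, share δ r b y x e ∂area d = p := by
  have h0 : (0 : ℝ) < m := by exact_mod_cast hm
  have hZ : 0 < capWeight δ r x e b :=
    lt_of_lt_of_le (by positivity) (capWeight_ge hδ hr _ e b)
  unfold share
  rw [integral_div, integral_finsetSum]
  · simp only [hcap.integral']
    rw [← Finset.sum_mul]
    exact mul_div_cancel_left₀ p hZ.ne'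
  · intro k _
    simp only [dist_comm _ (x k)]
    exact integrable_cap _ _

lemma measurable_gap (j : ℕ) (e : Edges n m) :
    Measurable fun z : Sphere d × (Fin n → Sphere d) => gap δ r p j z.1 z.2 e :=
  (measurable_mass j e).sub_const _

lemma measurable_gap_left (j : ℕ) (x : Fin n → Sphere d) (e : Edges n m) :
    Measurable fun y : Sphere d => gap δ r p j y x e :=
  (measurable_gap (d := d) (δ := δ) (r := r) (p := p) j e).comp
    (f := fun y : Sphere d => (y, x)) (measurable_id.prodMk measurable_const)

lemma abs_gap_le (hδ : 0 < δ) {j : ℕ} (hj : j ≤ n) (y : Sphere d) (x : Fin n → Sphere d)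
    (e : Edges n m) : |gap δ r p j y x e| ≤ n * ((1 + δ) * m + m * j) + |p * ((2 + δ) * m * (j + 1))| :=
  (abs_sub _ _).trans (add_le_add_left (abs_mass_le hδ hj y x e) _)

lemma integrable_abs_gap (hδ : 0 < δ) {j : ℕ} (hj : j ≤ n) (x : Fin n → Sphere d)
    (e : Edges n m) : Integrable (fun y => |gap δ r p j y x e|) (area d) :=
  (integrable_area (measurable_gap_left j x e) fun y => abs_gap_le hδ hj y x e).abs

lemma measurable_shareGap_integrand (b : Fin n) (x : Fin n → Sphere d) (e : Edges n m) :
    Measurable fun w : Sphere d × Sphere d =>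
      share δ r b w.1 (Function.update x b w.2) e * |gap δ r p b w.2 x e| := by
  have hu : Measurable fun w : Sphere d × Sphere d => (w.1, Function.update x b w.2) :=
    measurable_fst.prodMk ((measurable_update x).comp measurable_snd)
  have h1 := (measurable_share (d := d) (δ := δ) (r := r) b e).comp hu
  have h2 := (measurable_gap_left (d := d) (δ := δ) (r := r) (p := p) b x e).comp
    (measurable_snd : Measurable fun w : Sphere d × Sphere d => w.2)
  exact h1.mul (measurable_norm.comp h2)

lemma integrable_shareGap_integrand (hδ : 0 < δ) (b : Fin n) (x : Fin n → Sphere d)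
    (e : Edges n m) : Integrable (fun w : Sphere d × Sphere d =>
      share δ r b w.1 (Function.update x b w.2) e * |gap δ r p b w.2 x e|)
      ((area d).prod (area d)) := by
  have := isProb_area d
  refine Integrable.of_bound (measurable_shareGap_integrand b x e).aestronglyMeasurable
    (1 * (n * ((1 + δ) * m + m * (b : ℕ)) + |p * ((2 + δ) * m * ((b : ℕ) + 1))|))
    (Filter.Eventually.of_forall fun w => ?_)
  rw [Real.norm_eq_abs, abs_mul, abs_abs, abs_of_nonneg (share_nonneg hδ b _ _ e)]
  exact mul_le_mul (share_le_one hδ b _ _ e) (abs_gap_le hδ b.2.le _ x e) (abs_nonneg _) zero_le_one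

lemma integrable_share_mul_gap (hδ : 0 < δ) (b : Fin n) (y : Sphere d) (x : Fin n → Sphere d)
    (e : Edges n m) : Integrable (fun z =>
      share δ r b y (Function.update x b z) e * |gap δ r p b z x e|) (area d) := by
  refine (integrable_abs_gap (r := r) (p := p) hδ b.2.le x e).mono' ?_ (Filter.Eventually.of_forall fun z => ?_)
  · exact ((measurable_share_update b e y x).mul
      (measurable_norm.comp (measurable_gap_left b x e))).aestronglyMeasurable
  · rw [Real.norm_eq_abs, abs_mul, abs_abs, abs_of_nonneg (share_nonneg hδ b _ _ e)]
    exact mul_le_of_le_one_left (abs_nonneg _) (share_le_one hδ b _ _ e)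

lemma shareGap_le (hδ : 0 < δ) (b : Fin n) (y : Sphere d) (x : Fin n → Sphere d)
    (e : Edges n m) : shareGap δ r p b y x e ≤ ∫ z, |gap δ r p b z x e| ∂area d :=
  integral_mono (integrable_share_mul_gap hδ b y x e) (integrable_abs_gap hδ b.2.le x e) fun _ =>
    mul_le_of_le_one_left (abs_nonneg _) (share_le_one hδ b _ _ e)

/-- On average over `y`, the term `shareGap` is a mean deviation, by `integral_share`. -/
lemma integral_shareGap (hcap : CapArea d r p) (hδ : 0 < δ) (hr : 0 ≤ r) (hm : 1 ≤ m)
    (b : Fin n) (x : Fin n → Sphere d) (e : Edges n m) :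
    ∫ y, shareGap δ r p b y x e ∂area d = p * ∫ z, |gap δ r p b z x e| ∂area d := by
  have := isProb_area d
  unfold shareGap
  rw [integral_integral_swap (integrable_shareGap_integrand hδ b x e), ← integral_const_mul]
  simp only [integral_mul_const, integral_share hcap hδ hr hm]

lemma integrable_shareGap (hδ : 0 < δ) (b : Fin n) (x : Fin n → Sphere d)
    (e : Edges n m) : Integrable (fun y => shareGap δ r p b y x e) (area d) := by
  have := isProb_area d
  exact (integrable_shareGap_integrand hδ b x e).integral_prod_left

/-- The drift of the deviation is linear in the deviation, up to an error term which is controlled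
by the mean of the deviation. -/
lemma abs_drift_sub_le (hcap : CapArea d r p) (hδ : 0 < δ) (hr : 0 ≤ r) (hm : 1 ≤ m) (hp : 0 < p)
    {e : Edges n m} (he : Valid e) (b : Fin n) (y : Sphere d) (x : Fin n → Sphere d) :
    |drift δ r p b y x e - p * ((2 + δ) * m)| ≤ 1 / ((2 + δ) * ((b : ℕ) + 1)) *
      (|gap δ r p b y x e| + (1 + δ) * m * (1 + 1 / p) + 1 / p * shareGap δ r p b y x e) := by
  have hprob := isProb_area d
  have h0 : (0 : ℝ) < m := by exact_mod_cast hm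
  set W : ℝ := (2 + δ) * m * ((b : ℕ) + 1) with hW
  have hW0 : 0 < W := by positivity
  set I := ∫ z, share δ r b y (Function.update x b z) e ∂area d with hI
  set S := ∫ z, share δ r b y (Function.update x b z) e * gap δ r p b z x e ∂area d with hS
  set g := gap δ r p b y x e with hg
  have hi1 : Integrable (fun z => share δ r b y (Function.update x b z) e) (area d) :=
    integrable_area (C := 1) (measurable_share_update b e y x) fun z => by
      rw [abs_of_nonneg (share_nonneg hδ b _ _ e)]
      exact share_le_one hδ b _ _ e
  have hi2 : Integrable (fun z => share δ r b y (Function.update x b z) e * gap δ r p b z x e)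
      (area d) := by
    refine (integrable_share_mul_gap (r := r) (p := p) hδ b y x e).mono ?_
      (Filter.Eventually.of_forall fun z => ?_)
    · exact ((measurable_share_update b e y x).mul
        (measurable_gap_left b x e)).aestronglyMeasurable
    · simp
  have hS' : |S| ≤ shareGap δ r p b y x e := by
    refine (abs_integral_le_integral_abs).trans (le_of_eq ?_)
    refine integral_congr_ae (Filter.Eventually.of_forall fun z => ?_)
    simp only [abs_mul, abs_of_nonneg (share_nonneg hδ b _ _ e)]
  have hI01 := integral_share_mem (r := r) hδ b y x e
  rw [← hI] at hI01
  have key : p * W * I + S + (1 + δ) * m * I = p * (g + p * W + (1 + δ) * m) := by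
    have h1 := integral_share_mul hcap hδ hr hm he b y x
    have h2 : ∀ z, share δ r b y (Function.update x b z) e * (mass δ r b z x e + (1 + δ) * m) =
        (p * W + (1 + δ) * m) * share δ r b y (Function.update x b z) e +
          share δ r b y (Function.update x b z) e * gap δ r p b z x e := by
      intro z
      unfold gap
      ring
    simp only [h2] at h1
    rw [integral_add (hi1.const_mul _) hi2, integral_const_mul] at h1
    have h3 : mass δ r b y x e = g + p * W := by
      rw [hg, gap]
      ring
    rw [h3] at h1
    linear_combination h1
  have hd : drift δ r p b y x e - p * ((2 + δ) * m) =
      m / (p * W) * (p * g + p * ((1 + δ) * m) - S - (1 + δ) * m * I) := by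
    have h4 : p * g + p * ((1 + δ) * m) - S - (1 + δ) * m * I = p * W * I - p * W * p := by
      linear_combination -key
    rw [h4, drift, ← hI]
    field_simp
    ring
  have hk : 1 / ((2 + δ) * ((b : ℕ) + 1)) = m / W := by
    rw [hW]
    field_simp
  rw [hd, hk, abs_mul, abs_of_pos (by positivity), mul_comm p W, ← div_div, div_mul_eq_mul_div,
    mul_div_assoc]
  refine mul_le_mul_of_nonneg_left ?_ (by positivity)
  rw [div_le_iff₀ hp]
  have h5 : |p * g + p * ((1 + δ) * m) - S - (1 + δ) * m * I| ≤
      p * |g| + p * ((1 + δ) * m) + shareGap δ r p b y x e + (1 + δ) * m := by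
    have e1 : |p * g| = p * |g| := by rw [abs_mul, abs_of_pos hp]
    have e2 : |p * ((1 + δ) * (m : ℝ))| = p * ((1 + δ) * m) := abs_of_pos (by positivity)
    have e3 : |(1 + δ) * m * I| ≤ (1 + δ) * m := by
      rw [abs_of_nonneg (by have := hI01.1; positivity)]
      exact mul_le_of_le_one_right (by positivity) hI01.2
    have := abs_sub (p * g + p * ((1 + δ) * m) - S) ((1 + δ) * m * I)
    have := abs_sub (p * g + p * ((1 + δ) * m)) S
    have := abs_add_le (p * g) (p * ((1 + δ) * m))
    linarith
  refine h5.trans (le_of_eq ?_)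
  field_simp
  ring

/-- `shareGap`, as a sequence indexed by the natural numbers. -/
def shareGapSeq (δ r p : ℝ) (i : ℕ) (y : Sphere d) (x : Fin n → Sphere d) (e : Edges n m) : ℝ :=
  if h : i < n then shareGap δ r p ⟨i, h⟩ y x e else 0

/-- The deviation of the weight at `y`, in terms of the fluctuation and of the previous deviations.
-/
lemma abs_gap_le_sum (hcap : CapArea d r p) (hδ : 0 < δ) (hr : 0 ≤ r) (hm : 1 ≤ m) (hp : 0 < p)
    {e : Edges n m} (he : Valid e) (y : Sphere d) (x : Fin n → Sphere d) {j : ℕ} (hj : j ≤ n) :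
    |gap δ r p j y x e| ≤ |fluct δ r p j y x e| + p * ((2 + δ) * m) + ∑ i ∈ Finset.range j,
      1 / ((2 + δ) * ((i : ℝ) + 1)) * (|gap δ r p i y x e| + (1 + δ) * m * (1 + 1 / p) +
        1 / p * shareGapSeq δ r p i y x e) := by
  suffices h : |gap δ r p j y x e - fluct δ r p j y x e| ≤ p * ((2 + δ) * m) +
      ∑ i ∈ Finset.range j, 1 / ((2 + δ) * ((i : ℝ) + 1)) * (|gap δ r p i y x e| +
        (1 + δ) * m * (1 + 1 / p) + 1 / p * shareGapSeq δ r p i y x e) by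
    have h2 := abs_sub_abs_le_abs_sub (gap δ r p j y x e) (fluct δ r p j y x e)
    linarith
  induction j with
  | zero =>
    simp [gap, fluct, mass, abs_mul, abs_of_pos hp, abs_of_pos (by linarith : 0 < 2 + δ)]
  | succ j ih =>
    have ih := ih (by omega)
    have h1 := abs_drift_sub_le hcap hδ hr hm hp he ⟨j, hj⟩ y x
    have h2 := fluct_succ (δ := δ) (r := r) (p := p) ⟨j, hj⟩ y x e
    simp only at h1 h2
    have h3 : gap δ r p (j + 1) y x e - fluct δ r p (j + 1) y x e =
        (gap δ r p j y x e - fluct δ r p j y x e) +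
          (drift δ r p ⟨j, hj⟩ y x e - p * ((2 + δ) * m)) := by
      rw [h2]
      unfold gap
      push_cast
      ring
    rw [h3, Finset.sum_range_succ]
    refine (abs_add_le _ _).trans ?_
    have h4 : shareGapSeq δ r p j y x e = shareGap δ r p ⟨j, hj⟩ y x e := by
      rw [shareGapSeq, dif_pos]
    rw [h4]
    linarith

lemma measurable_fluct_left (j : ℕ) (x : Fin n → Sphere d) (e : Edges n m) :
    Measurable fun y : Sphere d => fluct δ r p j y x e :=
  (measurable_fluct (d := d) (δ := δ) (r := r) (p := p) j e).comp
    (f := fun y : Sphere d => (y, x)) (measurable_id.prodMk measurable_const)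

lemma integrable_abs_fluct (hδ : 0 < δ) (hp : 0 ≤ p) (hp1 : p ≤ 1) {j : ℕ} (hj : j ≤ n)
    (x : Fin n → Sphere d) (e : Edges n m) :
    Integrable (fun y => |fluct δ r p j y x e|) (area d) :=
  (integrable_area (measurable_fluct_left j x e) fun y => abs_fluct_le hδ hp hp1 hj y x e).abs

/-- The mean deviation of the weight satisfies a closed recursion: the two terms of
`abs_drift_sub_le` contribute the same amount, which gives the factor `2`. -/
lemma integral_abs_gap_le_sum (hcap : CapArea d r p) (hδ : 0 < δ) (hr : 0 ≤ r) (hm : 1 ≤ m)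
    (hp : 0 < p) (hp1 : p ≤ 1) {e : Edges n m} (he : Valid e) (x : Fin n → Sphere d) {j : ℕ}
    (hj : j ≤ n) :
    ∫ y, |gap δ r p j y x e| ∂area d ≤ ∫ y, |fluct δ r p j y x e| ∂area d + p * ((2 + δ) * m) +
      ∑ i ∈ Finset.range j, 1 / ((2 + δ) * ((i : ℝ) + 1)) *
        (2 * ∫ y, |gap δ r p i y x e| ∂area d + (1 + δ) * m * (1 + 1 / p)) := by
  have hprob := isProb_area d
  have hs : ∀ i, Integrable (fun y => shareGapSeq δ r p i y x e) (area d) := by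
    intro i
    unfold shareGapSeq
    split_ifs
    · exact integrable_shareGap hδ _ x e
    · exact integrable_const _
  have hI : ∀ i ∈ Finset.range j, Integrable (fun y => 1 / ((2 + δ) * ((i : ℝ) + 1)) *
      (|gap δ r p i y x e| + (1 + δ) * m * (1 + 1 / p) + 1 / p * shareGapSeq δ r p i y x e))
      (area d) := by
    intro i hi
    have hi' := Finset.mem_range.1 hi
    exact (((integrable_abs_gap hδ (by omega) x e).add (integrable_const _)).add
      ((hs i).const_mul _)).const_mul _
  refine (integral_mono (integrable_abs_gap hδ hj x e)
    (((integrable_abs_fluct hδ hp.le hp1 hj x e).add (integrable_const _)).add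
      (integrable_finsetSum _ hI))
    fun y => abs_gap_le_sum hcap hδ hr hm hp he y x hj).trans (le_of_eq ?_)
  have hf := integrable_abs_fluct (r := r) hδ hp.le hp1 hj x e
  have e1 : ∫ y, (|fluct δ r p j y x e| + p * ((2 + δ) * m) + ∑ i ∈ Finset.range j,
      1 / ((2 + δ) * ((i : ℝ) + 1)) * (|gap δ r p i y x e| + (1 + δ) * m * (1 + 1 / p) +
        1 / p * shareGapSeq δ r p i y x e)) ∂area d =
      (∫ y, (|fluct δ r p j y x e| + p * ((2 + δ) * m)) ∂area d) +
      ∫ y, ∑ i ∈ Finset.range j,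
      1 / ((2 + δ) * ((i : ℝ) + 1)) * (|gap δ r p i y x e| + (1 + δ) * m * (1 + 1 / p) +
        1 / p * shareGapSeq δ r p i y x e) ∂area d :=
    integral_add (hf.add (integrable_const _)) (integrable_finsetSum _ hI)
  refine e1.trans ?_
  rw [integral_add hf (integrable_const _), integral_finsetSum _ hI]
  simp only [integral_const, probReal_univ, smul_eq_mul, one_mul]
  congr 1
  refine Finset.sum_congr rfl fun i hi => ?_
  have hi' : i < n := lt_of_lt_of_le (Finset.mem_range.1 hi) hj
  have hg := integrable_abs_gap (r := r) (p := p) hδ hi'.le x e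
  have e2 : ∫ y, (|gap δ r p i y x e| + (1 + δ) * m * (1 + 1 / p) +
      1 / p * shareGapSeq δ r p i y x e) ∂area d =
      (∫ y, (|gap δ r p i y x e| + (1 + δ) * m * (1 + 1 / p)) ∂area d) +
      ∫ y, 1 / p * shareGapSeq δ r p i y x e ∂area d :=
    integral_add (hg.add (integrable_const _)) ((hs i).const_mul _)
  have e3 : ∫ y, shareGapSeq δ r p i y x e ∂area d = p * ∫ z, |gap δ r p i z x e| ∂area d := by
    simp only [shareGapSeq, hi', dif_pos]
    exact integral_shareGap hcap hδ hr hm ⟨i, hi'⟩ x e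
  rw [integral_const_mul, e2, integral_add hg (integrable_const _), integral_const,
    integral_const_mul (1 / p), e3, probReal_univ, one_smul]
  congr 1
  field_simp
  ring

end Pathwise

/-! ### Concentration of the weight -/

section Concentration

variable {d n m : ℕ} {δ r p : ℝ}

/-- If the fluctuations are small, near `y` and on average, then the weight near `y` is close to its
typical value. -/
lemma exists_abs_gap_le (hδ : 0 < δ) (hm : 1 ≤ m) (hp : 0 < p) (hp1 : p ≤ 1) {γ : ℝ}
    (hγ : 2 / (2 + δ) < γ) (hγ1 : γ ≤ 1) :
    ∃ G : ℝ, 0 < G ∧ ∀ (d n : ℕ) (r : ℝ), CapArea d r p → 0 ≤ r →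
      ∀ (e : Edges n m), Valid e → ∀ (y : Sphere d) (x : Fin n → Sphere d) (j : ℕ), j ≤ n →
      ∀ Λ : ℝ, 1 ≤ Λ →
      (∀ i ≤ j, |fluct δ r p i y x e| ≤ Λ * ((i : ℝ) + 1) ^ γ) →
      (∀ i ≤ j, ∫ z, |fluct δ r p i z x e| ∂area d ≤ Λ * ((i : ℝ) + 1) ^ γ) →
      |gap δ r p j y x e| ≤ G * Λ * ((j : ℝ) + 1) ^ γ := by
  have h0 : (0 : ℝ) < m := by exact_mod_cast hm
  have h2 : 0 < 2 + δ := by linarith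
  set θ : ℝ := 2 / (2 + δ) with hθ
  have hθ0 : 0 < θ := by positivity
  have hγ0 : 0 < γ := by linarith
  have hγθ : 0 < γ - θ := by linarith
  have hθ' : 1 / (2 + δ) < γ := lt_of_le_of_lt (by rw [hθ]; gcongr; norm_num) hγ
  have hγθ' : 0 < γ - 1 / (2 + δ) := by linarith
  set C₂ : ℝ := (1 + δ) * m * (1 + 1 / p) with hC₂
  have hC₂0 : 0 < C₂ := by positivity
  set D : ℝ := 1 + p * ((2 + δ) * m) + C₂ / ((2 + δ) * γ) with hD
  have hD0 : 0 < D := by positivity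
  set A : ℝ := D * (γ / (γ - θ)) with hA
  have hA0 : 0 < A := by positivity
  set D' : ℝ := D + A / (p * (2 + δ) * γ) with hD'
  have hD'0 : 0 < D' := by positivity
  refine ⟨D' * (γ / (γ - 1 / (2 + δ))), by positivity, ?_⟩
  intro d n r hcap hr e he y x j hj Λ hΛ H1 H2
  have hone : ∀ i : ℕ, 1 ≤ ((i : ℝ) + 1) ^ γ := fun i =>
    Real.one_le_rpow (by linarith [(Nat.cast_nonneg i : (0 : ℝ) ≤ i)]) hγ0.le
  have hconst : ∀ i : ℕ, Λ * ((i : ℝ) + 1) ^ γ + p * ((2 + δ) * m) +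
      C₂ / (2 + δ) * ∑ l ∈ Finset.range i, 1 / ((l : ℝ) + 1) ≤ D * Λ * ((i : ℝ) + 1) ^ γ := by
    intro i
    have e1 := mul_le_mul_of_nonneg_left (sum_inv_le hγ0 hγ1 i) (by positivity : 0 ≤ C₂ / (2 + δ))
    have e2 : 1 ≤ Λ * ((i : ℝ) + 1) ^ γ := one_le_mul_of_one_le_of_one_le hΛ (hone i)
    have e3 : C₂ / (2 + δ) * (((i : ℝ) + 1) ^ γ / γ) = C₂ / ((2 + δ) * γ) * ((i : ℝ) + 1) ^ γ := by
      field_simp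
    have e4 : C₂ / ((2 + δ) * γ) * ((i : ℝ) + 1) ^ γ ≤
        C₂ / ((2 + δ) * γ) * (Λ * ((i : ℝ) + 1) ^ γ) := by
      refine mul_le_mul_of_nonneg_left ?_ (by positivity)
      exact le_mul_of_one_le_left (by positivity) hΛ
    have e5 : p * ((2 + δ) * m) ≤ p * ((2 + δ) * m) * (Λ * ((i : ℝ) + 1) ^ γ) :=
      le_mul_of_one_le_right (by positivity) e2
    have e6 : D * Λ * ((i : ℝ) + 1) ^ γ = Λ * ((i : ℝ) + 1) ^ γ +
        p * ((2 + δ) * m) * (Λ * ((i : ℝ) + 1) ^ γ) +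
        C₂ / ((2 + δ) * γ) * (Λ * ((i : ℝ) + 1) ^ γ) := by
      rw [hD]
      ring
    linarith
  -- The mean deviation has to be bounded first, as it enters the recursion at each point.
  have hL1 := gronwall (a := fun i => ∫ z, |gap δ r p i z x e| ∂area d) (B := D * Λ) (θ := θ)
    (γ := γ) (N := j) (by positivity) hθ0.le hγ hγ1 (fun i hi => by
      have h := integral_abs_gap_le_sum hcap hδ hr hm hp hp1 he x (hi.trans hj)
      have e6 : ∑ l ∈ Finset.range i, 1 / ((2 + δ) * ((l : ℝ) + 1)) *
          (2 * ∫ z, |gap δ r p l z x e| ∂area d + C₂) =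
          θ * ∑ l ∈ Finset.range i, (∫ z, |gap δ r p l z x e| ∂area d) / ((l : ℝ) + 1) +
            C₂ / (2 + δ) * ∑ l ∈ Finset.range i, 1 / ((l : ℝ) + 1) := by
        rw [Finset.mul_sum, Finset.mul_sum, ← Finset.sum_add_distrib]
        refine Finset.sum_congr rfl fun l _ => ?_
        rw [hθ]
        field_simp
      rw [e6] at h
      have := hconst i
      have := H2 i hi
      linarith)
  have hpt := gronwall (a := fun i => |gap δ r p i y x e|) (B := D' * Λ) (θ := 1 / (2 + δ))
    (γ := γ) (N := j) (by positivity) (by positivity) hθ' hγ1 (fun i hi => by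
      have h := abs_gap_le_sum hcap hδ hr hm hp he y x (hi.trans hj)
      have e7 : ∑ l ∈ Finset.range i, 1 / ((2 + δ) * ((l : ℝ) + 1)) * (|gap δ r p l y x e| + C₂ +
            1 / p * shareGapSeq δ r p l y x e) ≤
          1 / (2 + δ) * ∑ l ∈ Finset.range i, |gap δ r p l y x e| / ((l : ℝ) + 1) +
            C₂ / (2 + δ) * ∑ l ∈ Finset.range i, 1 / ((l : ℝ) + 1) +
            Λ * A / (p * (2 + δ)) * ∑ l ∈ Finset.range i, ((l : ℝ) + 1) ^ (γ - 1) := by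
        rw [Finset.mul_sum, Finset.mul_sum, Finset.mul_sum, ← Finset.sum_add_distrib,
          ← Finset.sum_add_distrib]
        refine Finset.sum_le_sum fun l hl => ?_
        have hl' := Finset.mem_range.1 hl
        have hl0 : (0 : ℝ) < (l : ℝ) + 1 := by positivity
        have e8 : shareGapSeq δ r p l y x e ≤ D * Λ * (γ / (γ - θ)) * ((l : ℝ) + 1) ^ γ := by
          have hln : l < n := by omega
          rw [shareGapSeq, dif_pos hln]
          exact (shareGap_le hδ ⟨l, hln⟩ y x e).trans (hL1 l (by omega))
        have e9 : 1 / ((2 + δ) * ((l : ℝ) + 1)) * (1 / p * shareGapSeq δ r p l y x e) ≤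
            1 / ((2 + δ) * ((l : ℝ) + 1)) * (1 / p * (D * Λ * (γ / (γ - θ)) * ((l : ℝ) + 1) ^ γ)) := by
          gcongr
        have e10 : 1 / ((2 + δ) * ((l : ℝ) + 1)) *
            (1 / p * (D * Λ * (γ / (γ - θ)) * ((l : ℝ) + 1) ^ γ)) =
            Λ * A / (p * (2 + δ)) * ((l : ℝ) + 1) ^ (γ - 1) := by
          rw [Real.rpow_sub_one hl0.ne', hA]
          field_simp
        rw [e10] at e9
        have e11 : 1 / ((2 + δ) * ((l : ℝ) + 1)) * (|gap δ r p l y x e| + C₂) =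
            1 / (2 + δ) * (|gap δ r p l y x e| / ((l : ℝ) + 1)) +
            C₂ / (2 + δ) * (1 / ((l : ℝ) + 1)) := by
          field_simp
        rw [mul_add, e11]
        linarith
      have e12 := mul_le_mul_of_nonneg_left (sum_rpow_sub_one_le hγ0 hγ1 i)
        (by positivity : 0 ≤ Λ * A / (p * (2 + δ)))
      have e13 : Λ * A / (p * (2 + δ)) * (((i : ℝ) + 1) ^ γ / γ) =
          A / (p * (2 + δ) * γ) * Λ * ((i : ℝ) + 1) ^ γ := by
        field_simp
      have := hconst i
      have := H1 i hi
      have e14 : D' * Λ * ((i : ℝ) + 1) ^ γ = D * Λ * ((i : ℝ) + 1) ^ γ +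
          A / (p * (2 + δ) * γ) * Λ * ((i : ℝ) + 1) ^ γ := by
        rw [hD']
        ring
      rw [e14]
      linarith)
  refine (hpt j le_rfl).trans (le_of_eq ?_)
  ring

/-- The exponent of the error terms. The deviations of the weight are, with high probability, of
order `j ^ γ` for all `γ` above both `2 / (2 + δ)`, the rate of growth in the recursion of the mean
deviation, and `1 / 2`, the order of the fluctuations. An eighth of the remaining margin leaves
room for the tail bounds. -/
def errExp (δ : ℝ) : ℝ := (1 - max (2 / (2 + δ)) (1 / 2)) / 8

lemma errExp_pos (hδ : 0 < δ) : 0 < errExp δ := by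
  have h1 : 2 / (2 + δ) < 1 := by rw [div_lt_one (by linarith)]; linarith
  have h2 : max (2 / (2 + δ)) (1 / 2) < 1 := max_lt h1 (by norm_num)
  unfold errExp
  linarith

lemma errExp_le (δ : ℝ) : errExp δ ≤ 1 / 16 := by
  have h2 : 1 / 2 ≤ max (2 / (2 + δ)) (1 / 2) := le_max_right _ _
  unfold errExp
  linarith

/-- The typical total weight near a point when there are `j + 1` vertices. -/
def typical (δ p : ℝ) (m j : ℕ) : ℝ := p * ((2 + δ) * m * (j + 1))

/-- The indicator of the event that the weight which a vertex with index `j` and position `y` finds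
around it is atypical. -/
def badInd (δ r p : ℝ) (j : ℕ) (y : Sphere d) (x : Fin n → Sphere d) (e : Edges n m) : ℝ :=
  if typical δ p m j * ((j : ℝ) + 1) ^ (-errExp δ) / 2 <
    |mass δ r j y x e + (1 + δ) * m - typical δ p m j| then 1 else 0

lemma badInd_mem (j : ℕ) (y : Sphere d) (x : Fin n → Sphere d) (e : Edges n m) :
    badInd δ r p j y x e ∈ Set.Icc (0 : ℝ) 1 := by
  unfold badInd
  split_ifs <;> simp

lemma measurable_badInd (j : ℕ) (e : Edges n m) :
    Measurable fun z : Sphere d × (Fin n → Sphere d) => badInd δ r p j z.1 z.2 e := by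
  unfold badInd
  refine Measurable.ite (measurableSet_lt measurable_const ?_) measurable_const measurable_const
  exact measurable_norm.comp (((measurable_mass j e).add_const _).sub_const _)

lemma nice_badInd (j : ℕ) (y : Sphere d) : Nice (n := n) (m := m) (badInd δ r p j y) :=
  ⟨fun e => (measurable_badInd (d := d) (δ := δ) (r := r) (p := p) j e).comp
    (f := fun x => (y, x)) (measurable_const_prodMk y), 1, fun x e => by
      obtain ⟨h0, h1⟩ := badInd_mem (δ := δ) (r := r) (p := p) j y x e
      rwa [abs_of_nonneg h0]⟩

/-- A two-sided exponential of the fluctuation. -/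
def expFluct (δ r p t : ℝ) (i : ℕ) (y : Sphere d) (x : Fin n → Sphere d) (e : Edges n m) : ℝ :=
  Real.exp (t * fluct δ r p i y x e) + Real.exp (-t * fluct δ r p i y x e)

lemma exp_abs_le {t u : ℝ} : Real.exp (t * |u|) ≤ Real.exp (t * u) + Real.exp (-t * u) := by
  rcases le_total 0 u with h | h
  · rw [abs_of_nonneg h]
    linarith [Real.exp_pos (-t * u)]
  · rw [abs_of_nonpos h, mul_neg, ← neg_mul]
    linarith [Real.exp_pos (t * u)]

lemma expFluct_le (hδ : 0 < δ) (hp : 0 ≤ p) (hp1 : p ≤ 1) {t : ℝ} (ht : 0 ≤ t) {i : ℕ} (hi : i ≤ n)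
    (y : Sphere d) (x : Fin n → Sphere d) (e : Edges n m) :
    expFluct δ r p t i y x e ≤
      2 * Real.exp (t * (n * ((1 + δ) * m + m * i) + n * ((2 + δ) * m))) := by
  have h := abs_fluct_le (r := r) hδ hp hp1 hi y x e
  have h1 : t * fluct δ r p i y x e ≤ t * (n * ((1 + δ) * m + m * i) + n * ((2 + δ) * m)) :=
    mul_le_mul_of_nonneg_left ((le_abs_self _).trans h) ht
  have h2 : -t * fluct δ r p i y x e ≤ t * (n * ((1 + δ) * m + m * i) + n * ((2 + δ) * m)) := by
    rw [neg_mul, ← mul_neg]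
    exact mul_le_mul_of_nonneg_left ((neg_le_abs _).trans h) ht
  unfold expFluct
  linarith [Real.exp_le_exp.2 h1, Real.exp_le_exp.2 h2]

lemma expFluct_nonneg (t : ℝ) (i : ℕ) (y : Sphere d) (x : Fin n → Sphere d) (e : Edges n m) :
    0 ≤ expFluct δ r p t i y x e := by
  unfold expFluct
  positivity

lemma measurable_expFluct (t : ℝ) (i : ℕ) (e : Edges n m) :
    Measurable fun z : Sphere d × (Fin n → Sphere d) => expFluct δ r p t i z.1 z.2 e :=
  (Real.measurable_exp.comp (measurable_const.mul (measurable_fluct i e))).add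
    (Real.measurable_exp.comp (measurable_const.mul (measurable_fluct i e)))

lemma nice_expFluct (hδ : 0 < δ) (hp : 0 ≤ p) (hp1 : p ≤ 1) (t : ℝ) {i : ℕ} (hi : i ≤ n)
    (y : Sphere d) : Nice (n := n) (m := m) (expFluct δ r p t i y) :=
  ((nice_fluct hδ hp hp1 hi y).comp (φ := fun s => Real.exp (t * s)) (by fun_prop)).add
    ((nice_fluct hδ hp hp1 hi y).comp (φ := fun s => Real.exp (-t * s)) (by fun_prop))

variable {μ : Fin n → Measure (Sphere d)} [∀ b, IsProbabilityMeasure (μ b)]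

/-- Exponential moments of the fluctuation at the scale of a random walk. -/
lemma expect_expFluct_le (hcap : CapArea d r p) (hδ : 0 < δ) (hr : 0 ≤ r) (hm : 1 ≤ m)
    (hp : 0 ≤ p) (hp1 : p ≤ 1) (σ : Finset (Fin n)) (hσ : ∀ b ∉ σ, μ b = area d) (y : Sphere d)
    {t : ℝ} (ht0 : 0 ≤ t) (ht : t * ((2 + δ) * m) ≤ 1) {i j : ℕ}
    (hti : i * (t * ((2 + δ) * m)) ^ 2 ≤ 1) (hij : i ≤ j) (hj : j ≤ n) :
    expect δ r μ j (expFluct (m := m) δ r p t i y) ≤ 2 * Real.exp (1 + σ.card) := by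
  have hd : DependsBefore (n := n) (m := m) i (expFluct δ r p t i y) := by
    intro x x' e e' hx he
    simp only [expFluct, dependsBefore_fluct i y x x' e e' hx he]
  have hi : i ≤ n := hij.trans hj
  rw [expect_eq_of_dependsBefore (nice_expFluct hδ hp hp1 t hi y) hδ hr hm hij hj hd]
  unfold expFluct
  rw [expect_add hδ hr
    ((nice_fluct hδ hp hp1 hi y).comp (φ := fun s => Real.exp (t * s)) (by fun_prop))
    ((nice_fluct hδ hp hp1 hi y).comp (φ := fun s => Real.exp (-t * s)) (by fun_prop))]
  have h1 := expect_exp_fluct_le (μ := μ) hcap hδ hr hm hp hp1 σ hσ y (t := t)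
    (by rwa [abs_of_nonneg ht0]) hi
  have h2 := expect_exp_fluct_le (μ := μ) hcap hδ hr hm hp hp1 σ hσ y (t := -t)
    (by rwa [abs_neg, abs_of_nonneg ht0]) hi
  have h3 : Real.exp (i * (t * ((2 + δ) * m)) ^ 2 + σ.card) ≤ Real.exp (1 + σ.card) :=
    Real.exp_le_exp.2 (by linarith)
  rw [neg_mul, neg_sq] at h2
  linarith

/-- Jensen's inequality for the mean fluctuation. -/
lemma exp_integral_le_integral_expFluct (hδ : 0 < δ) (hp : 0 ≤ p) (hp1 : p ≤ 1) {t : ℝ} (ht : 0 ≤ t)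
    {i : ℕ} (hi : i ≤ n) (x : Fin n → Sphere d) (e : Edges n m) :
    Real.exp (t * ∫ y, |fluct δ r p i y x e| ∂area d) ≤ ∫ y, expFluct δ r p t i y x e ∂area d := by
  have hprob := isProb_area d
  have hf := integrable_abs_fluct (r := r) hδ hp hp1 hi x e
  have hF : Integrable (fun y => expFluct δ r p t i y x e) (area d) := by
    refine integrable_area
      (C := 2 * Real.exp (t * (n * ((1 + δ) * m + m * i) + n * ((2 + δ) * m))))
      ((measurable_expFluct (d := d) (δ := δ) (r := r) (p := p) t i e).comp
      (f := fun y : Sphere d => (y, x)) (measurable_id.prodMk measurable_const)) fun y => ?_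
    rw [abs_of_nonneg (expFluct_nonneg t i y x e)]
    exact expFluct_le hδ hp hp1 ht hi y x e
  set v := t * ∫ y, |fluct δ r p i y x e| ∂area d with hv
  have h1 : ∫ y, Real.exp v * (1 + (t * |fluct δ r p i y x e| - v)) ∂area d ≤
      ∫ y, expFluct δ r p t i y x e ∂area d := by
    refine integral_mono (((integrable_const _).add
      ((hf.const_mul t).sub (integrable_const _))).const_mul _) hF fun y => ?_
    refine le_trans ?_ exp_abs_le
    have h2 := Real.add_one_le_exp (t * |fluct δ r p i y x e| - v)
    have h3 : Real.exp (t * |fluct δ r p i y x e|) =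
        Real.exp v * Real.exp (t * |fluct δ r p i y x e| - v) := by
      rw [← Real.exp_add]
      congr 1
      ring
    rw [h3]
    exact mul_le_mul_of_nonneg_left (by linarith) (Real.exp_pos v).le
  have h4 : ∫ y, (1 + (t * |fluct δ r p i y x e| - v)) ∂area d = 1 := by
    have h5 : ∀ y, 1 + (t * |fluct δ r p i y x e| - v) = t * |fluct δ r p i y x e| + (1 - v) :=
      fun y => by ring
    simp only [h5]
    rw [integral_add (hf.const_mul t) (integrable_const _), integral_const_mul, ← hv]
    simp
  rwa [integral_const_mul, h4, mul_one] at h1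

lemma mul_exp_neg_le {h c : ℝ} (hh : 0 < h) (hc : 0 < c) (K : ℕ) :
    ∃ C : ℝ, ∀ J : ℝ, 1 ≤ J → J * Real.exp (-(J ^ h / c)) ≤ C / J ^ K := by
  obtain ⟨N, hN⟩ := exists_nat_ge (((K : ℝ) + 1) / h)
  refine ⟨N.factorial * c ^ N, fun J hJ => ?_⟩
  have hJ0 : 0 < J := by linarith
  have hN' : (K : ℝ) + 1 ≤ h * N := by rwa [div_le_iff₀ hh, mul_comm] at hN
  have h1 := Real.pow_div_factorial_le_exp (J ^ h / c) (by positivity) N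
  have h2 : J ^ (K + 1) ≤ (J ^ h) ^ N := by
    rw [← Real.rpow_natCast, ← Real.rpow_natCast, ← Real.rpow_mul hJ0.le]
    exact Real.rpow_le_rpow_of_exponent_le hJ (by push_cast; linarith)
  rw [Real.exp_neg, le_div_iff₀ (by positivity), ← div_eq_mul_inv, div_mul_eq_mul_div,
    div_le_iff₀ (Real.exp_pos _)]
  rw [div_pow, div_div, div_le_iff₀ (by positivity)] at h1
  calc J * J ^ K = J ^ (K + 1) := by ring
    _ ≤ (J ^ h) ^ N := h2
    _ ≤ _ := h1
    _ = _ := by ring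

/-- Atypical weights are improbable, to any polynomial order and uniformly in the positions of a
bounded number of vertices. -/
theorem exists_expect_badInd_le (hδ : 0 < δ) (hm : 1 ≤ m) (hp : 0 < p) (hp1 : p ≤ 1) (s K : ℕ) :
    ∃ C : ℝ, 0 ≤ C ∧ ∀ (d n : ℕ) (r : ℝ), CapArea d r p → 0 ≤ r →
      ∀ (μ : Fin n → Measure (Sphere d)) [∀ b, IsProbabilityMeasure (μ b)] (σ : Finset (Fin n)),
      σ.card ≤ s → (∀ b ∉ σ, μ b = area d) → ∀ (y : Sphere d) (j : ℕ), j ≤ n →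
      expect δ r μ j (badInd (m := m) δ r p j y) ≤ C / ((j : ℝ) + 1) ^ K := by
  have h0 : (0 : ℝ) < m := by exact_mod_cast hm
  set θ₀ : ℝ := max (2 / (2 + δ)) (1 / 2) with hθ₀
  set h : ℝ := errExp δ with hh
  have hh0 : 0 < h := errExp_pos hδ
  have hh8 : 8 * h = 1 - θ₀ := by rw [hh, errExp]; ring
  set γ : ℝ := θ₀ + 4 * h with hγ
  have hγ2 : 2 / (2 + δ) < γ := lt_of_le_of_lt (le_max_left _ _) (by rw [hγ]; linarith)
  have hγ12 : 1 / 2 ≤ γ := (le_max_right (2 / (2 + δ)) (1 / 2)).trans (by rw [hγ]; linarith)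
  have hγ1 : γ ≤ 1 := by rw [hγ]; linarith
  obtain ⟨G, hG, hgap⟩ := exists_abs_gap_le hδ hm hp hp1 hγ2 hγ1
  set c : ℝ := (2 + δ) * m with hc
  have hc0 : 0 < c := by positivity
  set G' : ℝ := G + (1 + δ) * m with hG'
  have hG'0 : 0 < G' := by positivity
  set Q : ℝ := 2 * G' / (p * c) with hQ
  have hQ0 : 0 < Q := by positivity
  set C₁ : ℝ := Q ^ ((K : ℝ) / (2 * h)) with hC₁
  have hC₁0 : 0 < C₁ := by positivity
  obtain ⟨C₂, hC₂⟩ := mul_exp_neg_le hh0 hc0 K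
  have hC₂0 : 0 ≤ C₂ := by
    have h1 := hC₂ 1 le_rfl
    rw [one_pow, div_one] at h1
    exact le_trans (by positivity) h1
  refine ⟨C₁ + 4 * Real.exp (1 + s) * C₂, by positivity, ?_⟩
  intro d n r hcap hr μ _ σ hσs hσ y j hj
  have hprob := isProb_area d
  set J : ℝ := (j : ℝ) + 1 with hJ
  have hJ1 : 1 ≤ J := by rw [hJ]; linarith [(Nat.cast_nonneg j : (0 : ℝ) ≤ j)]
  have hJ0 : 0 < J := by linarith
  set Λ : ℝ := J ^ h with hΛ
  have hΛ1 : 1 ≤ Λ := Real.one_le_rpow hJ1 hh0.le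
  -- the tilts for which the exponential moments of the fluctuation are bounded
  set t : ℕ → ℝ := fun i => 1 / (c * Real.sqrt ((i : ℝ) + 1)) with ht
  have hsq : ∀ i : ℕ, 1 ≤ Real.sqrt ((i : ℝ) + 1) := fun i =>
    Real.one_le_sqrt.2 (by linarith [(Nat.cast_nonneg i : (0 : ℝ) ≤ i)])
  have hsq0 : ∀ i : ℕ, 0 < Real.sqrt ((i : ℝ) + 1) := fun i => lt_of_lt_of_le zero_lt_one (hsq i)
  have ht0 : ∀ i, 0 ≤ t i := fun i => by positivity
  have htc : ∀ i, t i * c = 1 / Real.sqrt ((i : ℝ) + 1) := fun i => by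
    have := hsq0 i
    rw [ht]
    field_simp
  have htc1 : ∀ i, t i * c ≤ 1 := fun i => by
    rw [htc, div_le_one (hsq0 i)]
    exact hsq i
  have hti : ∀ i : ℕ, i * (t i * c) ^ 2 ≤ 1 := fun i => by
    rw [htc, div_pow, one_pow, Real.sq_sqrt (by positivity), mul_one_div, div_le_one (by positivity)]
    linarith
  have htΛ : ∀ i : ℕ, Λ / c ≤ t i * (Λ * ((i : ℝ) + 1) ^ γ) := fun i => by
    have h1 : Real.sqrt ((i : ℝ) + 1) ≤ ((i : ℝ) + 1) ^ γ := by
      rw [Real.sqrt_eq_rpow]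
      exact Real.rpow_le_rpow_of_exponent_le
        (by linarith [(Nat.cast_nonneg i : (0 : ℝ) ≤ i)]) hγ12
    have h2 := hsq0 i
    rw [ht]
    simp only
    rw [one_div_mul_eq_div, div_le_div_iff₀ hc0 (by positivity)]
    have : Λ * (c * Real.sqrt ((i : ℝ) + 1)) ≤ Λ * (c * ((i : ℝ) + 1) ^ γ) := by gcongr
    linarith
  have hniceI : ∀ i ∈ Finset.range (j + 1), Nice (n := n) (m := m)
      (fun x e => ∫ z, expFluct δ r p (t i) i z x e ∂area d) := by
    intro i hi
    have hin : i ≤ n := by have := Finset.mem_range.1 hi; omega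
    refine ⟨fun e => ?_, 2 * Real.exp (t i * (n * ((1 + δ) * m + m * i) + n * ((2 + δ) * m))),
      fun x e => ?_⟩
    · have h1 : Measurable fun w : (Fin n → Sphere d) × Sphere d =>
          expFluct δ r p (t i) i w.2 w.1 e :=
        (measurable_expFluct (d := d) (δ := δ) (r := r) (p := p) (t i) i e).comp
          (f := fun w : (Fin n → Sphere d) × Sphere d => (w.2, w.1)) measurable_swap
      exact h1.stronglyMeasurable.integral_prod_right'.measurable
    · have h1 : ‖∫ z, expFluct δ r p (t i) i z x e ∂area d‖ ≤
          2 * Real.exp (t i * (n * ((1 + δ) * m + m * i) + n * ((2 + δ) * m))) *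
            (area d).real Set.univ := by
        refine norm_integral_le_of_norm_le_const (Filter.Eventually.of_forall fun z => ?_)
        rw [Real.norm_eq_abs, abs_of_nonneg (expFluct_nonneg _ i z x e)]
        exact expFluct_le hδ hp.le hp1 (ht0 i) hin z x e
      rwa [probReal_univ, mul_one] at h1
  have hnice : ∀ i ∈ Finset.range (j + 1), Nice (n := n) (m := m)
      (fun x e => expFluct δ r p (t i) i y x e + ∫ z, expFluct δ r p (t i) i z x e ∂area d) :=
    fun i hi => (nice_expFluct hδ hp.le hp1 (t i)
      (by have := Finset.mem_range.1 hi; omega) y).add (hniceI i hi)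
  -- Either `j` is small, and the first term exceeds one, or one of the fluctuations is large, and
  -- the second term does, as in Markov inequalities.
  have hpath : ∀ x (e : Edges n m), Valid e → badInd δ r p j y x e ≤ C₁ / J ^ K +
      Real.exp (-(Λ / c)) * ∑ i ∈ Finset.range (j + 1),
        (expFluct δ r p (t i) i y x e + ∫ z, expFluct δ r p (t i) i z x e ∂area d) := by
    intro x e he
    have hint : ∀ i, 0 ≤ ∫ z, expFluct δ r p (t i) i z x e ∂area d := fun i =>
      integral_nonneg fun z => expFluct_nonneg _ _ _ _ _
    have hsum0 : ∀ i ∈ Finset.range (j + 1), 0 ≤ expFluct δ r p (t i) i y x e +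
        ∫ z, expFluct δ r p (t i) i z x e ∂area d := fun i _ =>
      add_nonneg (expFluct_nonneg _ _ _ _ _) (hint i)
    have hlarge : ∀ i ≤ j, Real.exp (Λ / c) ≤ expFluct δ r p (t i) i y x e +
        ∫ z, expFluct δ r p (t i) i z x e ∂area d → 1 ≤ Real.exp (-(Λ / c)) *
        ∑ i ∈ Finset.range (j + 1),
        (expFluct δ r p (t i) i y x e + ∫ z, expFluct δ r p (t i) i z x e ∂area d) := by
      intro i hi hle
      have h1 := hle.trans (Finset.single_le_sum hsum0 (Finset.mem_range.2 (by omega : i < j + 1)))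
      have h2 := mul_le_mul_of_nonneg_left h1 (Real.exp_pos (-(Λ / c))).le
      rwa [← Real.exp_add, neg_add_cancel, Real.exp_zero] at h2
    have hC1K : 0 ≤ C₁ / J ^ K := by positivity
    have hS : 0 ≤ Real.exp (-(Λ / c)) * ∑ i ∈ Finset.range (j + 1),
        (expFluct δ r p (t i) i y x e + ∫ z, expFluct δ r p (t i) i z x e ∂area d) :=
      mul_nonneg (Real.exp_pos _).le (Finset.sum_nonneg hsum0)
    have hb1 := (badInd_mem (δ := δ) (r := r) (p := p) j y x e).2
    by_cases H1 : ∀ i ≤ j, |fluct δ r p i y x e| ≤ Λ * ((i : ℝ) + 1) ^ γ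
    swap
    · push Not at H1
      obtain ⟨i, hi, hlt⟩ := H1
      have := hlarge i hi (by
        have h1 : Real.exp (Λ / c) ≤ Real.exp (t i * |fluct δ r p i y x e|) :=
          Real.exp_le_exp.2 ((htΛ i).trans (mul_le_mul_of_nonneg_left hlt.le (ht0 i)))
        have h2 : Real.exp (t i * |fluct δ r p i y x e|) ≤ expFluct δ r p (t i) i y x e :=
          exp_abs_le
        linarith [hint i])
      linarith
    by_cases H2 : ∀ i ≤ j, ∫ z, |fluct δ r p i z x e| ∂area d ≤ Λ * ((i : ℝ) + 1) ^ γ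
    swap
    · push Not at H2
      obtain ⟨i, hi, hlt⟩ := H2
      have := hlarge i hi (by
        have h1 : Real.exp (Λ / c) ≤ Real.exp (t i * ∫ z, |fluct δ r p i z x e| ∂area d) :=
          Real.exp_le_exp.2 ((htΛ i).trans (mul_le_mul_of_nonneg_left hlt.le (ht0 i)))
        have h2 := exp_integral_le_integral_expFluct (r := r) hδ hp.le hp1 (ht0 i)
          (by omega : i ≤ n) x e
        linarith [expFluct_nonneg (δ := δ) (r := r) (p := p) (t i) i y x e])
      linarith
    have hg := hgap d n r hcap hr e he y x j hj Λ hΛ1 H1 H2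
    unfold badInd
    split_ifs with hbad
    swap
    · linarith
    -- for large `j` the bound on the deviation contradicts the event
    have h1 : |mass δ r j y x e + (1 + δ) * m - typical δ p m j| ≤ G' * (Λ * J ^ γ) := by
      have h2 : mass δ r j y x e + (1 + δ) * m - typical δ p m j =
          gap δ r p j y x e + (1 + δ) * m := by
        unfold gap typical
        ring
      have h3 : (1 + δ) * m ≤ (1 + δ) * m * (Λ * J ^ γ) :=
        le_mul_of_one_le_right (by positivity)
          (one_le_mul_of_one_le_of_one_le hΛ1 (Real.one_le_rpow hJ1 (by linarith)))
      rw [h2]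
      refine (abs_add_le _ _).trans ?_
      rw [abs_of_pos (by positivity : 0 < (1 + δ) * (m : ℝ)), hG', add_mul]
      linarith
    have h4 : J ^ (2 * h) < Q := by
      have h5 := lt_of_lt_of_le hbad h1
      have h6 : typical δ p m j = p * c * J := by
        unfold typical
        rw [hc, hJ]
        ring
      have h7 : J * J ^ (-h) = J ^ (2 * h) * (Λ * J ^ γ) := by
        rw [hΛ, ← Real.rpow_add hJ0, ← Real.rpow_add hJ0]
        nth_rewrite 1 [← Real.rpow_one J]
        rw [← Real.rpow_add hJ0]
        congr 1
        rw [hγ]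
        linarith
      have h8 : 0 < Λ * J ^ γ := by positivity
      rw [h6, mul_assoc, h7] at h5
      rw [hQ, lt_div_iff₀ (by positivity)]
      have h9 : (J ^ (2 * h) * (p * c)) * (Λ * J ^ γ) < (2 * G') * (Λ * J ^ γ) := by linarith
      exact lt_of_mul_lt_mul_right h9 h8.le
    have h10 : J ^ K ≤ C₁ := by
      have h11 : (J ^ (2 * h)) ^ ((K : ℝ) / (2 * h)) = J ^ K := by
        rw [← Real.rpow_mul hJ0.le, mul_div_cancel₀ _ (by positivity), Real.rpow_natCast]
      rw [← h11]
      exact Real.rpow_le_rpow (by positivity) h4.le (by positivity)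
    have h12 : 1 ≤ C₁ / J ^ K := by
      rwa [le_div_iff₀ (by positivity), one_mul]
    linarith
  have hexp : ∀ i ∈ Finset.range (j + 1), expect δ r μ j (fun x (e : Edges n m) =>
      expFluct δ r p (t i) i y x e + ∫ z, expFluct δ r p (t i) i z x e ∂area d) ≤
      4 * Real.exp (1 + s) := by
    intro i hi
    have hij : i ≤ j := by have := Finset.mem_range.1 hi; omega
    have hin : i ≤ n := hij.trans hj
    have hb : ∀ z, expect δ r μ j (expFluct (m := m) δ r p (t i) i z) ≤ 2 * Real.exp (1 + s) := by
      intro z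
      refine (expect_expFluct_le hcap hδ hr hm hp.le hp1 σ hσ z (ht0 i) (htc1 i) (hti i) hij
        hj).trans ?_
      have : (σ.card : ℝ) ≤ s := by exact_mod_cast hσs
      gcongr
    have hbound : ∀ (z : Sphere d) (x : Fin n → Sphere d) (e : Edges n m), |expFluct δ r p (t i) i z x e| ≤
        2 * Real.exp (t i * (n * ((1 + δ) * m + m * i) + n * ((2 + δ) * m))) := fun z x e => by
      rw [abs_of_nonneg (expFluct_nonneg _ i z x e)]
      exact expFluct_le hδ hp.le hp1 (ht0 i) hin z x e
    rw [expect_add hδ hr (nice_expFluct hδ hp.le hp1 (t i) hin y) (hniceI i hi),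
      expect_integral hδ hr (fun e => measurable_expFluct (t i) i e) hbound]
    have h1 : ∫ z, expect δ r μ j (expFluct (m := m) δ r p (t i) i z) ∂area d ≤
        2 * Real.exp (1 + s) := by
      refine (integral_mono_of_nonneg (Filter.Eventually.of_forall fun z => ?_)
        (integrable_const (2 * Real.exp (1 + s))) (Filter.Eventually.of_forall hb)).trans (by simp)
      exact integral_nonneg fun x => Finset.sum_nonneg fun e _ =>
        mul_nonneg (density_nonneg hδ _ _ _) (expFluct_nonneg _ _ _ _ _)
    have := hb y
    linarith
  have hmain := expect_mono (μ := μ) (j := j) hδ hr (nice_badInd (δ := δ) (r := r) (p := p) j y)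
    ((nice_const (C₁ / J ^ K)).add ((Nice.sum _ hnice).const_mul (Real.exp (-(Λ / c))))) hpath
  rw [expect_add hδ hr (nice_const _) ((Nice.sum _ hnice).const_mul _), expect_const_mul,
    expect_const hδ hr hm hj, expect_sum hδ hr _ hnice] at hmain
  refine hmain.trans ?_
  have h1 := Finset.sum_le_sum hexp
  rw [Finset.sum_const, Finset.card_range, nsmul_eq_mul] at h1
  have h2 := mul_le_mul_of_nonneg_left h1 (Real.exp_pos (-(Λ / c))).le
  have h3 := mul_le_mul_of_nonneg_left (hC₂ J hJ1) (by positivity : 0 ≤ 4 * Real.exp (1 + (s : ℝ)))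
  have h4 : Real.exp (-(Λ / c)) * (((j + 1 : ℕ) : ℝ) * (4 * Real.exp (1 + s))) =
      4 * Real.exp (1 + s) * (J * Real.exp (-(J ^ h / c))) := by
    push_cast
    rw [← hJ, ← hΛ]
    ring
  rw [h4] at h2
  rw [add_div]
  have h5 : 4 * Real.exp (1 + s) * (C₂ / J ^ K) = 4 * Real.exp (1 + s) * C₂ / J ^ K := by ring
  linarith

end Concentration

/-! ### Elementary estimates -/

section Estimates

lemma exp_sub_one_le {s : ℝ} : Real.exp s - 1 ≤ s * Real.exp s := by
  have h := Real.add_one_le_exp (-s)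
  have h2 := mul_le_mul_of_nonneg_right h (Real.exp_pos s).le
  rw [← Real.exp_add, neg_add_cancel, Real.exp_zero] at h2
  linarith

lemma exp_sub_one_sub_le {s : ℝ} (hs : 0 ≤ s) : Real.exp s - 1 - s ≤ s ^ 2 * Real.exp s := by
  have h := mul_le_mul_of_nonneg_left (exp_sub_one_le (s := s)) hs
  have h2 := exp_sub_one_le (s := s)
  have h3 : s * (s * Real.exp s) = s ^ 2 * Real.exp s := by ring
  have h4 : s * Real.exp s - s = s * (Real.exp s - 1) := by ring
  linarith

/-- A product of factors close to one, to first order. -/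
lemma abs_prod_one_add_sub_le {ι : Type*} (s : Finset ι) {u : ι → ℝ} {v V : ℝ} (M : ℕ)
    (hM : s.card ≤ M) (hu0 : ∀ i ∈ s, 0 ≤ u i) (huv : ∀ i ∈ s, u i ≤ v) (hv : 0 ≤ v) (hvV : v ≤ V) :
    |∏ i ∈ s, (1 + u i) - (1 + ∑ i ∈ s, u i)| ≤ (M * v) ^ 2 * Real.exp (M * V) := by
  have hs0 : 0 ≤ ∑ i ∈ s, u i := Finset.sum_nonneg hu0
  have hlow : 1 + ∑ i ∈ s, u i ≤ ∏ i ∈ s, (1 + u i) :=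
    by
      clear hs0 hM huv
      induction s using Finset.cons_induction with
      | empty => simp
      | cons i s hi ih =>
        have h0 : 0 ≤ ∑ j ∈ s, u j := Finset.sum_nonneg fun j hj => hu0 j (Finset.mem_cons_of_mem hj)
        have h1 := ih fun j hj => hu0 j (Finset.mem_cons_of_mem hj)
        have h2 := hu0 i (Finset.mem_cons_self i s)
        rw [Finset.sum_cons, Finset.prod_cons]
        nlinarith
  have hup : ∏ i ∈ s, (1 + u i) ≤ Real.exp (∑ i ∈ s, u i) := by
    rw [Real.exp_sum]
    exact Finset.prod_le_prod (fun i hi => by have := hu0 i hi; linarith)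
      fun i hi => by rw [add_comm]; exact Real.add_one_le_exp _
  have hsum : ∑ i ∈ s, u i ≤ M * v := by
    refine (Finset.sum_le_card_nsmul s u v huv).trans ?_
    rw [nsmul_eq_mul]
    exact mul_le_mul_of_nonneg_right (by exact_mod_cast hM) hv
  rw [abs_of_nonneg (by linarith)]
  have h1 := exp_sub_one_sub_le hs0
  have h2 : (∑ i ∈ s, u i) ^ 2 * Real.exp (∑ i ∈ s, u i) ≤ (M * v) ^ 2 * Real.exp (M * V) := by
    have h3 : ∑ i ∈ s, u i ≤ M * V := hsum.trans (by gcongr)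
    gcongr
  linarith

/-- A product of factors close to one, to leading order. -/
lemma abs_prod_sub_one_le {ι : Type*} (s : Finset ι) {u : ι → ℝ} {v V : ℝ} (M : ℕ)
    (hM : s.card ≤ M) (hu : ∀ i ∈ s, |u i - 1| ≤ v) (hv : 0 ≤ v) (hvV : v ≤ V) :
    |∏ i ∈ s, u i - 1| ≤ M * v * Real.exp (M * V) := by
  have h1 := Finset.norm_prod_one_add_sub_one_le s fun i => u i - 1
  simp only [add_sub_cancel, Real.norm_eq_abs] at h1
  have hsum : ∑ i ∈ s, |u i - 1| ≤ M * v := by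
    refine (Finset.sum_le_card_nsmul s _ v hu).trans ?_
    rw [nsmul_eq_mul]
    exact mul_le_mul_of_nonneg_right (by exact_mod_cast hM) hv
  refine h1.trans (exp_sub_one_le.trans ?_)
  have h3 : ∑ i ∈ s, |u i - 1| ≤ M * V := hsum.trans (by gcongr)
  gcongr

lemma rpow_neg_one_sub_eq {J h : ℝ} (hJ : 0 < J) : J ^ (-1 - h) = J ^ (-h) / J := by
  rw [show -1 - h = -h - 1 by ring, Real.rpow_sub_one hJ.ne']

lemma sum_rpow_tail_le {h : ℝ} (h0 : 0 < h) (h1 : h ≤ 1) (α n : ℕ) :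
    ∑ j ∈ Finset.Ico α n, ((j : ℝ) + 1) ^ (-1 - h) ≤ 4 / h * ((α : ℝ) + 1) ^ (-h) := by
  have hterm : ∀ j : ℕ, ((j : ℝ) + 1) ^ (-1 - h) ≤
      4 / h * (((j : ℝ) + 1) ^ (-h) - (((j + 1 : ℕ) : ℝ) + 1) ^ (-h)) := by
    intro j
    have hj : (0 : ℝ) ≤ j := Nat.cast_nonneg j
    set T : ℝ := (j : ℝ) + 2 with hT
    have hT0 : 0 < T := by positivity
    have hT1 : (((j + 1 : ℕ) : ℝ) + 1) = T := by push_cast; ring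
    have hT2 : (j : ℝ) + 1 = T * (1 + -1 / T) := by field_simp; ring
    have hq0 : 0 < 1 + -1 / T := by
      have : (0 : ℝ) < (j : ℝ) + 1 := by positivity
      rw [hT2] at this
      exact pos_of_mul_pos_right this hT0.le
    have hB := rpow_one_add_le_one_add_mul_self (s := -1 / T) (p := h)
      (by linarith) h0.le h1
    have hpos : 0 < (1 + -1 / T) ^ h := Real.rpow_pos_of_pos hq0 h
    have hinv : 1 + h / T ≤ (1 + -1 / T) ^ (-h) := by
      rw [Real.rpow_neg hq0.le, ← one_div, le_div_iff₀ hpos]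
      have h3 : (1 + h / T) * (1 + -1 / T) ^ h ≤ (1 + h / T) * (1 + h * (-1 / T)) :=
        mul_le_mul_of_nonneg_left hB (by positivity)
      have h4 : (1 + h / T) * (1 + h * (-1 / T)) = 1 - (h / T) ^ 2 := by ring
      nlinarith [sq_nonneg (h / T)]
    have h5 : h * T ^ (-1 - h) ≤ ((j : ℝ) + 1) ^ (-h) - T ^ (-h) := by
      rw [hT2, Real.mul_rpow hT0.le hq0.le, rpow_neg_one_sub_eq hT0]
      have h6 := mul_le_mul_of_nonneg_left hinv (Real.rpow_pos_of_pos hT0 (-h)).le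
      have h7 : T ^ (-h) * (1 + h / T) = T ^ (-h) + h * (T ^ (-h) / T) := by ring
      linarith
    have h8 : ((j : ℝ) + 1) ^ (-1 - h) ≤ 4 * T ^ (-1 - h) := by
      have h9 : (2 * ((j : ℝ) + 1)) ^ (-1 - h) ≤ T ^ (-1 - h) :=
        Real.rpow_le_rpow_of_nonpos hT0 (by rw [hT]; linarith) (by linarith)
      rw [Real.mul_rpow (by norm_num) (by positivity)] at h9
      have h10 : (1 : ℝ) / 4 ≤ 2 ^ (-1 - h) := by
        have : (2 : ℝ) ^ (-2 : ℝ) ≤ 2 ^ (-1 - h) :=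
          Real.rpow_le_rpow_of_exponent_le (by norm_num) (by linarith)
        refine le_trans (le_of_eq ?_) this
        rw [Real.rpow_neg (by norm_num)]
        norm_num
      have h11 := mul_le_mul_of_nonneg_right h10
        (Real.rpow_pos_of_pos (by positivity : (0 : ℝ) < (j : ℝ) + 1) (-1 - h)).le
      linarith
    rw [hT1, div_mul_eq_mul_div, le_div_iff₀ h0]
    nlinarith
  rcases le_or_gt α n with hn | hn
  · refine (Finset.sum_le_sum fun j _ => hterm j).trans ?_
    rw [← Finset.mul_sum]
    refine mul_le_mul_of_nonneg_left ?_ (by positivity)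
    have h12 : ∑ j ∈ Finset.Ico α n, (((j : ℝ) + 1) ^ (-h) - (((j + 1 : ℕ) : ℝ) + 1) ^ (-h)) =
        ((α : ℝ) + 1) ^ (-h) - ((n : ℝ) + 1) ^ (-h) := by
      induction n, hn using Nat.le_induction with
      | base => simp
      | succ n hn ih =>
        rw [Finset.sum_Ico_succ_top hn, ih]
        ring
    rw [h12]
    have : 0 < ((n : ℝ) + 1) ^ (-h) := by positivity
    linarith
  · rw [Finset.Ico_eq_empty (by omega), Finset.sum_empty]
    positivity

/-- A sequence with small relative increments is nearly constant. -/
lemma abs_sub_le_of_increments {w η : ℕ → ℝ} {α n : ℕ} (hαn : α ≤ n) (hη : ∀ j, 0 ≤ η j)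
    (hwα : 0 ≤ w α) (h : ∀ j, α ≤ j → j < n → |w (j + 1) - w j| ≤ η j * w j) :
    |w n - w α| ≤ w α * (Real.exp (∑ j ∈ Finset.Ico α n, η j) - 1) := by
  induction n, hαn using Nat.le_induction with
  | base => simp
  | succ n hn ih =>
    have ih := ih fun j hj hj' => h j hj (by omega)
    have h1 := h n hn (by omega)
    rw [Finset.sum_Ico_succ_top hn, Real.exp_add]
    set E := Real.exp (∑ j ∈ Finset.Ico α n, η j) with hE
    have h2 : w n ≤ w α * E := by
      have := (abs_le.1 ih).2
      linarith
    have h3 : |w (n + 1) - w α| ≤ |w (n + 1) - w n| + |w n - w α| := abs_sub_le _ _ _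
    have h4 : η n * w n ≤ η n * (w α * E) := mul_le_mul_of_nonneg_left h2 (hη n)
    have h5 := Real.add_one_le_exp (η n)
    have h6 : w α * E * (η n + 1) ≤ w α * E * Real.exp (η n) :=
      mul_le_mul_of_nonneg_left h5 (mul_nonneg hwα (Real.exp_pos _).le)
    linarith

lemma rpow_neg_le_one {J h : ℝ} (hJ : 1 ≤ J) (hh : 0 ≤ h) : J ^ (-h) ≤ 1 :=
  Real.rpow_le_one_of_one_le_of_nonpos hJ (by linarith)

lemma inv_le_rpow_neg {J h : ℝ} (hJ : 1 ≤ J) (hh : h ≤ 1) : 1 / J ≤ J ^ (-h) := by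
  rw [one_div, ← Real.rpow_neg_one]
  exact Real.rpow_le_rpow_of_exponent_le hJ (by linarith)

lemma inv_sq_le_rpow {J h : ℝ} (hJ : 1 ≤ J) (hh : h ≤ 1) : 1 / J ^ 2 ≤ J ^ (-1 - h) := by
  have hJ0 : 0 < J := by linarith
  rw [rpow_neg_one_sub_eq hJ0, sq, ← div_div]
  exact div_le_div_of_nonneg_right (inv_le_rpow_neg hJ hh) hJ0.le

/-- The factor `(1 + 1 / j) ^ s`, to first order. -/
lemma ratio_rpow_bounds {s : ℝ} (hs0 : 0 ≤ s) (hs1 : s ≤ 1) {j : ℕ} (hj : 1 ≤ j) :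
    s / ((j : ℝ) + 1) ≤ (((j : ℝ) + 1) / j) ^ s - 1 ∧
      (((j : ℝ) + 1) / j) ^ s - 1 ≤ s / j := by
  have hj0 : (0 : ℝ) < j := by exact_mod_cast hj
  constructor
  · have hB := rpow_one_add_le_one_add_mul_self (s := -1 / ((j : ℝ) + 1)) (p := s)
      (by rw [le_div_iff₀ (by positivity)]; linarith) hs0 hs1
    have e1 : 1 + -1 / ((j : ℝ) + 1) = ((((j : ℝ) + 1) / j))⁻¹ := by
      field_simp
      ring
    rw [e1, Real.inv_rpow (by positivity)] at hB
    set R := (((j : ℝ) + 1) / j) ^ s with hR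
    have hR0 : 0 < R := by positivity
    have hB2 := mul_le_mul_of_nonneg_right hB hR0.le
    rw [inv_mul_cancel₀ hR0.ne'] at hB2
    have hR1 : 1 ≤ R := Real.one_le_rpow (by rw [le_div_iff₀ hj0]; linarith) hs0
    have e2 : (1 + s * (-1 / ((j : ℝ) + 1))) * R = R - s / ((j : ℝ) + 1) * R := by ring
    have e3 : s / ((j : ℝ) + 1) * 1 ≤ s / ((j : ℝ) + 1) * R :=
      mul_le_mul_of_nonneg_left hR1 (by positivity)
    linarith
  · have hB := rpow_one_add_le_one_add_mul_self (s := 1 / (j : ℝ)) (p := s)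
      (by have : 0 < 1 / (j : ℝ) := by positivity
          linarith) hs0 hs1
    have e1 : 1 + 1 / (j : ℝ) = ((j : ℝ) + 1) / j := by
      field_simp
    rw [e1] at hB
    have e2 : s * (1 / (j : ℝ)) = s / j := by ring
    linarith

/-- The factor by which the weights of `N` edges grow in one step, to first order. -/
lemma abs_ratio_pow_sub_le {s : ℝ} (hs0 : 0 ≤ s) (hs1 : s ≤ 1) {k N j : ℕ} (hN : N ≤ k)
    (hj : 1 ≤ j ∨ N = 0) :
    |((((j : ℝ) + 1) / j) ^ s) ^ N - (1 + N * (s / ((j : ℝ) + 1)))| ≤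
      ((2 * k) ^ 2 * Real.exp (2 * k) + 2 * k) / ((j : ℝ) + 1) ^ 2 := by
  rcases Nat.eq_zero_or_pos N with rfl | hN0
  · simp
    positivity
  have hj1 : 1 ≤ j := by omega
  have hj0 : (1 : ℝ) ≤ j := by exact_mod_cast hj1
  obtain ⟨h1, h2⟩ := ratio_rpow_bounds hs0 hs1 hj1
  set u := (((j : ℝ) + 1) / j) ^ s - 1 with hu
  have hu1 : (((j : ℝ) + 1) / j) ^ s = 1 + u := by rw [hu]; ring
  set J : ℝ := (j : ℝ) + 1 with hJ
  have hJ0 : 0 < J := by positivity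
  have h3 : s / j ≤ 2 / J := by
    rw [div_le_div_iff₀ (by positivity) hJ0]
    nlinarith
  have hu0 : 0 ≤ u := le_trans (by positivity) h1
  have h4 := abs_prod_one_add_sub_le (Finset.range N) (u := fun _ => u) (v := 2 / J) (V := 2) k
    (by simpa using hN) (fun _ _ => hu0) (fun _ _ => h2.trans h3) (by positivity)
    (by rw [div_le_iff₀ hJ0]; linarith)
  rw [Finset.prod_const, Finset.sum_const, Finset.card_range, nsmul_eq_mul] at h4
  have h5 : |(N : ℝ) * u - N * (s / J)| ≤ 2 * k / J ^ 2 := by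
    rw [← mul_sub, abs_mul, abs_of_nonneg (Nat.cast_nonneg N), abs_of_nonneg (by linarith)]
    have h6 : u - s / J ≤ 2 / J ^ 2 := by
      have h7 : s / j - s / J ≤ 2 / J ^ 2 := by
        rw [div_sub_div _ _ (by positivity) hJ0.ne', div_le_div_iff₀ (by positivity) (by positivity)]
        have : s * J - j * s = s := by rw [hJ]; ring
        rw [this]
        nlinarith [mul_nonneg hs0 hJ0.le, mul_pos hJ0 hJ0]
      linarith
    have h8 : (N : ℝ) ≤ k := by exact_mod_cast hN
    calc (N : ℝ) * (u - s / J) ≤ k * (2 / J ^ 2) := by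
          refine mul_le_mul h8 h6 (by linarith) (by positivity)
      _ = _ := by ring
  rw [hu1]
  have h9 : (1 + u) ^ N - (1 + N * (s / J)) =
      ((1 + u) ^ N - (1 + N * u)) + (N * u - N * (s / J)) := by ring
  rw [h9]
  refine (abs_add_le _ _).trans ((add_le_add h4 h5).trans (le_of_eq ?_))
  rw [mul_comm (k : ℝ) 2]
  field_simp

variable {m : ℕ} {δ p : ℝ}

lemma typical_pos (hδ : 0 < δ) (hm : 1 ≤ m) (hp : 0 < p) (j : ℕ) : 0 < typical δ p m j := by
  have h0 : (0 : ℝ) < m := by exact_mod_cast hm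
  unfold typical
  positivity

/-- The factor of a step without prescribed edges, to first order. -/
lemma exists_abs_prod_factor_sub_le (hδ : 0 < δ) (hm : 1 ≤ m) (hp : 0 < p) (k : ℕ) :
    ∃ C : ℝ, 0 ≤ C ∧ ∀ (j : ℕ) (Z L : ℝ), (1 + δ) * m ≤ Z → 0 ≤ L → L ≤ k →
      (|Z - typical δ p m j| ≤ typical δ p m j * ((j : ℝ) + 1) ^ (-errExp δ) / 2 →
        |∏ i : Fin m, (1 + L / (Z + (i : ℕ))) - (1 + m * L / typical δ p m j)| ≤
          C * ((j : ℝ) + 1) ^ (-1 - errExp δ)) ∧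
      |∏ i : Fin m, (1 + L / (Z + (i : ℕ))) - (1 + m * L / typical δ p m j)| ≤ C := by
  have h0 : (0 : ℝ) < m := by exact_mod_cast hm
  set h := errExp δ with hh
  have hh0 : 0 < h := errExp_pos hδ
  have hh1 : h ≤ 1 := (errExp_le δ).trans (by norm_num)
  set g : ℝ := p * ((2 + δ) * m) with hg
  have hg0 : 0 < g := by positivity
  set C₁ : ℝ := (m * (2 * k / g)) ^ 2 * Real.exp (m * (2 * k / g)) + m * k / g + 2 * m ^ 2 * k / g ^ 2
    with hC₁
  set C₂ : ℝ := (m * (k / ((1 + δ) * m))) ^ 2 * Real.exp (m * (k / ((1 + δ) * m))) +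
    (m * (k / ((1 + δ) * m)) + m * k / g) with hC₂
  have hC₁0 : 0 ≤ C₁ := by positivity
  have hC₂0 : 0 ≤ C₂ := by positivity
  refine ⟨C₁ + C₂, by positivity, fun j Z L hZ hL0 hLk => ?_⟩
  set J : ℝ := (j : ℝ) + 1 with hJ
  have hJ1 : 1 ≤ J := by rw [hJ]; linarith [(Nat.cast_nonneg j : (0 : ℝ) ≤ j)]
  have hJ0 : 0 < J := by linarith
  have htyp : typical δ p m j = g * J := by
    unfold typical
    rw [hg, hJ]
    ring
  have hZ0 : 0 < Z := lt_of_lt_of_le (by positivity) hZ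
  have hi0 : ∀ i : Fin m, 0 < Z + (i : ℕ) := fun i => by positivity
  have hcard : (Finset.univ : Finset (Fin m)).card ≤ m := by simp
  have hpow0 : 0 < J ^ (-1 - h) := by positivity
  constructor
  · intro hgood
    rw [htyp] at hgood ⊢
    have hpow1 := rpow_neg_le_one hJ1 hh0.le
    have hZ2 : g * J / 2 ≤ Z := by
      have h1 := (abs_le.1 hgood).1
      have h2 : g * J * J ^ (-h) ≤ g * J := mul_le_of_le_one_right (by positivity) hpow1
      linarith
    have hu : ∀ i : Fin m, L / (Z + (i : ℕ)) ≤ 2 * k / g / J := by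
      intro i
      have h3 : g * J / 2 ≤ Z + (i : ℕ) := by
        have : (0 : ℝ) ≤ (i : ℕ) := Nat.cast_nonneg _
        linarith
      calc L / (Z + (i : ℕ)) ≤ k / (g * J / 2) := by gcongr
        _ = _ := by field_simp
    have h4 := abs_prod_one_add_sub_le Finset.univ (u := fun i : Fin m => L / (Z + (i : ℕ)))
      (v := 2 * k / g / J) (V := 2 * k / g) m hcard (fun i _ => div_nonneg hL0 (hi0 i).le)
      (fun i _ => hu i) (by positivity) (div_le_self (by positivity) hJ1)
    have h5 : |∑ i : Fin m, L / (Z + (i : ℕ)) - m * L / (g * J)| ≤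
        m * k / g * J ^ (-1 - h) + 2 * m ^ 2 * k / g ^ 2 / J ^ 2 := by
      have h6 : ∑ i : Fin m, L / (Z + (i : ℕ)) - m * L / (g * J) =
          ∑ i : Fin m, (L / (Z + (i : ℕ)) - L / (g * J)) := by
        rw [Finset.sum_sub_distrib, Finset.sum_const, Finset.card_univ, Fintype.card_fin,
          nsmul_eq_mul]
        ring
      rw [h6]
      refine (Finset.abs_sum_le_sum_abs _ _).trans ?_
      calc _ ≤ ∑ _i : Fin m, (k / g * J ^ (-1 - h) + 2 * m * k / g ^ 2 / J ^ 2) := by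
            refine Finset.sum_le_sum fun i _ => ?_
            have h7 : L / (Z + (i : ℕ)) - L / (g * J) =
                L * (g * J - Z - (i : ℕ)) / ((Z + (i : ℕ)) * (g * J)) := by
              have := hi0 i
              field_simp
              ring
            rw [h7, abs_div, abs_mul, abs_of_nonneg hL0,
              abs_of_pos (mul_pos (hi0 i) (by positivity))]
            have h8 : |g * J - Z - (i : ℕ)| ≤ g * J * J ^ (-h) / 2 + m := by
              refine (abs_sub _ _).trans (add_le_add ?_ ?_)
              · rwa [abs_sub_comm]
              · rw [abs_of_nonneg (Nat.cast_nonneg _)]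
                exact_mod_cast i.2.le
            have h9 : g * J / 2 ≤ Z + (i : ℕ) := by
              have : (0 : ℝ) ≤ (i : ℕ) := Nat.cast_nonneg _
              linarith
            calc L * |g * J - Z - (i : ℕ)| / ((Z + (i : ℕ)) * (g * J)) ≤
                  k * (g * J * J ^ (-h) / 2 + m) / (g * J / 2 * (g * J)) := by gcongr
              _ = _ := by
                  rw [rpow_neg_one_sub_eq hJ0]
                  field_simp
        _ = _ := by
            rw [Finset.sum_const, Finset.card_univ, Fintype.card_fin, nsmul_eq_mul]
            ring
    have h10 : (m * (2 * k / g / J)) ^ 2 * Real.exp (m * (2 * k / g)) =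
        (m * (2 * k / g)) ^ 2 * Real.exp (m * (2 * k / g)) * (1 / J ^ 2) := by
      field_simp
    have h11 := inv_sq_le_rpow hJ1 hh1
    have h12 : (m * (2 * k / g)) ^ 2 * Real.exp (m * (2 * k / g)) * (1 / J ^ 2) ≤
        (m * (2 * k / g)) ^ 2 * Real.exp (m * (2 * k / g)) * J ^ (-1 - h) := by gcongr
    have h13 : 2 * m ^ 2 * k / g ^ 2 / J ^ 2 ≤ 2 * m ^ 2 * k / g ^ 2 * J ^ (-1 - h) := by
      rw [div_eq_mul_one_div _ (J ^ 2)]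
      gcongr
    have h14 : ∏ i : Fin m, (1 + L / (Z + (i : ℕ))) - (1 + m * L / (g * J)) =
        (∏ i : Fin m, (1 + L / (Z + (i : ℕ))) - (1 + ∑ i : Fin m, L / (Z + (i : ℕ)))) +
        (∑ i : Fin m, L / (Z + (i : ℕ)) - m * L / (g * J)) := by ring
    rw [h14]
    refine (abs_add_le _ _).trans ?_
    have h15 : (C₁ + C₂) * J ^ (-1 - h) = (m * (2 * k / g)) ^ 2 * Real.exp (m * (2 * k / g)) *
        J ^ (-1 - h) + m * k / g * J ^ (-1 - h) + 2 * m ^ 2 * k / g ^ 2 * J ^ (-1 - h) +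
        C₂ * J ^ (-1 - h) := by
      rw [hC₁]
      ring
    have h16 : 0 ≤ C₂ * J ^ (-1 - h) := by positivity
    rw [h15]
    linarith
  · rw [htyp]
    have hu : ∀ i : Fin m, L / (Z + (i : ℕ)) ≤ k / ((1 + δ) * m) := by
      intro i
      have h3 : (1 + δ) * m ≤ Z + (i : ℕ) := by
        have : (0 : ℝ) ≤ (i : ℕ) := Nat.cast_nonneg _
        linarith
      gcongr
    have h4 := abs_prod_one_add_sub_le Finset.univ (u := fun i : Fin m => L / (Z + (i : ℕ)))
      (v := k / ((1 + δ) * m)) (V := k / ((1 + δ) * m)) m hcard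
      (fun i _ => div_nonneg hL0 (hi0 i).le) (fun i _ => hu i) (by positivity) le_rfl
    have h5 : |∑ i : Fin m, L / (Z + (i : ℕ)) - m * L / (g * J)| ≤
        m * (k / ((1 + δ) * m)) + m * k / g := by
      refine (abs_sub _ _).trans (add_le_add ?_ ?_)
      · rw [abs_of_nonneg (Finset.sum_nonneg fun i _ => div_nonneg hL0 (hi0 i).le)]
        refine (Finset.sum_le_card_nsmul _ _ _ fun i _ => hu i).trans (le_of_eq ?_)
        simp
      · rw [abs_of_nonneg (by positivity)]
        have : g ≤ g * J := le_mul_of_one_le_right hg0.le hJ1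
        gcongr
    have h14 : ∏ i : Fin m, (1 + L / (Z + (i : ℕ))) - (1 + m * L / (g * J)) =
        (∏ i : Fin m, (1 + L / (Z + (i : ℕ))) - (1 + ∑ i : Fin m, L / (Z + (i : ℕ)))) +
        (∑ i : Fin m, L / (Z + (i : ℕ)) - m * L / (g * J)) := by ring
    rw [h14]
    refine (abs_add_le _ _).trans ?_
    linarith

/-- The factor of a step with prescribed edges, to leading order. -/
lemma exists_abs_prod_factor_le (hδ : 0 < δ) (hm : 1 ≤ m) (hp : 0 < p) (k : ℕ) :
    ∃ C : ℝ, 0 ≤ C ∧ ∀ (j : ℕ) (Z : ℝ) (S : Finset (Fin m)) (L : Fin m → ℝ), (1 + δ) * m ≤ Z →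
      (∀ i, 0 ≤ L i) → (∀ i, L i ≤ k) →
      (|Z - typical δ p m j| ≤ typical δ p m j * ((j : ℝ) + 1) ^ (-errExp δ) / 2 →
        |(∏ i : Fin m, if i ∈ S then 1 / (Z + (i : ℕ)) else 1 + L i / (Z + (i : ℕ))) -
          (1 / typical δ p m j) ^ S.card| ≤
          C * ((j : ℝ) + 1) ^ (-errExp δ) * (1 / typical δ p m j) ^ S.card) ∧
      |∏ i : Fin m, if i ∈ S then 1 / (Z + (i : ℕ)) else 1 + L i / (Z + (i : ℕ))| ≤ C := by
  have h0 : (0 : ℝ) < m := by exact_mod_cast hm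
  set h := errExp δ with hh
  have hh0 : 0 < h := errExp_pos hδ
  have hh1 : h ≤ 1 := (errExp_le δ).trans (by norm_num)
  set g : ℝ := p * ((2 + δ) * m) with hg
  have hg0 : 0 < g := by positivity
  set c₁ : ℝ := 1 + 2 * m / g + 2 * k / g with hc₁
  have hc₁0 : 0 < c₁ := by positivity
  set C₁ : ℝ := m * c₁ * Real.exp (m * c₁) with hC₁
  set C₂ : ℝ := (1 + (k + 1) / ((1 + δ) * m)) ^ m with hC₂
  have hC₁0 : 0 ≤ C₁ := by positivity
  have hC₂0 : 0 ≤ C₂ := by positivity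
  refine ⟨C₁ + C₂, by positivity, fun j Z S L hZ hL0 hLk => ?_⟩
  set J : ℝ := (j : ℝ) + 1 with hJ
  have hJ1 : 1 ≤ J := by rw [hJ]; linarith [(Nat.cast_nonneg j : (0 : ℝ) ≤ j)]
  have hJ0 : 0 < J := by linarith
  have htyp : typical δ p m j = g * J := by
    unfold typical
    rw [hg, hJ]
    ring
  have hZ0 : 0 < Z := lt_of_lt_of_le (by positivity) hZ
  have hi0 : ∀ i : Fin m, 0 < Z + (i : ℕ) := fun i => by positivity
  have hcard : (Finset.univ : Finset (Fin m)).card ≤ m := by simp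
  constructor
  · intro hgood
    rw [htyp] at hgood ⊢
    set T := g * J with hT
    have hT0 : 0 < T := by positivity
    have hpow1 := rpow_neg_le_one hJ1 hh0.le
    have hpow0 : 0 < J ^ (-h) := by positivity
    have hZ2 : T / 2 ≤ Z := by
      have h1 := (abs_le.1 hgood).1
      have h2 : T * J ^ (-h) ≤ T := mul_le_of_le_one_right (by positivity) hpow1
      linarith
    have hinv := inv_le_rpow_neg hJ1 hh1
    have hfac : ∀ i : Fin m, (if i ∈ S then 1 / (Z + (i : ℕ)) else 1 + L i / (Z + (i : ℕ))) =
        (if i ∈ S then T / (Z + (i : ℕ)) else 1 + L i / (Z + (i : ℕ))) *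
          (if i ∈ S then 1 / T else 1) := by
      intro i
      split_ifs
      · have := hi0 i
        field_simp
      · rw [mul_one]
    have hprod : (∏ i : Fin m, if i ∈ S then 1 / (Z + (i : ℕ)) else 1 + L i / (Z + (i : ℕ))) =
        (∏ i : Fin m, if i ∈ S then T / (Z + (i : ℕ)) else 1 + L i / (Z + (i : ℕ))) *
          (1 / T) ^ S.card := by
      rw [Finset.prod_congr rfl fun i _ => hfac i, Finset.prod_mul_distrib]
      congr 1
      rw [Finset.prod_ite_mem, Finset.univ_inter, Finset.prod_const]
    have hnear : ∀ i ∈ (Finset.univ : Finset (Fin m)),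
        |(if i ∈ S then T / (Z + (i : ℕ)) else 1 + L i / (Z + (i : ℕ))) - 1| ≤ c₁ * J ^ (-h) := by
      intro i _
      have h9 : T / 2 ≤ Z + (i : ℕ) := by
        have : (0 : ℝ) ≤ (i : ℕ) := Nat.cast_nonneg _
        linarith
      split_ifs
      · have h7 : T / (Z + (i : ℕ)) - 1 = (T - Z - (i : ℕ)) / (Z + (i : ℕ)) := by
          have := hi0 i
          field_simp
          ring
        rw [h7, abs_div, abs_of_pos (hi0 i)]
        have h8 : |T - Z - (i : ℕ)| ≤ T * J ^ (-h) / 2 + m := by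
          refine (abs_sub _ _).trans (add_le_add ?_ ?_)
          · rwa [abs_sub_comm]
          · rw [abs_of_nonneg (Nat.cast_nonneg _)]
            exact_mod_cast i.2.le
        calc |T - Z - (i : ℕ)| / (Z + (i : ℕ)) ≤ (T * J ^ (-h) / 2 + m) / (T / 2) := by gcongr
          _ = J ^ (-h) + 2 * m / g * (1 / J) := by
              rw [hT]
              field_simp
          _ ≤ J ^ (-h) + 2 * m / g * J ^ (-h) := by gcongr
          _ ≤ c₁ * J ^ (-h) := by
              have : 0 ≤ 2 * k / g * J ^ (-h) := by positivity
              rw [hc₁]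
              linarith
      · rw [add_sub_cancel_left, abs_of_nonneg (div_nonneg (hL0 i) (hi0 i).le)]
        calc L i / (Z + (i : ℕ)) ≤ k / (T / 2) := by
              gcongr
              exact hLk i
          _ = 2 * k / g * (1 / J) := by
              rw [hT]
              field_simp
          _ ≤ 2 * k / g * J ^ (-h) := by gcongr
          _ ≤ c₁ * J ^ (-h) := by
              have : 0 ≤ 2 * m / g * J ^ (-h) := by positivity
              rw [hc₁]
              linarith
    have h4 := abs_prod_sub_one_le Finset.univ (V := c₁) m hcard hnear (by positivity)
      (mul_le_of_le_one_right hc₁0.le hpow1)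
    rw [hprod]
    have h5 : ∀ P : ℝ, P * (1 / T) ^ S.card - (1 / T) ^ S.card = (P - 1) * (1 / T) ^ S.card :=
      fun P => by ring
    rw [h5, abs_mul, abs_of_pos (by positivity : 0 < (1 / T) ^ S.card)]
    refine mul_le_mul_of_nonneg_right (h4.trans ?_) (by positivity)
    have h6 : 0 ≤ C₂ * J ^ (-h) := by positivity
    have h7 : m * (c₁ * J ^ (-h)) * Real.exp (m * c₁) = C₁ * J ^ (-h) := by rw [hC₁]; ring
    rw [h7]
    linarith
  · rw [Finset.abs_prod]
    have : ∏ i : Fin m, |if i ∈ S then 1 / (Z + (i : ℕ)) else 1 + L i / (Z + (i : ℕ))| ≤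
        ∏ _i : Fin m, (1 + ((k : ℝ) + 1) / ((1 + δ) * m)) := by
      refine Finset.prod_le_prod (fun _ _ => abs_nonneg _) fun i _ => ?_
      have h3 : (1 + δ) * m ≤ Z + (i : ℕ) := by
        have : (0 : ℝ) ≤ (i : ℕ) := Nat.cast_nonneg _
        linarith
      split_ifs
      · rw [abs_of_pos (one_div_pos.2 (hi0 i))]
        calc 1 / (Z + (i : ℕ)) ≤ ((k : ℝ) + 1) / ((1 + δ) * m) := by
              gcongr
              have : (0 : ℝ) ≤ k := Nat.cast_nonneg _
              linarith
          _ ≤ _ := by linarith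
      · rw [abs_of_nonneg (by have := div_nonneg (hL0 i) (hi0 i).le; linarith)]
        have : L i / (Z + (i : ℕ)) ≤ ((k : ℝ) + 1) / ((1 + δ) * m) := by
          gcongr
          have := hLk i
          linarith
        linarith
    refine this.trans ?_
    rw [Finset.prod_const, Finset.card_univ, Fintype.card_fin]
    linarith

end Estimates

/-! ### The potential of the prescribed edges -/

section Prescribed

variable {d n m k : ℕ} {δ r : ℝ}

/-- The number of prescribed edges into `c` which are sent out by vertices of index at least `j`. -/
def remaining (a b : Fin k → Fin n) (j : ℕ) (c : Fin n) : ℕ :=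
  (Finset.univ.filter fun q => j ≤ (b q : ℕ) ∧ a q = c).card

/-- The prescription for the edges of the vertex `v`: the end point of its edge `i`, if that edge is
one of the prescribed ones. The prescribed edge is unique if the pairs `(b q, t q)` are distinct. -/
def spec (a b : Fin k → Fin n) (t : Fin k → Fin m) (v : Fin n) (i : Fin m) : Option (Fin n) :=
  open Classical in if h : ∃ q, b q = v ∧ t q = i then some (a h.choose) else none

/-- The indicator that the prescribed edges of the vertices of index less than `j` are present,
times a rising factorial for the prescribed edges which are still to come. The weights which the
prescribed edges add to their targets are accounted for by the rising factorials. -/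
def potential (δ : ℝ) (a b : Fin k → Fin n) (t : Fin k → Fin m) (j : ℕ) (e : Edges n m) : ℝ :=
  (if ∀ q, (b q : ℕ) < j → e (b q) (t q) = a q then 1 else 0) *
    ∏ c, rise (weight δ j e c) (remaining a b j c)

/-- The factor by which the step of `v` changes the potential on average, given the position
of `v`. -/
def potentialFactor (δ r : ℝ) (a b : Fin k → Fin n) (t : Fin k → Fin m) (v : Fin n)
    (x : Fin n → Sphere d) (e : Edges n m) : ℝ :=
  ∏ i, urnFactor (near r x v) (capWeight δ r x e v) (spec a b t v) (remaining a b (v + 1)) i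

variable {a b : Fin k → Fin n} {t : Fin k → Fin m}

lemma spec_eq_some (hinj : Function.Injective fun q => (b q, t q)) {v : Fin n} {i : Fin m}
    {c : Fin n} : spec a b t v i = some c ↔ ∃ q, b q = v ∧ t q = i ∧ a q = c := by
  unfold spec
  constructor
  · intro h
    split_ifs at h with h1
    exact ⟨h1.choose, h1.choose_spec.1, h1.choose_spec.2, Option.some_injective _ h⟩
  · rintro ⟨q, hq, hi, hc⟩
    have h1 : ∃ q, b q = v ∧ t q = i := ⟨q, hq, hi⟩
    rw [dif_pos h1]
    have h2 : h1.choose = q := hinj (by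
      simp only [Prod.mk.injEq]
      exact ⟨h1.choose_spec.1.trans hq.symm, h1.choose_spec.2.trans hi.symm⟩)
    rw [h2, hc]

lemma spec_eq_none (v : Fin n) (i : Fin m) (h : ∀ q, b q ≠ v) : spec a b t v i = none := by
  unfold spec
  rw [dif_neg]
  rintro ⟨q, hq, -⟩
  exact h q hq

lemma card_spec (hinj : Function.Injective fun q => (b q, t q)) (v : Fin n) (c : Fin n) :
    (Finset.univ.filter fun i => spec a b t v i = some c).card =
      (Finset.univ.filter fun q => b q = v ∧ a q = c).card := by
  have h : (Finset.univ.filter fun i => spec a b t v i = some c) =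
      (Finset.univ.filter fun q => b q = v ∧ a q = c).image t := by
    ext i
    simp only [Finset.mem_filter, Finset.mem_univ, true_and, Finset.mem_image, spec_eq_some hinj]
    constructor
    · rintro ⟨q, h1, h2, h3⟩
      exact ⟨q, ⟨h1, h3⟩, h2⟩
    · rintro ⟨q, ⟨h1, h3⟩, h2⟩
      exact ⟨q, h1, h2, h3⟩
  rw [h, Finset.card_image_of_injOn]
  intro q hq q' hq' hqq
  simp only [Finset.coe_filter, Finset.mem_univ, true_and, Set.mem_ofPred_eq] at hq hq'
  exact hinj (by simp only [Prod.mk.injEq]; exact ⟨hq.1.trans hq'.1.symm, hqq⟩)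

/-- The prescribed slots of `v` correspond to the prescribed edges sent out by `v`. -/
lemma card_isSome_spec (hinj : Function.Injective fun q => (b q, t q)) (v : Fin n) :
    (Finset.univ.filter fun i => (spec a b t v i).isSome).card =
      (Finset.univ.filter fun q => b q = v).card := by
  have h : (Finset.univ.filter fun i => (spec a b t v i).isSome) =
      (Finset.univ.filter fun q => b q = v).image t := by
    ext i
    simp only [Finset.mem_filter, Finset.mem_univ, true_and, Finset.mem_image,
      Option.isSome_iff_exists, spec_eq_some hinj]
    constructor
    · rintro ⟨c, q, h1, h2, h3⟩
      exact ⟨q, h1, h2⟩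
    · rintro ⟨q, h1, h2⟩
      exact ⟨a q, q, h1, h2, rfl⟩
  rw [h, Finset.card_image_of_injOn]
  intro q hq q' hq' hqq
  simp only [Finset.coe_filter, Finset.mem_univ, true_and, Set.mem_ofPred_eq] at hq hq'
  exact hinj (by simp only [Prod.mk.injEq]; exact ⟨hq.trans hq'.symm, hqq⟩)

lemma remaining_eq_add (v c : Fin n) :
    remaining a b v c =
      remaining a b (v + 1) c + (Finset.univ.filter fun q => b q = v ∧ a q = c).card := by
  unfold remaining
  rw [← Finset.card_union_of_disjoint]
  · congr 1
    ext q
    simp only [Finset.mem_filter, Finset.mem_univ, true_and, Finset.mem_union, Fin.ext_iff]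
    omega
  · rw [Finset.disjoint_left]
    intro q
    simp only [Finset.mem_filter, Finset.mem_univ, true_and, Fin.ext_iff]
    omega

lemma sum_remaining_le (j : ℕ) (B : Finset (Fin n)) : ∑ c ∈ B, remaining a b j c ≤ k := by
  have h : ∑ c ∈ B, remaining a b j c =
      (Finset.univ.filter fun q => j ≤ (b q : ℕ) ∧ a q ∈ B).card := by
    rw [Finset.card_eq_sum_card_fiberwise (f := a) (t := B)]
    · refine Finset.sum_congr rfl fun c hc => ?_
      unfold remaining
      congr 1
      ext q
      simp only [Finset.mem_filter, Finset.mem_univ, true_and]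
      constructor
      · rintro ⟨h1, rfl⟩
        exact ⟨⟨h1, hc⟩, rfl⟩
      · rintro ⟨⟨h1, -⟩, h2⟩
        exact ⟨h1, h2⟩
    · intro q hq
      simp only [Finset.coe_filter, Finset.mem_univ, true_and, Set.mem_ofPred_eq] at hq
      exact hq.2
  rw [h]
  exact (Finset.card_le_univ _).trans (by simp)

lemma potential_nonneg (hδ : 0 < δ) (j : ℕ) (e : Edges n m) : 0 ≤ potential δ a b t j e := by
  unfold potential
  refine mul_nonneg (by split_ifs <;> norm_num) (Finset.prod_nonneg fun c _ => ?_)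
  exact Finset.prod_nonneg fun q _ => by have := weight_nonneg hδ j e c; positivity

/-- A crude deterministic bound, for use on improbable events. -/
lemma potential_le (hδ : 0 < δ) {j : ℕ} (hj : j ≤ n) (e : Edges n m) :
    potential δ a b t j e ≤ (((2 + δ) * m + k + 1) * ((j : ℝ) + 1)) ^ k := by
  set Q : ℝ := ((2 + δ) * m + k + 1) * ((j : ℝ) + 1) with hQ
  have hQ1 : 1 ≤ Q := by
    have h1 : (1 : ℝ) ≤ (2 + δ) * m + k + 1 := by
      have : 0 ≤ (2 + δ) * m + k := by positivity
      linarith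
    have h2 : (1 : ℝ) ≤ (j : ℝ) + 1 := by simp
    nlinarith
  have hrise : ∀ c, rise (weight δ j e c) (remaining a b j c) ≤ Q ^ remaining a b j c := by
    intro c
    unfold rise
    have h1 : ∀ q ∈ Finset.range (remaining a b j c), weight δ j e c + q ≤ Q := by
      intro q hq
      have h2 : remaining a b j c ≤ k := by
        simpa using sum_remaining_le (a := a) (b := b) j {c}
      have h3 : (q : ℝ) ≤ k := by exact_mod_cast (Finset.mem_range.1 hq).le.trans h2
      have h4 : (indegree j e c : ℝ) ≤ m * j := by exact_mod_cast indegree_le j hj e c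
      have h5 : (0 : ℝ) ≤ j := Nat.cast_nonneg j
      have h6 : (0 : ℝ) ≤ m := Nat.cast_nonneg m
      have h7 : (0 : ℝ) ≤ k := Nat.cast_nonneg k
      unfold weight
      rw [hQ]
      nlinarith [mul_nonneg h6 h5, mul_nonneg h7 h5, mul_nonneg hδ.le (mul_nonneg h6 h5)]
    refine (Finset.prod_le_prod (fun q _ => ?_) h1).trans (by simp)
    have := weight_nonneg hδ j e c
    positivity
  unfold potential
  have h0 : ∀ c ∈ Finset.univ, 0 ≤ rise (weight δ j e c) (remaining a b j c) := fun c _ =>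
    Finset.prod_nonneg fun q _ => by have := weight_nonneg hδ j e c; positivity
  calc (if ∀ q, (b q : ℕ) < j → e (b q) (t q) = a q then (1 : ℝ) else 0) *
      ∏ c, rise (weight δ j e c) (remaining a b j c)
      ≤ 1 * ∏ c, rise (weight δ j e c) (remaining a b j c) :=
        mul_le_mul_of_nonneg_right (by split_ifs <;> norm_num) (Finset.prod_nonneg h0)
    _ ≤ 1 * ∏ c, Q ^ remaining a b j c := by
        gcongr 1 * ?_
        exact Finset.prod_le_prod h0 fun c _ => hrise c
    _ = Q ^ ∑ c, remaining a b j c := by rw [one_mul, Finset.prod_pow_eq_pow_sum]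
    _ ≤ Q ^ k := pow_le_pow_right₀ hQ1 (sum_remaining_le j _)

lemma nice_potential (hδ : 0 < δ) {j : ℕ} (hj : j ≤ n) :
    Nice fun (_ : Fin n → Sphere d) e => potential δ a b t j e where
  meas _ := measurable_const
  bdd := ⟨(((2 + δ) * m + k + 1) * ((j : ℝ) + 1)) ^ k, fun x e => by
    rw [abs_of_nonneg (potential_nonneg hδ j e)]
    exact potential_le hδ hj e⟩

/-- Before the first target the potential is deterministic. -/
lemma potential_eq_of_le (hab : ∀ q, a q ≤ b q) {j : ℕ} (hj : ∀ q, j ≤ (a q : ℕ)) {e : Edges n m}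
    (he : Valid e) :
    potential δ a b t j e =
      ∏ c, rise ((1 + δ) * m) (Finset.univ.filter fun q => a q = c).card := by
  have hjb : ∀ q, j ≤ (b q : ℕ) := fun q => (hj q).trans (hab q)
  unfold potential
  rw [if_pos fun q hq => absurd (hjb q) (by omega), one_mul]
  refine Finset.prod_congr rfl fun c _ => ?_
  have h1 : remaining a b j c = (Finset.univ.filter fun q => a q = c).card := by
    unfold remaining
    congr 1
    ext q
    simp [hjb q]
  rw [h1]
  rcases le_or_gt j (c : ℕ) with hc | hc
  · rw [weight_eq he hc]
  · rw [Finset.card_eq_zero.2, rise_zero, rise_zero]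
    rw [Finset.filter_eq_empty_iff]
    rintro q - rfl
    exact absurd (hj q) (by omega)

lemma potential_last (e : Edges n m) :
    potential δ a b t n e = if ∀ q, e (b q) (t q) = a q then 1 else 0 := by
  unfold potential
  have h1 : ∀ c, remaining a b n c = 0 := by
    intro c
    unfold remaining
    rw [Finset.card_eq_zero, Finset.filter_eq_empty_iff]
    rintro q - ⟨h, -⟩
    exact absurd (b q).2 (by omega)
  simp [h1]

/-- A step multiplies the potential by an explicit factor on average. This is the reason for the
choice of the potential. -/
lemma stepExpect_potential {μ : Fin n → Measure (Sphere d)} (hδ : 0 < δ) (hr : 0 ≤ r) (hm : 1 ≤ m)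
    (hinj : Function.Injective fun q => (b q, t q)) (v : Fin n) (x : Fin n → Sphere d)
    (e : Edges n m) :
    stepExpect δ r μ v (fun _ e => potential δ a b t (v + 1) e) x e =
      potential δ a b t v e *
        ∫ y, potentialFactor δ r a b t v (Function.update x v y) e ∂μ v := by
  unfold stepExpect
  rw [← integral_const_mul]
  refine integral_congr_ae (Filter.Eventually.of_forall fun y => ?_)
  dsimp only
  set x' := Function.update x v y
  have h1 : ∀ f : Fin m → Fin n, potential δ a b t (v + 1) (Function.update e v f) =
      (if ∀ q, (b q : ℕ) < v → e (b q) (t q) = a q then 1 else 0) *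
        ((if ∀ i c, spec a b t v i = some c → f i = c then 1 else 0) *
          ∏ c, rise (weight δ (v + 1) (Function.update e v f) c) (remaining a b (v + 1) c)) := by
    intro f
    unfold potential
    rw [← mul_assoc]
    congr 1
    rw [ite_zero_mul_ite_zero, mul_one]
    refine if_congr ?_ rfl rfl
    constructor
    · intro h
      refine ⟨fun q hq => ?_, fun i c hc => ?_⟩
      · have h2 := h q (by omega)
        rwa [Function.update_of_ne (by rintro rfl; omega)] at h2
      · obtain ⟨q, rfl, rfl, rfl⟩ := (spec_eq_some hinj).1 hc
        simpa using h q (by omega)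
    · rintro ⟨h1, h2⟩ q hq
      rcases eq_or_ne (b q) v with hv | hv
      · rw [hv, Function.update_self]
        exact h2 _ _ ((spec_eq_some hinj).2 ⟨q, hv, rfl, rfl⟩)
      · rw [Function.update_of_ne hv]
        exact h1 q (by have : (b q : ℕ) ≠ v := fun h => hv (Fin.ext h)
                       omega)
  have h2 := sum_stepProb_mul hδ hr hm x' e v (spec a b t v) (remaining a b (v + 1))
  calc ∑ f, stepProb δ r x' e v f * potential δ a b t (v + 1) (Function.update e v f)
      = (if ∀ q, (b q : ℕ) < v → e (b q) (t q) = a q then 1 else 0) *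
        ∑ f, stepProb δ r x' e v f * ((if ∀ i c, spec a b t v i = some c → f i = c then 1 else 0) *
          ∏ c, rise (weight δ (v + 1) (Function.update e v f) c) (remaining a b (v + 1) c)) := by
        rw [Finset.mul_sum]
        refine Finset.sum_congr rfl fun f _ => ?_
        rw [h1]
        ring
    _ = (if ∀ q, (b q : ℕ) < v → e (b q) (t q) = a q then 1 else 0) *
        ((∏ c, rise (weight δ v e c) (remaining a b (v + 1) c +
          (Finset.univ.filter fun s => spec a b t v s = some c).card)) *
          potentialFactor δ r a b t v x' e) := by
        unfold potentialFactor
        rw [← h2]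
    _ = _ := by
        rw [← mul_assoc]
        congr 2
        refine Finset.prod_congr rfl fun c _ => ?_
        rw [card_spec hinj, ← remaining_eq_add]

end Prescribed

/-! ### The average change of the potential -/

section StepEstimate

variable {d n m k : ℕ} {δ r p : ℝ} {a b : Fin k → Fin n} {t : Fin k → Fin m}

/-- The number of prescribed edges from a vertex of index at least `j` to one of index less
than `j`. -/
def openCount (a b : Fin k → Fin n) (j : ℕ) : ℕ :=
  (Finset.univ.filter fun q => (a q : ℕ) < j ∧ j ≤ (b q : ℕ)).card

/-- The number of prescribed edges sent out by the vertex of index `j`. -/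
def sourceCount (b : Fin k → Fin n) (j : ℕ) : ℕ := (Finset.univ.filter fun q => (b q : ℕ) = j).card

/-- The main term of the factor by which the step of the vertex of index `j` changes the
potential. For `j = 0` the ratio has the junk value zero, but then `openCount` vanishes. -/
def stepFactor (δ p : ℝ) (m : ℕ) (a b : Fin k → Fin n) (j : ℕ) : ℝ :=
  ((((j : ℝ) + 1) / j) ^ (1 / (2 + δ))) ^ openCount a b j *
    (1 / typical δ p m j) ^ sourceCount b j

lemma openCount_le (j : ℕ) : openCount a b j ≤ k := (Finset.card_le_univ _).trans (by simp)

lemma sourceCount_le (j : ℕ) : sourceCount b j ≤ k := (Finset.card_le_univ _).trans (by simp)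

lemma one_le_or_openCount_eq_zero (j : ℕ) : 1 ≤ j ∨ openCount a b j = 0 := by
  rcases Nat.eq_zero_or_pos j with rfl | hj
  · right
    simp [openCount]
  · exact Or.inl hj

lemma one_le_ratio_pow (hδ : 0 < δ) (j : ℕ) :
    1 ≤ ((((j : ℝ) + 1) / j) ^ (1 / (2 + δ))) ^ openCount a b j := by
  rcases one_le_or_openCount_eq_zero (a := a) (b := b) j with hj | hj
  · have hj0 : (0 : ℝ) < j := by exact_mod_cast hj
    refine one_le_pow₀ (Real.one_le_rpow ?_ (by positivity))
    rw [le_div_iff₀ hj0]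
    linarith
  · simp [hj]

lemma capWeight_eq {e : Edges n m} (he : Valid e) (hr : 0 ≤ r) (v : Fin n)
    (x : Fin n → Sphere d) :
    capWeight δ r x e v = mass δ r v (x v) x e + (1 + δ) * m := by
  have := capWeight_update (δ := δ) he hr v (x v) x
  rwa [Function.update_eq_self] at this

/-- The prescribed edges which a vertex without prescribed edges of its own, at the position `y`,
could later receive together with the vertices around it. -/
lemma sum_near_remaining {v : Fin n} (hv : ∀ q, a q ≠ v) (x : Fin n → Sphere d)
    (y : Sphere d) :
    ∑ c ∈ near r (Function.update x v y) v, (remaining a b (v + 1) c : ℝ) =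
      ∑ c : Fin n, if dist y (x c) ≤ r then
        (if c < v then (remaining a b (v + 1) c : ℝ) else 0) else 0 := by
  unfold near
  rw [Finset.sum_filter]
  refine Finset.sum_congr rfl fun c _ => ?_
  rw [Function.update_self]
  rcases lt_trichotomy c v with hc | rfl | hc
  · rw [Function.update_of_ne hc.ne]
    simp [hc, hc.le]
  · have h0 : remaining a b (c + 1) c = 0 := by
      unfold remaining
      rw [Finset.card_eq_zero, Finset.filter_eq_empty_iff]
      rintro q - ⟨-, h⟩
      exact hv q h
    simp [h0]
  · simp [hc.not_ge, hc.not_gt]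

lemma sum_remaining_eq {v : Fin n} (hv : ∀ q, b q ≠ v) :
    ∑ c : Fin n, (if c < v then (remaining a b (v + 1) c : ℝ) else 0) = openCount a b v := by
  have h : openCount a b v = ∑ c ∈ Finset.univ.filter (· < v), remaining a b (v + 1) c := by
    unfold openCount
    rw [Finset.card_eq_sum_card_fiberwise (f := a) (t := Finset.univ.filter (· < v))]
    · refine Finset.sum_congr rfl fun c hc => ?_
      simp only [Finset.mem_filter, Finset.mem_univ, true_and] at hc
      unfold remaining
      congr 1
      ext q
      have h1 : (b q : ℕ) ≠ v := fun h => hv q (Fin.ext h)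
      simp only [Finset.mem_filter, Finset.mem_univ, true_and]
      constructor
      · rintro ⟨⟨h2, h3⟩, h4⟩
        exact ⟨by omega, h4⟩
      · rintro ⟨h2, rfl⟩
        exact ⟨⟨hc, by omega⟩, rfl⟩
    · intro q hq
      simp only [Finset.coe_filter, Finset.mem_univ, true_and, Set.mem_ofPred_eq] at hq ⊢
      exact hq.1
  rw [h, ← Finset.sum_filter]
  push_cast
  rfl

lemma potentialFactor_eq_of_free {v : Fin n} (hv : ∀ q, b q ≠ v) (x : Fin n → Sphere d)
    (e : Edges n m) :
    potentialFactor δ r a b t v x e = ∏ i : Fin m,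
      (1 + (∑ c ∈ near r x v, (remaining a b (v + 1) c : ℝ)) / (capWeight δ r x e v + (i : ℕ))) := by
  unfold potentialFactor urnFactor
  refine Finset.prod_congr rfl fun i _ => ?_
  rw [spec_eq_none v i hv]
  simp [spec_eq_none v _ hv]

/-- The average change of the potential in the step of a vertex which is not an end point of a
prescribed edge. -/
lemma exists_abs_integral_potentialFactor_sub_le (hδ : 0 < δ) (hm : 1 ≤ m) (hp : 0 < p) (k : ℕ) :
    ∃ C : ℝ, 0 ≤ C ∧ ∀ (d n : ℕ) (r : ℝ), CapArea d r p → 0 ≤ r → ∀ (a b : Fin k → Fin n)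
      (t : Fin k → Fin m) (v : Fin n), (∀ q, a q ≠ v) → (∀ q, b q ≠ v) →
      ∀ (x : Fin n → Sphere d) (e : Edges n m), Valid e →
      |∫ y, potentialFactor δ r a b t v (Function.update x v y) e ∂area d -
        stepFactor δ p m a b v| ≤
      C * ((v : ℝ) + 1) ^ (-1 - errExp δ) + C * ∫ y, badInd δ r p v y x e ∂area d := by
  obtain ⟨C₁, hC₁, hfac⟩ := exists_abs_prod_factor_sub_le (p := p) hδ hm hp k
  set C₂ : ℝ := (2 * k) ^ 2 * Real.exp (2 * k) + 2 * k with hC₂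
  have hC₂0 : 0 ≤ C₂ := by positivity
  refine ⟨C₁ + C₂, by positivity, fun d n r hcap hr a b t v hva hvb x e he => ?_⟩
  have := isProb_area d
  set J : ℝ := (v : ℝ) + 1 with hJ
  have hJ1 : 1 ≤ J := by simp [hJ]
  have hm0 : (0 : ℝ) < m := by exact_mod_cast hm
  set T := typical δ p m v with hT
  have hT0 : 0 < T := typical_pos hδ hm hp v
  set L : Sphere d → ℝ := fun y => ∑ c : Fin n, if dist y (x c) ≤ r then
        (if c < v then (remaining a b (v + 1) c : ℝ) else 0) else 0 with hL
  set Z : Sphere d → ℝ := fun y => mass δ r v y x e + (1 + δ) * m with hZ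
  have hfacEq : ∀ y, potentialFactor δ r a b t v (Function.update x v y) e =
      ∏ i : Fin m, (1 + L y / (Z y + (i : ℕ))) := by
    intro y
    rw [potentialFactor_eq_of_free hvb, sum_near_remaining hva, capWeight_update he hr]
  have hL0 : ∀ y, 0 ≤ L y := fun y => Finset.sum_nonneg fun c _ => by split_ifs <;> positivity
  have hLk : ∀ y, L y ≤ k := by
    intro y
    have h1 : L y ≤ ∑ c : Fin n, (remaining a b (v + 1) c : ℝ) :=
      Finset.sum_le_sum fun c _ => by split_ifs <;> simp
    refine h1.trans ?_
    exact_mod_cast sum_remaining_le (a := a) (b := b) (v + 1) Finset.univ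
  have hLm : Measurable L := Finset.measurable_sum _ fun c _ =>
    Measurable.ite (measurableSet_dist_le measurable_id measurable_const) measurable_const
      measurable_const
  have hZ0 : ∀ y, (1 + δ) * m ≤ Z y := fun y => by
    have := mass_nonneg (r := r) hδ v y x e
    simp only [hZ]
    linarith
  have hZm : Measurable Z := by
    have h1 := (measurable_mass (d := d) (n := n) (δ := δ) (r := r) v e).comp
      (f := fun y : Sphere d => (y, x)) (measurable_id.prodMk measurable_const)
    exact h1.add_const _
  have hFm : Measurable fun y => ∏ i : Fin m, (1 + L y / (Z y + (i : ℕ))) :=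
    Finset.measurable_prod _ fun i _ => (hLm.div (hZm.add_const _)).const_add _
  set M : Sphere d → ℝ := fun y => 1 + m * L y / T with hM
  have hMm : Measurable M := ((hLm.const_mul _).div_const _).const_add _
  have hMb : ∀ y, |M y| ≤ 1 + m * k / T := by
    intro y
    have h1 : 0 ≤ m * L y / T := div_nonneg (mul_nonneg hm0.le (hL0 y)) hT0.le
    rw [abs_of_nonneg (by simp only [hM]; linarith)]
    simp only [hM]
    have := hLk y
    gcongr
  have hMint : Integrable M (area d) := integrable_area hMm hMb
  have hbm : Measurable fun y => badInd δ r p v y x e :=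
    (measurable_badInd (d := d) (n := n) (δ := δ) (r := r) (p := p) v e).comp
      (f := fun y : Sphere d => (y, x)) (measurable_id.prodMk measurable_const)
  have hbint : Integrable (fun y => badInd δ r p v y x e) (area d) :=
    integrable_area hbm (C := 1) fun y => by
      obtain ⟨h0, h1⟩ := badInd_mem (δ := δ) (r := r) (p := p) v y x e
      rwa [abs_of_nonneg h0]
  have hpt : ∀ y, |∏ i : Fin m, (1 + L y / (Z y + (i : ℕ))) - M y| ≤
      C₁ * J ^ (-1 - errExp δ) + C₁ * badInd δ r p v y x e := by
    intro y
    obtain ⟨h1, h2⟩ := hfac v (Z y) (L y) (hZ0 y) (hL0 y) (hLk y)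
    have h3 : 0 ≤ C₁ * J ^ (-1 - errExp δ) := by positivity
    unfold badInd
    split_ifs with hbad
    · linarith
    · have := h1 (not_lt.1 hbad)
      linarith
  have hFint : Integrable (fun y => ∏ i : Fin m, (1 + L y / (Z y + (i : ℕ)))) (area d) := by
    refine integrable_area hFm (C := C₁ + (1 + m * k / T)) fun y => ?_
    have h1 := (hfac v (Z y) (L y) (hZ0 y) (hL0 y) (hLk y)).2
    have h2 := abs_le.1 h1
    have h3 := abs_le.1 (hMb y)
    simp only [hM] at h3
    exact abs_le.2 ⟨by linarith, by linarith⟩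
  have hint1 : |∫ y, ∏ i : Fin m, (1 + L y / (Z y + (i : ℕ))) ∂area d - ∫ y, M y ∂area d| ≤
      C₁ * J ^ (-1 - errExp δ) + C₁ * ∫ y, badInd δ r p v y x e ∂area d := by
    rw [← integral_sub hFint hMint]
    refine (abs_integral_le_integral_abs).trans ?_
    refine (integral_mono (hFint.sub hMint).abs
      ((integrable_const _).add (hbint.const_mul _)) hpt).trans (le_of_eq ?_)
    rw [integral_add' (integrable_const _) (hbint.const_mul _)]
    simp [integral_const_mul]
  have hintL : ∫ y, L y ∂area d = p * openCount a b v := by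
    simp only [hL]
    rw [integral_finsetSum]
    · simp only [hcap.integral']
      rw [← Finset.sum_mul, sum_remaining_eq hvb, mul_comm]
    · intro c _
      refine integrable_area (C := k) ?_ fun y => ?_
      · exact Measurable.ite (measurableSet_dist_le measurable_id measurable_const)
          measurable_const measurable_const
      · have h1 : (remaining a b (v + 1) c : ℝ) ≤ k := by
          exact_mod_cast by simpa using sum_remaining_le (a := a) (b := b) (v + 1) {c}
        split_ifs <;> simp [h1]
  have hLint : Integrable L (area d) := integrable_area hLm (C := k) fun y => by
    rw [abs_of_nonneg (hL0 y)]
    exact hLk y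
  have hintM : ∫ y, M y ∂area d = 1 + openCount a b v * (1 / (2 + δ) / J) := by
    simp only [hM]
    rw [integral_add (integrable_const _) ((hLint.const_mul _).div_const _), integral_div,
      integral_const_mul, hintL]
    simp only [integral_const, probReal_univ, smul_eq_mul, mul_one]
    rw [hT, typical, ← hJ]
    have h2 : 0 < 2 + δ := by linarith
    have h3 : 0 < J := by linarith
    field_simp
  have hrat := abs_ratio_pow_sub_le (s := 1 / (2 + δ)) (k := k) (N := openCount a b v) (j := v)
    (by positivity) (by rw [div_le_one (by linarith)]; linarith) (openCount_le _)
    (one_le_or_openCount_eq_zero _)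
  have hs : stepFactor δ p m a b v =
      ((((v : ℝ) + 1) / v) ^ (1 / (2 + δ))) ^ openCount a b v := by
    unfold stepFactor
    have h0 : sourceCount b v = 0 := by
      unfold sourceCount
      rw [Finset.card_eq_zero, Finset.filter_eq_empty_iff]
      exact fun q _ h => hvb q (Fin.ext h)
    rw [h0, pow_zero, mul_one]
  have hsq : C₂ / J ^ 2 ≤ C₂ * J ^ (-1 - errExp δ) := by
    rw [div_eq_mul_one_div]
    exact mul_le_mul_of_nonneg_left
      (inv_sq_le_rpow hJ1 ((errExp_le δ).trans (by norm_num))) hC₂0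
  have hb0 : 0 ≤ ∫ y, badInd δ r p v y x e ∂area d :=
    integral_nonneg fun y => (badInd_mem v y x e).1
  rw [hs]
  simp only [hfacEq]
  rw [hintM] at hint1
  rw [← hJ, ← hC₂] at hrat
  rw [abs_sub_comm] at hrat
  have htri := abs_sub_le (∫ y, ∏ i : Fin m, (1 + L y / (Z y + (i : ℕ))) ∂area d)
    (1 + openCount a b v * (1 / (2 + δ) / J))
    (((((v : ℝ) + 1) / v) ^ (1 / (2 + δ))) ^ openCount a b v)
  rw [← hJ] at htri ⊢
  have h5 := mul_nonneg hC₂0 hb0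
  rw [add_mul C₁ C₂, add_mul C₁ C₂]
  linarith

/-- The change of the potential in the step of a vertex, given its position, if the prescribed
targets are within reach. -/
lemma exists_abs_potentialFactor_sub_le (hδ : 0 < δ) (hm : 1 ≤ m) (hp : 0 < p) (k : ℕ) :
    ∃ C : ℝ, 0 ≤ C ∧ ∀ (d n : ℕ) (r : ℝ), 0 ≤ r → ∀ (a b : Fin k → Fin n)
      (t : Fin k → Fin m), (∀ q, a q ≤ b q) → (Function.Injective fun q => (b q, t q)) →
      ∀ (v : Fin n) (x : Fin n → Sphere d) (e : Edges n m), Valid e →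
      (∀ q, b q = v → dist (x v) (x (a q)) ≤ r) →
      |potentialFactor δ r a b t v x e - stepFactor δ p m a b v| ≤
      C * ((v : ℝ) + 1) ^ (-errExp δ) * stepFactor δ p m a b v +
        C * badInd δ r p v (x v) x e := by
  obtain ⟨C₁, hC₁, hfac⟩ := exists_abs_prod_factor_le (p := p) hδ hm hp k
  have hm0 : (0 : ℝ) < m := by exact_mod_cast hm
  set C₂ : ℝ := k + ((2 * k) ^ 2 * Real.exp (2 * k) + 2 * k) with hC₂
  have hC₂0 : 0 ≤ C₂ := by positivity
  set g : ℝ := p * ((2 + δ) * m) with hg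
  have hg0 : 0 < g := by positivity
  set C₃ : ℝ := (1 + C₂) * (1 + 1 / g) ^ k with hC₃
  have hC₃0 : 0 ≤ C₃ := by positivity
  refine ⟨C₁ + C₂ + C₃, by positivity, fun d n r hr a b t hab hinj v x e he hdist => ?_⟩
  set J : ℝ := (v : ℝ) + 1 with hJ
  have hJ1 : 1 ≤ J := by simp [hJ]
  have hh0 := errExp_pos hδ
  have hh1 : errExp δ ≤ 1 := (errExp_le δ).trans (by norm_num)
  set T := typical δ p m v with hT
  have hT0 : 0 < T := typical_pos hδ hm hp v
  have hgT : g ≤ T := by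
    rw [hT, typical, ← hJ, hg]
    have h1 : (2 + δ) * m ≤ (2 + δ) * m * J := le_mul_of_one_le_right (by positivity) hJ1
    exact mul_le_mul_of_nonneg_left h1 hp.le
  set S : Finset (Fin m) := Finset.univ.filter fun i => (spec a b t v i).isSome with hS
  have hScard : S.card = sourceCount b v := by
    rw [hS, card_isSome_spec hinj]
    unfold sourceCount
    simp only [Fin.ext_iff]
  set L : Fin m → ℝ := fun i => ∑ c ∈ near r x v, ((remaining a b (v + 1) c : ℝ) +
    (Finset.univ.filter fun s => i < s ∧ spec a b t v s = some c).card) with hL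
  have hL0 : ∀ i, 0 ≤ L i := fun i => Finset.sum_nonneg fun c _ => by positivity
  have hLk : ∀ i, L i ≤ k := by
    intro i
    have h1 : L i ≤ ∑ c ∈ near r x v, (remaining a b v c : ℝ) := by
      refine Finset.sum_le_sum fun c _ => ?_
      rw [remaining_eq_add, ← card_spec hinj]
      push_cast
      gcongr
      tauto
    refine h1.trans ?_
    exact_mod_cast sum_remaining_le (a := a) (b := b) v (near r x v)
  set Z := capWeight δ r x e v with hZ
  have hfacEq : potentialFactor δ r a b t v x e =
      ∏ i : Fin m, if i ∈ S then 1 / (Z + (i : ℕ)) else 1 + L i / (Z + (i : ℕ)) := by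
    unfold potentialFactor urnFactor
    refine Finset.prod_congr rfl fun i _ => ?_
    rcases hi : spec a b t v i with _ | c
    · simp [hS, hi, hL, hZ]
    · obtain ⟨q, h1, h2, h3⟩ := (spec_eq_some hinj).1 hi
      have h4 : c ∈ near r x v := mem_near.2 ⟨by rw [← h3, ← h1]; exact hab q, by
        rw [← h3]; exact hdist q h1⟩
      simp [hS, hi, h4, hZ]
  obtain ⟨hgood, hbd⟩ := hfac v Z S L (capWeight_ge hδ hr x e v) hL0 hLk
  rw [← hfacEq, hScard, ← hT, ← hJ] at hgood
  rw [← hfacEq] at hbd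
  have hrat := abs_ratio_pow_sub_le (s := 1 / (2 + δ)) (k := k) (N := openCount a b v) (j := v)
    (by positivity) (by rw [div_le_one (by linarith)]; linarith) (openCount_le _)
    (one_le_or_openCount_eq_zero _)
  have hρ1 := one_le_ratio_pow (a := a) (b := b) hδ v
  unfold stepFactor
  rw [← hJ] at hrat hρ1 ⊢
  rw [← hT]
  set ρ : ℝ := ((J / v) ^ (1 / (2 + δ))) ^ openCount a b v with hρ
  set P : ℝ := (1 / T) ^ sourceCount b v with hP
  have hP0 : 0 < P := by positivity
  have hρJ : ρ - 1 ≤ C₂ * J ^ (-errExp δ) := by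
    have h1 := (abs_le.1 hrat).2
    have h2 : (openCount a b v : ℝ) * (1 / (2 + δ) / J) ≤ k * (1 / J) := by
      have h3 : (openCount a b v : ℝ) ≤ k := by exact_mod_cast openCount_le (a := a) (b := b) v
      have h4 : 1 / (2 + δ) ≤ 1 := by rw [div_le_one (by linarith)]; linarith
      gcongr
    have h5 : ((2 * k) ^ 2 * Real.exp (2 * k) + 2 * k) / J ^ 2 ≤
        ((2 * (k : ℝ)) ^ 2 * Real.exp (2 * k) + 2 * k) * (1 / J) := by
      rw [div_eq_mul_one_div]
      gcongr
      nlinarith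
    have h6 : C₂ * (1 / J) ≤ C₂ * J ^ (-errExp δ) :=
      mul_le_mul_of_nonneg_left (inv_le_rpow_neg hJ1 hh1) hC₂0
    have h7 : C₂ * (1 / J) = k * (1 / J) +
        ((2 * (k : ℝ)) ^ 2 * Real.exp (2 * k) + 2 * k) * (1 / J) := by rw [hC₂]; ring
    linarith
  have hPρ : P ≤ ρ * P := le_mul_of_one_le_left hP0.le hρ1
  have hJh0 : 0 < J ^ (-errExp δ) := by positivity
  have hJh1 := rpow_neg_le_one hJ1 hh0.le
  unfold badInd
  rw [← capWeight_eq he hr, ← hZ, ← hT, ← hJ]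
  split_ifs with hbad
  · have h1 : ρ * P ≤ C₃ := by
      have h2 : ρ ≤ 1 + C₂ := by nlinarith
      have h3 : P ≤ (1 + 1 / g) ^ k := by
        calc P ≤ (1 + 1 / g) ^ sourceCount b v := by
              refine pow_le_pow_left₀ (by positivity) ?_ _
              have := one_div_le_one_div_of_le hg0 hgT
              linarith
          _ ≤ (1 + 1 / g) ^ k := by
              refine pow_le_pow_right₀ ?_ (sourceCount_le _)
              have : 0 < 1 / g := by positivity
              linarith
      rw [hC₃]
      gcongr
    have h4 : 0 ≤ (C₁ + C₂ + C₃) * J ^ (-errExp δ) * (ρ * P) := by positivity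
    have h5 := abs_sub (potentialFactor δ r a b t v x e) (ρ * P)
    rw [abs_of_nonneg (show 0 ≤ ρ * P by positivity)] at h5
    linarith
  · have h1 := hgood (not_lt.1 hbad)
    have h2 : |P - ρ * P| ≤ C₂ * J ^ (-errExp δ) * P := by
      rw [abs_sub_comm, abs_of_nonneg (by linarith)]
      have := mul_le_mul_of_nonneg_right hρJ hP0.le
      linarith
    have h3 := abs_sub_le (potentialFactor δ r a b t v x e) P (ρ * P)
    have h4 : (C₁ + C₂) * J ^ (-errExp δ) * P ≤ (C₁ + C₂ + C₃) * J ^ (-errExp δ) * (ρ * P) :=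
      mul_le_mul (mul_le_mul_of_nonneg_right (by linarith) hJh0.le) hPρ hP0.le (by positivity)
    have h5 : (C₁ + C₂) * J ^ (-errExp δ) * P =
      C₁ * J ^ (-errExp δ) * P + C₂ * J ^ (-errExp δ) * P := by ring
    linarith

end StepEstimate

/-! ### Solution of the recursion, and the main term -/

section Recursion

/-- A nonnegative sequence `u`, whose steps are multiplications by `f j` up to errors, is close to
the product of the factors. The relative errors are summable, apart from at most `N` exceptional
indices, and the additive errors are smaller than the possible decay of the product, which is at
most polynomial of degree `k`. -/
lemma abs_sub_le_of_recursion {h C₁ C₂ Q R : ℝ} (h0 : 0 < h) (h1 : h ≤ 1) (hC₁ : 0 ≤ C₁)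
    (hC₂ : 0 ≤ C₂) (hQ : 0 ≤ Q) (hR : 1 ≤ R) {k N α n : ℕ} (hαn : α ≤ n) {s : Finset ℕ}
    (hs : s.card ≤ N) {u f : ℕ → ℝ} (hf : ∀ j, 0 < f j) (hu : ∀ j, 0 ≤ u j) (huα : u α = R)
    (hlow : ∀ j : ℕ, 1 ≤ Q * ((j : ℝ) + 1) ^ k * ∏ i ∈ Finset.Ico α (j + 1), f i)
    (hstep : ∀ j, α ≤ j → j < n → |u (j + 1) - f j * u j| ≤
      C₁ * (((j : ℝ) + 1) ^ (-1 - h) + if j ∈ s then ((j : ℝ) + 1) ^ (-h) else 0) * (f j * u j) +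
        C₂ / ((j : ℝ) + 1) ^ (k + 2)) :
    |u n - (∏ i ∈ Finset.Ico α n, f i) * R| ≤
      2 * ((C₁ + Q * C₂) * (4 / h) + C₁ * N) * Real.exp ((C₁ + Q * C₂) * (4 / h) + C₁ * N) *
        ((α : ℝ) + 1) ^ (-h) * ((∏ i ∈ Finset.Ico α n, f i) * R) := by
  set F : ℕ → ℝ := fun j => ∏ i ∈ Finset.Ico α j, f i with hF
  have hF0 : ∀ j, 0 < F j := fun j => Finset.prod_pos fun i _ => hf i
  set η : ℕ → ℝ := fun j => (C₁ + Q * C₂) * ((j : ℝ) + 1) ^ (-1 - h) +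
    C₁ * (if j ∈ s then ((j : ℝ) + 1) ^ (-h) else 0) with hη
  set A : ℝ := (C₁ + Q * C₂) * (4 / h) + C₁ * N with hA
  have hA0 : 0 ≤ A := by positivity
  have hη0 : ∀ j, 0 ≤ η j := by
    intro j
    simp only [hη]
    have : 0 ≤ if j ∈ s then ((j : ℝ) + 1) ^ (-h) else 0 := by split_ifs <;> positivity
    positivity
  -- Adding one to the normalized sequence turns the additive error into a multiplicative one.
  set w : ℕ → ℝ := fun j => u j / F j + 1 with hw
  have hwα : w α = R + 1 := by simp [hw, hF, huα]
  have hinc : ∀ j, α ≤ j → j < n → |w (j + 1) - w j| ≤ η j * w j := by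
    intro j hj hjn
    set J : ℝ := (j : ℝ) + 1 with hJ
    have hJ1 : 1 ≤ J := by simp [hJ]
    have hJ0 : 0 < J := by linarith
    have hFs : F (j + 1) = F j * f j := Finset.prod_Ico_succ_top hj f
    have h2 := hstep j hj hjn
    have h3 : w (j + 1) - w j = (u (j + 1) - f j * u j) / F (j + 1) := by
      have := (hF0 j).ne'
      have := (hf j).ne'
      simp only [hw, hFs]
      field_simp
      ring
    rw [h3, abs_div, abs_of_pos (hF0 (j + 1)), div_le_iff₀ (hF0 _)]
    have h4 : C₂ / J ^ (k + 2) ≤ Q * C₂ * J ^ (-1 - h) * F (j + 1) := by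
      have h5 : 1 / J ^ k ≤ Q * F (j + 1) := by
        rw [div_le_iff₀ (by positivity)]
        have := hlow j
        calc 1 ≤ _ := this
          _ = _ := by simp only [hF, ← hJ]; ring
      calc C₂ / J ^ (k + 2) = C₂ * (1 / J ^ 2) * (1 / J ^ k) := by
            rw [pow_add]
            field_simp
        _ ≤ C₂ * J ^ (-1 - h) * (Q * F (j + 1)) := by
            have := inv_sq_le_rpow hJ1 h1
            gcongr
        _ = _ := by ring
    have h6 : f j * u j = u j / F j * F (j + 1) := by
      have := (hF0 j).ne'
      rw [hFs]
      field_simp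
    have h2' : |u (j + 1) - f j * u j| ≤
        C₁ * (J ^ (-1 - h) + if j ∈ s then J ^ (-h) else 0) * (u j / F j * F (j + 1)) +
          C₂ / J ^ (k + 2) := by
      rw [← h6]
      exact h2
    have h7 : 0 ≤ u j / F j := div_nonneg (hu j) (hF0 j).le
    have h8 : 0 ≤ Q * C₂ * J ^ (-1 - h) := by positivity
    have h9 : 0 ≤ C₁ * (J ^ (-1 - h) + if j ∈ s then J ^ (-h) else 0) := by
      have : 0 ≤ if j ∈ s then J ^ (-h) else 0 := by split_ifs <;> positivity
      positivity
    have h10 : η j * w j = C₁ * (J ^ (-1 - h) + if j ∈ s then J ^ (-h) else 0) * (u j / F j) +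
        Q * C₂ * J ^ (-1 - h) + (C₁ * (J ^ (-1 - h) + if j ∈ s then J ^ (-h) else 0) +
        Q * C₂ * J ^ (-1 - h) * (u j / F j)) := by
      simp only [hη, hw, ← hJ]
      ring
    rw [h10]
    have h11 : 0 ≤ (C₁ * (J ^ (-1 - h) + if j ∈ s then J ^ (-h) else 0) +
        Q * C₂ * J ^ (-1 - h) * (u j / F j)) * F (j + 1) :=
      mul_nonneg (add_nonneg h9 (mul_nonneg h8 h7)) (hF0 _).le
    linarith
  have hmain := abs_sub_le_of_increments hαn hη0 (by rw [hwα]; linarith) hinc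
  have hsumη : ∑ j ∈ Finset.Ico α n, η j ≤ A * ((α : ℝ) + 1) ^ (-h) := by
    simp only [hη]
    rw [Finset.sum_add_distrib, ← Finset.mul_sum, ← Finset.mul_sum]
    have h2 := sum_rpow_tail_le h0 h1 α n
    have h3 : ∑ j ∈ Finset.Ico α n, (if j ∈ s then ((j : ℝ) + 1) ^ (-h) else 0) ≤
        N * ((α : ℝ) + 1) ^ (-h) := by
      rw [← Finset.sum_filter]
      refine (Finset.sum_le_card_nsmul _ _ (((α : ℝ) + 1) ^ (-h)) fun j hj => ?_).trans ?_
      · have h4 : α ≤ j := (Finset.mem_Ico.1 (Finset.mem_filter.1 hj).1).1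
        exact Real.rpow_le_rpow_of_nonpos (by positivity) (by gcongr) (by linarith)
      · rw [nsmul_eq_mul]
        have h5 : ((Finset.Ico α n).filter (· ∈ s)).card ≤ s.card :=
          Finset.card_le_card fun j hj => (Finset.mem_filter.1 hj).2
        have h6 : (((Finset.Ico α n).filter (· ∈ s)).card : ℝ) ≤ N := by
          exact_mod_cast h5.trans hs
        gcongr
    calc _ ≤ (C₁ + Q * C₂) * (4 / h * ((α : ℝ) + 1) ^ (-h)) +
          C₁ * (N * ((α : ℝ) + 1) ^ (-h)) := by gcongr
      _ = _ := by rw [hA]; ring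
  set a₀ : ℝ := ((α : ℝ) + 1) ^ (-h) with ha₀
  have ha0 : 0 < a₀ := by positivity
  have ha1 : a₀ ≤ 1 := rpow_neg_le_one (by simp) h0.le
  have hexp : Real.exp (∑ j ∈ Finset.Ico α n, η j) - 1 ≤ A * Real.exp A * a₀ := by
    have h2 : Real.exp (∑ j ∈ Finset.Ico α n, η j) ≤ Real.exp (A * a₀) := Real.exp_le_exp.2 hsumη
    have h3 := exp_sub_one_le (s := A * a₀)
    have h4 : Real.exp (A * a₀) ≤ Real.exp A :=
      Real.exp_le_exp.2 (mul_le_of_le_one_right hA0 ha1)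
    have h5 : A * a₀ * Real.exp (A * a₀) ≤ A * a₀ * Real.exp A := by gcongr
    linarith
  rw [hwα] at hmain
  have h2 : w n - (R + 1) = (u n - F n * R) / F n := by
    have := (hF0 n).ne'
    simp only [hw]
    field_simp
    ring
  rw [h2, abs_div, abs_of_pos (hF0 n), div_le_iff₀ (hF0 n)] at hmain
  have h3 : (R + 1) * (Real.exp (∑ j ∈ Finset.Ico α n, η j) - 1) ≤
      2 * R * (A * Real.exp A * a₀) := by
    have h4 : 0 ≤ Real.exp (∑ j ∈ Finset.Ico α n, η j) - 1 := by
      have := Real.add_one_le_exp (∑ j ∈ Finset.Ico α n, η j)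
      have := Finset.sum_nonneg fun j (_ : j ∈ Finset.Ico α n) => hη0 j
      linarith
    have : R + 1 ≤ 2 * R := by linarith
    gcongr
  calc _ ≤ _ := hmain
    _ ≤ 2 * R * (A * Real.exp A * a₀) * F n := mul_le_mul_of_nonneg_right h3 (hF0 n).le
    _ = _ := by ring

end Recursion

section MainTerm

variable {d n m k : ℕ} {δ r p : ℝ} {a b : Fin k → Fin n} {t : Fin k → Fin m}

lemma stepFactor_pos (hδ : 0 < δ) (hm : 1 ≤ m) (hp : 0 < p) (j : ℕ) :
    0 < stepFactor δ p m a b j := by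
  have h1 := one_le_ratio_pow (a := a) (b := b) hδ j
  have h2 := typical_pos hδ hm hp j
  unfold stepFactor
  have h3 : 0 < ((((j : ℝ) + 1) / j) ^ (1 / (2 + δ))) ^ openCount a b j := by linarith
  positivity

lemma stepFactor_eq_prod (j : ℕ) :
    stepFactor δ p m a b j = ∏ q : Fin k,
      (if (a q : ℕ) < j ∧ j ≤ (b q : ℕ) then (((j : ℝ) + 1) / j) ^ (1 / (2 + δ)) else 1) *
        (if (b q : ℕ) = j then 1 / typical δ p m j else 1) := by
  unfold stepFactor openCount sourceCount
  rw [Finset.prod_mul_distrib, ← Finset.prod_filter, ← Finset.prod_filter, Finset.prod_const,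
    Finset.prod_const]

lemma prod_ratio_rpow (s : ℝ) {i j : ℕ} (hij : i ≤ j) :
    ∏ l ∈ Finset.Ico (i + 1) (j + 1), (((l : ℝ) + 1) / l) ^ s =
      (((j : ℝ) + 1) / ((i : ℝ) + 1)) ^ s := by
  induction j, hij using Nat.le_induction with
  | base =>
    have : (i : ℝ) + 1 ≠ 0 := by positivity
    simp [div_self this]
  | succ j hj ih =>
    rw [Finset.prod_Ico_succ_top (by omega), ih, ← Real.mul_rpow (by positivity) (by positivity)]
    congr 1
    push_cast
    field_simp

/-- The accumulated factors of all the steps. -/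
lemma prod_stepFactor (hab : ∀ q, a q ≤ b q) {α : ℕ} (hα : ∀ q, α ≤ (a q : ℕ)) :
    ∏ j ∈ Finset.Ico α n, stepFactor δ p m a b j =
      ∏ q : Fin k, (((b q : ℝ) + 1) / ((a q : ℝ) + 1)) ^ (1 / (2 + δ)) *
        (1 / typical δ p m (b q)) := by
  simp only [stepFactor_eq_prod]
  rw [Finset.prod_comm]
  refine Finset.prod_congr rfl fun q _ => ?_
  have hq := hα q
  have hq2 : (a q : ℕ) ≤ b q := hab q
  have hq3 := (b q).2
  rw [Finset.prod_mul_distrib]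
  congr 1
  · rw [← Finset.prod_filter, ← prod_ratio_rpow _ hq2]
    refine Finset.prod_congr ?_ fun _ _ => rfl
    ext j
    simp only [Finset.mem_filter, Finset.mem_Ico]
    omega
  · rw [Finset.prod_ite_eq, if_pos]
    rw [Finset.mem_Ico]
    omega

/-- The partial products of the step factors decay at most polynomially. -/
lemma one_le_mul_prod_stepFactor (hδ : 0 < δ) (hm : 1 ≤ m) (hp : 0 < p) (α j : ℕ) :
    1 ≤ (1 + p * ((2 + δ) * m)) ^ k * ((j : ℝ) + 1) ^ k *
      ∏ i ∈ Finset.Ico α (j + 1), stepFactor δ p m a b i := by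
  have hm0 : (0 : ℝ) < m := by exact_mod_cast hm
  set E : ℝ := 1 + p * ((2 + δ) * m) with hE
  have hE1 : 1 ≤ E := by
    have : 0 ≤ p * ((2 + δ) * m) := by positivity
    linarith
  set J : ℝ := (j : ℝ) + 1 with hJ
  have hJ1 : 1 ≤ J := by simp [hJ]
  have hEJ : 1 ≤ E * J := by nlinarith
  have h1 : ∀ i ∈ Finset.Ico α (j + 1),
      (1 / (E * J)) ^ sourceCount b i ≤ stepFactor δ p m a b i := by
    intro i hi
    have hT0 := typical_pos hδ hm hp i
    have hTi : typical δ p m i ≤ E * J := by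
      have hij : (i : ℝ) + 1 ≤ J := by
        have : i ≤ j := by have := (Finset.mem_Ico.1 hi).2; omega
        rw [hJ]
        gcongr
      unfold typical
      calc p * ((2 + δ) * m * ((i : ℝ) + 1)) = p * ((2 + δ) * m) * ((i : ℝ) + 1) := by ring
        _ ≤ E * J := by
          gcongr
          linarith
    unfold stepFactor
    have h2 : (1 / (E * J)) ^ sourceCount b i ≤ (1 / typical δ p m i) ^ sourceCount b i :=
      pow_le_pow_left₀ (by positivity) (one_div_le_one_div_of_le hT0 hTi) _
    refine h2.trans (le_mul_of_one_le_left (by positivity) (one_le_ratio_pow hδ i))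
  have h2 := Finset.prod_le_prod (fun i _ => by positivity) h1
  rw [Finset.prod_pow_eq_pow_sum] at h2
  have h3 : ∑ i ∈ Finset.Ico α (j + 1), sourceCount b i ≤ k := by
    unfold sourceCount
    rw [← Finset.card_biUnion]
    · exact (Finset.card_le_univ _).trans (by simp)
    · intro i _ i' _ hii
      rw [Function.onFun, Finset.disjoint_left]
      intro q hq hq'
      simp only [Finset.mem_filter, Finset.mem_univ, true_and] at hq hq'
      exact hii (hq.symm.trans hq')
  have h4 : (1 / (E * J)) ^ k ≤ (1 / (E * J)) ^ ∑ i ∈ Finset.Ico α (j + 1), sourceCount b i :=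
    pow_le_pow_of_le_one (by positivity) (by rw [div_le_one (by positivity)]; exact hEJ) h3
  have h5 : (E * J) ^ k * (1 / (E * J)) ^ k = 1 := by
    rw [← mul_pow, mul_one_div_cancel (by positivity), one_pow]
  rw [← mul_pow, ← h5]
  exact mul_le_mul_of_nonneg_left (h4.trans h2) (by positivity)

/-- Grouping the prescribed edges by their targets. -/
lemma prod_rise_eq (w : ℝ) : ∀ (k : ℕ) (a : Fin k → Fin n),
    ∏ c, rise w (Finset.univ.filter fun q => a q = c).card =
      ∏ q, (w + (Finset.univ.filter fun q' => q' < q ∧ a q' = a q).card)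
  | 0, a => by simp
  | k + 1, a => by
    have hcard : ∀ P : Fin (k + 1) → Prop, ∀ [DecidablePred P],
        (Finset.univ.filter P).card =
          (Finset.univ.filter fun q : Fin k => P q.castSucc).card +
            if P (Fin.last k) then 1 else 0 := by
      intro P _
      simp only [Finset.card_filter, Fin.sum_univ_castSucc]
    rw [Fin.prod_univ_castSucc]
    have h1 : ∀ q : Fin k, (Finset.univ.filter fun q' => q' < q.castSucc ∧ a q' = a q.castSucc).card =
        (Finset.univ.filter fun q' : Fin k => q' < q ∧ a q'.castSucc = a q.castSucc).card := by
      intro q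
      rw [hcard]
      simp [Fin.not_lt.2 (Fin.castSucc_lt_last q).le]
    have h2 : (Finset.univ.filter fun q' => q' < Fin.last k ∧ a q' = a (Fin.last k)).card =
        (Finset.univ.filter fun q' : Fin k => a q'.castSucc = a (Fin.last k)).card := by
      rw [hcard]
      simp [Fin.castSucc_lt_last]
    simp only [h1, h2]
    rw [← prod_rise_eq w k fun q => a q.castSucc]
    rw [← Finset.mul_prod_erase _ _ (Finset.mem_univ (a (Fin.last k))),
      ← Finset.mul_prod_erase (a := a (Fin.last k)) _
        (fun c => rise w (Finset.univ.filter fun q : Fin k => a q.castSucc = c).card)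
        (Finset.mem_univ _)]
    rw [hcard, if_pos rfl, rise_succ]
    have h3 : ∏ c ∈ Finset.univ.erase (a (Fin.last k)),
        rise w (Finset.univ.filter fun q => a q = c).card =
        ∏ c ∈ Finset.univ.erase (a (Fin.last k)),
        rise w (Finset.univ.filter fun q : Fin k => a q.castSucc = c).card := by
      refine Finset.prod_congr rfl fun c hc => ?_
      rw [hcard, if_neg (Finset.ne_of_mem_erase hc).symm, add_zero]
    rw [h3]
    ring

end MainTerm

/-! ### Conditioning on the positions of the end points -/

section Conditional

variable {d n m k : ℕ} {δ r p : ℝ} {a b : Fin k → Fin n} {t : Fin k → Fin m}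

/-- The end points of the prescribed edges. -/
def endpoints (a b : Fin k → Fin n) : Finset (Fin n) := Finset.univ.image a ∪ Finset.univ.image b

/-- The laws of the positions, when those of the end points of the prescribed edges are fixed. -/
def pinnedLaw (a b : Fin k → Fin n) (ξ : Fin n → Sphere d) (v : Fin n) : Measure (Sphere d) :=
  if v ∈ endpoints a b then Measure.dirac (ξ v) else area d

instance (ξ : Fin n → Sphere d) (v : Fin n) : IsProbabilityMeasure (pinnedLaw a b ξ v) := by
  have := isProb_area d
  unfold pinnedLaw
  split_ifs <;> infer_instance

lemma mem_endpoints_left (q : Fin k) : a q ∈ endpoints a b :=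
  Finset.mem_union_left _ (Finset.mem_image_of_mem _ (Finset.mem_univ _))

lemma mem_endpoints_right (q : Fin k) : b q ∈ endpoints a b :=
  Finset.mem_union_right _ (Finset.mem_image_of_mem _ (Finset.mem_univ _))

lemma card_endpoints_le : (endpoints a b).card ≤ 2 * k := by
  refine (Finset.card_union_le _ _).trans ?_
  have h1 := Finset.card_image_le (s := (Finset.univ : Finset (Fin k))) (f := a)
  have h2 := Finset.card_image_le (s := (Finset.univ : Finset (Fin k))) (f := b)
  simp only [Finset.card_univ, Fintype.card_fin] at h1 h2
  omega

/-- Under the pinned laws, the end points have the prescribed positions almost surely. -/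
lemma ae_eq_of_mem_endpoints (ξ : Fin n → Sphere d) :
    ∀ᵐ x ∂Measure.pi (pinnedLaw a b ξ), ∀ v ∈ endpoints a b, x v = ξ v := by
  refine ae_all_iff.2 fun v => ?_
  by_cases hv : v ∈ endpoints a b
  · have h1 : ∀ᵐ y ∂pinnedLaw a b ξ v, y = ξ v := by
      unfold pinnedLaw
      rw [if_pos hv]
      exact (ae_dirac_iff (measurableSet_singleton (ξ v))).2 rfl
    have h2 := (measurePreserving_eval (pinnedLaw a b ξ) v).quasiMeasurePreserving.ae h1
    filter_upwards [h2] with x hx _ using hx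
  · exact Filter.Eventually.of_forall fun x h => absurd h hv

lemma expect_mono_ae {μ : Fin n → Measure (Sphere d)} [∀ b, IsProbabilityMeasure (μ b)] (hδ : 0 < δ)
    (hr : 0 ≤ r) {j : ℕ} {G H : (Fin n → Sphere d) → Edges n m → ℝ}
    (hG : Nice G) (hH : Nice H) (h : ∀ᵐ x ∂Measure.pi μ, ∀ e, Valid e → G x e ≤ H x e) :
    expect δ r μ j G ≤ expect δ r μ j H := by
  refine integral_mono_ae (integrable_finsetSum _ fun e _ => hG.integrable hδ hr j e)
    (integrable_finsetSum _ fun e _ => hH.integrable hδ hr j e) ?_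
  filter_upwards [h] with x hx
  refine Finset.sum_le_sum fun e _ => ?_
  by_cases he : Valid e
  · exact mul_le_mul_of_nonneg_left (hx e he) (density_nonneg hδ j x e)
  · simp [density_eq_zero j x he]

lemma expect_nonneg {μ : Fin n → Measure (Sphere d)} (hδ : 0 < δ) {j : ℕ}
    {G : (Fin n → Sphere d) → Edges n m → ℝ} (hG : ∀ x e, 0 ≤ G x e) : 0 ≤ expect δ r μ j G :=
  integral_nonneg fun x => Finset.sum_nonneg fun e _ => mul_nonneg (density_nonneg hδ j x e) (hG x e)

/-- Whether the weight around `y` is atypical for the step of `v` does not depend on the position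
of `v`. -/
lemma badInd_update (v : Fin n) (y z : Sphere d) (x : Fin n → Sphere d) (e : Edges n m) :
    badInd δ r p v y (Function.update x v z) e = badInd δ r p v y x e := by
  have h := (dependsBefore_mass (m := m) (δ := δ) (r := r) v y).update (le_refl (v : ℕ)) x e z (e v)
  rw [Function.update_eq_self] at h
  unfold badInd
  rw [h]

lemma nice_integral_badInd (j : ℕ) (ν : Measure (Sphere d)) [IsProbabilityMeasure ν] :
    Nice (n := n) (m := m) fun x e => ∫ y, badInd δ r p j y x e ∂ν where
  meas e := by
    have h := (measurable_badInd (d := d) (n := n) (δ := δ) (r := r) (p := p) j e)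
    have h2 : StronglyMeasurable (Function.uncurry fun (x : Fin n → Sphere d) (y : Sphere d) =>
        badInd δ r p j y x e) :=
      (h.comp (f := fun z : (Fin n → Sphere d) × Sphere d => (z.2, z.1))
        (measurable_snd.prodMk measurable_fst)).stronglyMeasurable
    exact h2.integral_prod_right.measurable
  bdd := ⟨1, fun x e => by
    have h := norm_integral_le_of_norm_le_const (μ := ν) (f := fun y => badInd δ r p j y x e) (C := 1)
      (Filter.Eventually.of_forall fun y => by
        obtain ⟨h0, h1⟩ := badInd_mem (δ := δ) (r := r) (p := p) j y x e
        rwa [Real.norm_eq_abs, abs_of_nonneg h0])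
    simpa using h⟩

/-- The average change of the potential in one step, when the positions of the end points of the
prescribed edges are fixed and within reach of each other. -/
lemma exists_abs_integral_pinnedLaw_sub_le (hδ : 0 < δ) (hm : 1 ≤ m) (hp : 0 < p) (k : ℕ) :
    ∃ C : ℝ, 0 ≤ C ∧ ∀ (d n : ℕ) (r : ℝ), CapArea d r p → 0 ≤ r → ∀ (a b : Fin k → Fin n)
      (t : Fin k → Fin m), (∀ q, a q ≤ b q) → (Function.Injective fun q => (b q, t q)) →
      ∀ ξ : Fin n → Sphere d, (∀ q, dist (ξ (a q)) (ξ (b q)) ≤ r) →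
      ∀ (v : Fin n) (x : Fin n → Sphere d), (∀ u ∈ endpoints a b, x u = ξ u) →
      ∀ e : Edges n m, Valid e →
      |∫ y, potentialFactor δ r a b t v (Function.update x v y) e ∂pinnedLaw a b ξ v -
        stepFactor δ p m a b v| ≤
      C * (((v : ℝ) + 1) ^ (-1 - errExp δ) +
          if (v : ℕ) ∈ (endpoints a b).image Fin.val then ((v : ℝ) + 1) ^ (-errExp δ) else 0) *
        stepFactor δ p m a b v + C * ∫ y, badInd δ r p v y x e ∂pinnedLaw a b ξ v := by
  obtain ⟨C₁, hC₁, H1⟩ := exists_abs_integral_potentialFactor_sub_le hδ hm hp k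
  obtain ⟨C₂, hC₂, H2⟩ := exists_abs_potentialFactor_sub_le hδ hm hp k
  refine ⟨C₁ + C₂, by positivity, fun d n r hcap hr a b t hab hinj ξ hξ v x hx e he => ?_⟩
  have hf := stepFactor_pos (a := a) (b := b) hδ hm hp v
  have hb0 : 0 ≤ ∫ y, badInd δ r p v y x e ∂pinnedLaw a b ξ v :=
    integral_nonneg fun y => (badInd_mem v y x e).1
  set J : ℝ := (v : ℝ) + 1 with hJ
  have hJ0 : 0 < J := by positivity
  have hJ1 : 0 < J ^ (-1 - errExp δ) := by positivity
  have hJ2 : 0 < J ^ (-errExp δ) := by positivity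
  have hmem : (v : ℕ) ∈ (endpoints a b).image Fin.val ↔ v ∈ endpoints a b := by
    rw [Finset.mem_image]
    constructor
    · rintro ⟨u, hu, huv⟩
      rwa [← Fin.ext huv]
    · exact fun h => ⟨v, h, rfl⟩
  by_cases hv : v ∈ endpoints a b
  · rw [if_pos (hmem.2 hv)]
    unfold pinnedLaw at hb0 ⊢
    rw [if_pos hv] at hb0 ⊢
    rw [integral_dirac] at hb0
    rw [integral_dirac, integral_dirac]
    have hupd : ∀ u ∈ endpoints a b, Function.update x v (ξ v) u = ξ u := by
      intro u hu
      rcases eq_or_ne u v with rfl | huv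
      · simp
      · rw [Function.update_of_ne huv, hx u hu]
    have h1 := H2 d n r hr a b t hab hinj v (Function.update x v (ξ v)) e he fun q hq => by
      rw [hupd _ hv, hupd _ (mem_endpoints_left q), dist_comm, ← hq]
      exact hξ q
    rw [badInd_update, Function.update_self, ← hJ] at h1
    have h2 : 0 ≤ C₂ * J ^ (-1 - errExp δ) * stepFactor δ p m a b v +
      C₁ * (J ^ (-1 - errExp δ) + J ^ (-errExp δ)) * stepFactor δ p m a b v := by positivity
    have h3 := mul_nonneg hC₁ hb0
    linarith
  · rw [if_neg (mt hmem.1 hv)]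
    have hva : ∀ q, a q ≠ v := by
      rintro q rfl
      exact hv (mem_endpoints_left q)
    have hvb : ∀ q, b q ≠ v := by
      rintro q rfl
      exact hv (mem_endpoints_right q)
    unfold pinnedLaw at hb0 ⊢
    rw [if_neg hv] at hb0 ⊢
    have h1 := H1 d n r hcap hr a b t v hva hvb x e he
    rw [← hJ] at h1
    have hf1 : 1 ≤ stepFactor δ p m a b v := by
      have h0 : sourceCount b v = 0 := by
        unfold sourceCount
        rw [Finset.card_eq_zero, Finset.filter_eq_empty_iff]
        exact fun q _ h => hvb q (Fin.ext h)
      unfold stepFactor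
      rw [h0, pow_zero, mul_one]
      exact one_le_ratio_pow hδ v
    have h2 : C₁ * J ^ (-1 - errExp δ) * 1 ≤
      C₁ * J ^ (-1 - errExp δ) * stepFactor δ p m a b v := by gcongr
    have h3 := mul_nonneg hC₂ hb0
    have h4 : 0 ≤ C₂ * J ^ (-1 - errExp δ) * stepFactor δ p m a b v := by positivity
    linarith

/-- The recursion for the expected potential. Improbable events contribute an additive error,
because the bound of the potential on them is deterministic. -/
lemma exists_abs_expect_potential_succ_sub_le (hδ : 0 < δ) (hm : 1 ≤ m) (hp : 0 < p) (hp1 : p ≤ 1)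
    (k : ℕ) :
    ∃ C₁ C₂ : ℝ, 0 ≤ C₁ ∧ 0 ≤ C₂ ∧ ∀ (d n : ℕ) (r : ℝ), CapArea d r p → 0 ≤ r →
      ∀ (a b : Fin k → Fin n) (t : Fin k → Fin m), (∀ q, a q ≤ b q) →
      (Function.Injective fun q => (b q, t q)) →
      ∀ ξ : Fin n → Sphere d, (∀ q, dist (ξ (a q)) (ξ (b q)) ≤ r) → ∀ v : Fin n,
      |expect δ r (pinnedLaw a b ξ) (v + 1) (fun _ e => potential δ a b t (v + 1) e) -
        stepFactor δ p m a b v *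
          expect δ r (pinnedLaw a b ξ) v (fun _ e => potential δ a b t v e)| ≤
      C₁ * (((v : ℝ) + 1) ^ (-1 - errExp δ) +
          if (v : ℕ) ∈ (endpoints a b).image Fin.val then ((v : ℝ) + 1) ^ (-errExp δ) else 0) *
        (stepFactor δ p m a b v *
          expect δ r (pinnedLaw a b ξ) v (fun _ e => potential δ a b t v e)) +
        C₂ / ((v : ℝ) + 1) ^ (k + 2) := by
  obtain ⟨C₁, hC₁, H1⟩ := exists_abs_integral_pinnedLaw_sub_le hδ hm hp k
  -- The power `2 k + 2` beats the bound `potential_le` and the decay of the main term.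
  obtain ⟨C₃, hC₃, H3⟩ := exists_expect_badInd_le hδ hm hp hp1 (2 * k) (2 * k + 2)
  refine ⟨C₁, ((2 + δ) * m + k + 1) ^ k * C₁ * C₃, hC₁, by positivity,
    fun d n r hcap hr a b t hab hinj ξ hξ v => ?_⟩
  set μ := pinnedLaw a b ξ with hμ
  set J : ℝ := (v : ℝ) + 1 with hJ
  have hJ0 : 0 < J := by positivity
  set f := stepFactor δ p m a b v with hf
  set η : ℝ := C₁ * (J ^ (-1 - errExp δ) +
    if (v : ℕ) ∈ (endpoints a b).image Fin.val then J ^ (-errExp δ) else 0) with hη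
  set V : (Fin n → Sphere d) → Edges n m → ℝ := fun _ e => potential δ a b t v e with hV
  set B : (Fin n → Sphere d) → Edges n m → ℝ := fun x e => ∫ y, badInd δ r p v y x e ∂μ v with hB
  set D : ℝ := (((2 + δ) * m + k + 1) * J) ^ k with hD
  have hVn : Nice V := nice_potential hδ v.2.le
  have hBn : Nice B := nice_integral_badInd v (μ v)
  have hPn : Nice fun (_ : Fin n → Sphere d) e => potential δ a b t (v + 1) e :=
    nice_potential hδ v.2
  have hSn := hPn.step (μ := μ) hδ hr hm v
  have hB0 : ∀ x e, 0 ≤ B x e := fun x e => integral_nonneg fun y => (badInd_mem v y x e).1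
  have hBe : expect δ r μ v B ≤ C₃ / J ^ (2 * k + 2) := by
    simp only [hB]
    rw [expect_integral hδ hr (fun e => measurable_badInd v e) (C := 1) fun y x e => by
      obtain ⟨h0, h1⟩ := badInd_mem (δ := δ) (r := r) (p := p) v y x e
      rwa [abs_of_nonneg h0]]
    have h1 : ∀ y, expect δ r μ v (badInd (m := m) δ r p v y) ≤ C₃ / J ^ (2 * k + 2) := by
      intro y
      refine H3 d n r hcap hr μ (endpoints a b) card_endpoints_le (fun u hu => ?_) y v v.2.le
      rw [hμ, pinnedLaw, if_neg hu]
    refine (integral_mono_of_nonneg (Filter.Eventually.of_forall fun y => ?_) (integrable_const _)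
      (Filter.Eventually.of_forall h1)).trans (by simp)
    exact expect_nonneg hδ fun x e => (badInd_mem v y x e).1
  have hpt : ∀ᵐ x ∂Measure.pi μ, ∀ e, Valid e →
      |stepExpect δ r μ v (fun _ e => potential δ a b t (v + 1) e) x e - f * V x e| ≤
        η * (f * V x e) + D * C₁ * B x e := by
    filter_upwards [ae_eq_of_mem_endpoints (a := a) (b := b) ξ] with x hx e he
    rw [stepExpect_potential hδ hr hm hinj]
    have h1 := H1 d n r hcap hr a b t hab hinj ξ hξ v x hx e he
    have hV0 : 0 ≤ potential δ a b t v e := potential_nonneg hδ v e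
    have hVD : potential δ a b t v e ≤ D := potential_le hδ v.2.le e
    have h2 := mul_le_mul_of_nonneg_left h1 hV0
    rw [← abs_of_nonneg hV0, ← abs_mul, abs_of_nonneg hV0] at h2
    rw [mul_sub] at h2
    simp only [hV]
    rw [mul_comm f]
    refine h2.trans ?_
    rw [mul_add]
    have h3 : potential δ a b t v e * (C₁ * B x e) ≤ D * (C₁ * B x e) :=
      mul_le_mul_of_nonneg_right hVD (mul_nonneg hC₁ (hB0 x e))
    have h4 : potential δ a b t v e * (η * f) = η * (potential δ a b t v e * f) := by ring
    linarith
  rw [expect_succ hPn hδ hr]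
  have hup := expect_mono_ae (j := v) hδ hr hSn
    ((hVn.const_mul (f + η * f)).add (hBn.const_mul (D * C₁))) (by
      filter_upwards [hpt] with x hx e he
      have := (abs_le.1 (hx e he)).2
      linarith)
  have hlo := expect_mono_ae (j := v) hδ hr
    ((hVn.const_mul (f - η * f)).add (hBn.const_mul (-(D * C₁)))) hSn (by
      filter_upwards [hpt] with x hx e he
      have := (abs_le.1 (hx e he)).1
      linarith)
  rw [expect_add hδ hr (hVn.const_mul _) (hBn.const_mul _), expect_const_mul, expect_const_mul]
    at hup hlo
  have hD0 : 0 ≤ D * C₁ := by positivity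
  have hlast : D * C₁ * expect δ r μ v B ≤ ((2 + δ) * m + k + 1) ^ k * C₁ * C₃ / J ^ (k + 2) := by
    refine (mul_le_mul_of_nonneg_left hBe hD0).trans (le_of_eq ?_)
    rw [hD, mul_pow, show 2 * k + 2 = k + (k + 2) by ring, pow_add J k]
    field_simp
  rw [abs_le]
  constructor <;> linarith

/-- The conditional probability of the prescribed edges, given positions for which all of them are
possible. -/
theorem exists_abs_expect_pinnedLaw_sub_le (hδ : 0 < δ) (hm : 1 ≤ m) (hp : 0 < p) (hp1 : p ≤ 1)
    (k : ℕ) :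
    ∃ C : ℝ, 0 ≤ C ∧ ∀ (d n : ℕ) (r : ℝ), CapArea d r p → 0 ≤ r →
      ∀ (a b : Fin k → Fin n) (t : Fin k → Fin m), (∀ q, a q ≤ b q) →
      (Function.Injective fun q => (b q, t q)) →
      ∀ ξ : Fin n → Sphere d, (∀ q, dist (ξ (a q)) (ξ (b q)) ≤ r) →
      ∀ α : ℕ, α ≤ n → (∀ q, α ≤ (a q : ℕ)) →
      |expect δ r (pinnedLaw a b ξ) n
          (fun _ (e : Edges n m) => if ∀ q, e (b q) (t q) = a q then 1 else 0) -
        (∏ j ∈ Finset.Ico α n, stepFactor δ p m a b j) *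
          ∏ c, rise ((1 + δ) * m) (Finset.univ.filter fun q => a q = c).card| ≤
      C * ((α : ℝ) + 1) ^ (-errExp δ) * ((∏ j ∈ Finset.Ico α n, stepFactor δ p m a b j) *
          ∏ c, rise ((1 + δ) * m) (Finset.univ.filter fun q => a q = c).card) := by
  obtain ⟨C₁, C₂, hC₁, hC₂, H⟩ := exists_abs_expect_potential_succ_sub_le hδ hm hp hp1 k
  have hm1 : (1 : ℝ) ≤ m := by exact_mod_cast hm
  set Q : ℝ := (1 + p * ((2 + δ) * m)) ^ k with hQ
  have hQ0 : 0 ≤ Q := by positivity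
  have hh0 := errExp_pos hδ
  refine ⟨2 * ((C₁ + Q * C₂) * (4 / errExp δ) + C₁ * (2 * k : ℕ)) *
    Real.exp ((C₁ + Q * C₂) * (4 / errExp δ) + C₁ * (2 * k : ℕ)), by positivity,
    fun d n r hcap hr a b t hab hinj ξ hξ α hαn hα => ?_⟩
  have hR : 1 ≤ ∏ c, rise ((1 + δ) * m) (Finset.univ.filter fun q => a q = c).card := by
    refine Finset.prod_induction _ (1 ≤ ·) (fun _ _ => one_le_mul_of_one_le_of_one_le) le_rfl
      fun c _ => ?_
    refine Finset.prod_induction _ (1 ≤ ·) (fun _ _ => one_le_mul_of_one_le_of_one_le) le_rfl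
      fun i _ => ?_
    have : (0 : ℝ) ≤ i := Nat.cast_nonneg i
    nlinarith
  have hmain := abs_sub_le_of_recursion (k := k) (N := 2 * k) hh0 ((errExp_le δ).trans (by norm_num))
    hC₁ hC₂ hQ0 hR hαn (s := (endpoints a b).image Fin.val)
    (Finset.card_image_le.trans card_endpoints_le)
    (u := fun j => expect δ r (pinnedLaw a b ξ) j (fun _ e => potential δ a b t j e))
    (f := stepFactor δ p m a b) (fun j => stepFactor_pos hδ hm hp j)
    (fun j => expect_nonneg hδ fun x e => potential_nonneg hδ j e) ?_
    (fun j => one_le_mul_prod_stepFactor hδ hm hp α j)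
    (fun j _ hjn => H d n r hcap hr a b t hab hinj ξ hξ ⟨j, hjn⟩)
  · simp only [potential_last] at hmain
    exact hmain
  · rw [expect_congr (fun _ e he => potential_eq_of_le hab hα he)]
    exact expect_const hδ hr hm hαn _

end Conditional

/-! ### Averaging over the positions -/

section Disintegration

variable {d n m k : ℕ} {δ r p : ℝ} {a b : Fin k → Fin n} {t : Fin k → Fin m}

/-- Probabilities in the model are expectations with respect to independent uniform positions. -/
lemma law_real_eq (hδ : 0 < δ) (hr : 0 ≤ r) {S : Set ((Fin n → Sphere d) × Edges n m)}
    (hS : MeasurableSet S) [∀ ω, Decidable (ω ∈ S)] :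
    (law d n m δ r).real S =
      expect δ r (fun _ => area d) n (fun x e => if (x, e) ∈ S then 1 else 0) := by
  have := isProb_area d
  have hdens : ∀ (x : Fin n → Sphere d) (e : Edges n m),
      density δ r n x e = ∏ b, ∏ i, edgeProb δ r x e b i (e b i) := by
    intro x e
    unfold density
    exact Finset.prod_congr rfl fun b _ => if_pos b.2
  have hG : Nice fun (x : Fin n → Sphere d) (e : Edges n m) =>
      if (x, e) ∈ S then (1 : ℝ) else 0 :=
    ⟨fun e => Measurable.ite (measurable_prodMk_right hS) measurable_const measurable_const,
      1, fun x e => by split_ifs <;> simp⟩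
  have hint : Integrable (fun x => ∑ e, density δ r n x e * if (x, e) ∈ S then (1 : ℝ) else 0)
      (Measure.pi fun _ : Fin n => area d) :=
    integrable_finsetSum _ fun e _ => hG.integrable hδ hr n e
  have h0 : ∀ x (e : Edges n m), 0 ≤ density δ r n x e * if (x, e) ∈ S then (1 : ℝ) else 0 :=
    fun x e => mul_nonneg (density_nonneg hδ n x e) (by split_ifs <;> simp)
  have hmeas : Measurable fun ω : (Fin n → Sphere d) × Edges n m => ENNReal.ofReal
      (∏ b : Fin n, ∏ i : Fin m, edgeProb δ r ω.1 ω.2 b i (ω.2 b i)) :=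
    (measurable_density δ r).ennreal_ofReal
  unfold expect
  rw [Measure.real, law, withDensity_apply _ hS, ← lintegral_indicator hS,
    lintegral_prod _ (hmeas.indicator hS).aemeasurable,
    integral_eq_lintegral_of_nonneg_ae
      (Filter.Eventually.of_forall fun x => Finset.sum_nonneg fun e _ => h0 x e)
      hint.aestronglyMeasurable]
  congr 1
  refine lintegral_congr fun x => ?_
  rw [lintegral_count, tsum_fintype, ENNReal.ofReal_sum_of_nonneg fun e _ => h0 x e]
  refine Finset.sum_congr rfl fun e _ => ?_
  rw [hdens]
  by_cases hx : (x, e) ∈ S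
  · simp [hx]
  · simp [hx]

/-- The positions `ξ` for the end points of the prescribed edges, and `x` for the other vertices. -/
def pin (a b : Fin k → Fin n) (ξ x : Fin n → Sphere d) (v : Fin n) : Sphere d :=
  if v ∈ endpoints a b then ξ v else x v

lemma measurable_pin :
    Measurable fun z : (Fin n → Sphere d) × (Fin n → Sphere d) => pin a b z.1 z.2 := by
  refine measurable_pi_lambda _ fun v => ?_
  unfold pin
  split_ifs
  · exact (measurable_pi_apply v).comp measurable_fst
  · exact (measurable_pi_apply v).comp measurable_snd

/-- With fixed `ξ`, the independent uniform positions outside the end points have the pinned laws.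
-/
lemma measurePreserving_pin (ξ : Fin n → Sphere d) :
    MeasurePreserving (pin a b ξ) (Measure.pi fun _ => area d) (Measure.pi (pinnedLaw a b ξ)) := by
  have := isProb_area d
  have h : pin a b ξ = fun x v => (fun y : Sphere d => if v ∈ endpoints a b then ξ v else y) (x v) :=
    rfl
  rw [h]
  refine measurePreserving_pi _ _ fun v => ?_
  unfold pinnedLaw
  by_cases hv : v ∈ endpoints a b
  · have h1 : (fun y : Sphere d => if v ∈ endpoints a b then ξ v else y) = fun _ => ξ v := by
      funext y
      exact if_pos hv
    change MeasurePreserving (fun y : Sphere d => if v ∈ endpoints a b then ξ v else y) _ _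
    rw [h1, if_pos hv]
    exact ⟨measurable_const, by simp⟩
  · have h1 : (fun y : Sphere d => if v ∈ endpoints a b then ξ v else y) = id := by
      funext y
      exact if_neg hv
    change MeasurePreserving (fun y : Sphere d => if v ∈ endpoints a b then ξ v else y) _ _
    rw [h1, if_neg hv]
    exact MeasurePreserving.id _

/-- Choosing the positions of the end points separately does not change the joint law. -/
lemma measurePreserving_pin_prod :
    MeasurePreserving (fun z : (Fin n → Sphere d) × (Fin n → Sphere d) => pin a b z.1 z.2)
      ((Measure.pi fun _ => area d).prod (Measure.pi fun _ => area d))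
      (Measure.pi fun _ => area d) := by
  have := isProb_area d
  refine ⟨measurable_pin, (Measure.pi_eq fun s hs => ?_).symm⟩
  rw [Measure.map_apply measurable_pin (MeasurableSet.univ_pi hs)]
  have h : (fun z : (Fin n → Sphere d) × (Fin n → Sphere d) => pin a b z.1 z.2) ⁻¹'
      (Set.univ.pi s) =
      (Set.univ.pi fun v => if v ∈ endpoints a b then s v else Set.univ) ×ˢ
        (Set.univ.pi fun v => if v ∈ endpoints a b then Set.univ else s v) := by
    ext ⟨ξ, x⟩
    simp only [Set.mem_preimage, Set.mem_univ_pi, Set.mem_prod, pin, ← forall_and]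
    refine forall_congr' fun v => ?_
    split_ifs <;> simp
  rw [h, Measure.prod_prod, Measure.pi_pi, Measure.pi_pi, ← Finset.prod_mul_distrib]
  refine Finset.prod_congr rfl fun v _ => ?_
  split_ifs <;> simp

/-- Averaging over the positions of the end points of the prescribed edges. -/
lemma expect_eq_integral_pinnedLaw (hδ : 0 < δ) (hr : 0 ≤ r) (a b : Fin k → Fin n) {j : ℕ}
    {G : (Fin n → Sphere d) → Edges n m → ℝ} (hG : Nice G) :
    Integrable (fun ξ => expect δ r (pinnedLaw a b ξ) j G) (Measure.pi fun _ : Fin n => area d) ∧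
      expect δ r (fun _ => area d) j G =
        ∫ ξ, expect δ r (pinnedLaw a b ξ) j G ∂Measure.pi fun _ : Fin n => area d := by
  have := isProb_area d
  have hint : Integrable (fun x => ∑ e, density δ r j x e * G x e)
      (Measure.pi fun _ : Fin n => area d) :=
    integrable_finsetSum _ fun e _ => hG.integrable hδ hr j e
  have hmeas : Measurable fun x => ∑ e, density δ r j x e * G x e :=
    Finset.measurable_sum _ fun e _ => (measurable_density' j e).mul (hG.meas e)
  have h1 : ∀ ξ, expect δ r (pinnedLaw a b ξ) j G =
      ∫ x, ∑ e, density δ r j (pin a b ξ x) e * G (pin a b ξ x) e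
        ∂Measure.pi fun _ : Fin n => area d := by
    intro ξ
    unfold expect
    rw [← (measurePreserving_pin ξ).map_eq, integral_map (measurePreserving_pin ξ).aemeasurable
      hmeas.aestronglyMeasurable]
  have h2 := (measurePreserving_pin_prod (a := a) (b := b) (d := d)).integrable_comp_of_integrable
    hint
  simp only [h1]
  refine ⟨h2.integral_prod_left, ?_⟩
  unfold expect
  conv_lhs => rw [← (measurePreserving_pin_prod (a := a) (b := b) (d := d)).map_eq]
  rw [integral_map (measurePreserving_pin_prod (a := a) (b := b) (d := d)).aemeasurable
    hmeas.aestronglyMeasurable]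
  exact integral_prod _ h2

/-- A prescribed edge between distant vertices has probability zero. -/
lemma expect_pinnedLaw_eq_zero (hr : 0 ≤ r) {ξ : Fin n → Sphere d} {q : Fin k}
    (hξ : r < dist (ξ (a q)) (ξ (b q))) :
    expect δ r (pinnedLaw a b ξ) n
      (fun _ (e : Edges n m) => if ∀ q, e (b q) (t q) = a q then 1 else 0) = 0 := by
  unfold expect
  refine integral_eq_zero_of_ae ?_
  filter_upwards [ae_eq_of_mem_endpoints (a := a) (b := b) ξ] with x hx
  refine Finset.sum_eq_zero fun e _ => ?_
  split_ifs with he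
  · have hne : a q ≠ b q := by
      intro h
      rw [h, dist_self] at hξ
      exact absurd hr (not_le.2 hξ)
    have h0 : edgeProb δ r x e (b q) (t q) (e (b q) (t q)) = 0 := by
      rw [he q]
      unfold edgeProb
      rw [if_neg hne, hx _ (mem_endpoints_left q), hx _ (mem_endpoints_right q), dist_comm,
        if_neg (not_le.2 hξ), zero_div, ite_self]
    have h1 : density δ r n x e = 0 := by
      unfold density
      refine Finset.prod_eq_zero (Finset.mem_univ (b q)) ?_
      rw [if_pos (b q).2]
      exact Finset.prod_eq_zero (Finset.mem_univ (t q)) h0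
    rw [h1, zero_mul]
  · rw [mul_zero]

/-- The positions are uniform under the law of the model, since the edge probabilities sum to one.
-/
lemma law_real_position (hδ : 0 < δ) (hr : 0 ≤ r) {A : Set (Fin n → Sphere d)}
    (hA : MeasurableSet A) :
    (law d n m δ r).real {ω | ω.1 ∈ A} = (Measure.pi fun _ : Fin n => area d).real A := by
  classical
  have := isProb_area d
  have hS : MeasurableSet {ω : (Fin n → Sphere d) × Edges n m | ω.1 ∈ A} := measurable_fst hA
  rw [law_real_eq hδ hr hS]
  unfold expect
  rw [← integral_indicator_one hA]
  refine integral_congr_ae (Filter.Eventually.of_forall fun x => ?_)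
  have h1 : ∑ e : Edges n m, density δ r n x e = 1 := by
    rw [← sum_prod_edgeProb (m := m) hδ hr x]
    refine Finset.sum_congr rfl fun e _ => ?_
    unfold density
    exact Finset.prod_congr rfl fun b _ => if_pos b.2
  by_cases hx : x ∈ A <;> simp [hx, h1]

/-- The probability of the prescribed edges, before the product of the factors is made explicit. -/
theorem exists_abs_law_sub_le (hδ : 0 < δ) (hm : 1 ≤ m) (hp : 0 < p) (hp1 : p ≤ 1)
    (k : ℕ) :
    ∃ C : ℝ, 0 ≤ C ∧ ∀ (d n : ℕ) (r : ℝ), CapArea d r p → 0 ≤ r →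
      ∀ (a b : Fin k → Fin n) (t : Fin k → Fin m), (∀ q, a q ≤ b q) →
      (Function.Injective fun q => (b q, t q)) → ∀ α : ℕ, α ≤ n → (∀ q, α ≤ (a q : ℕ)) →
      |(law d n m δ r).real {ω | ∀ q, ω.2 (b q) (t q) = a q} -
        (law d n m δ r).real {ω | ∀ q, dist (ω.1 (a q)) (ω.1 (b q)) ≤ r} *
        ((∏ j ∈ Finset.Ico α n, stepFactor δ p m a b j) *
          ∏ c, rise ((1 + δ) * m) (Finset.univ.filter fun q => a q = c).card)| ≤
      C * ((α : ℝ) + 1) ^ (-errExp δ) *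
        ((law d n m δ r).real {ω | ∀ q, dist (ω.1 (a q)) (ω.1 (b q)) ≤ r} *
        ((∏ j ∈ Finset.Ico α n, stepFactor δ p m a b j) *
          ∏ c, rise ((1 + δ) * m) (Finset.univ.filter fun q => a q = c).card)) := by
  classical
  obtain ⟨C, hC, H⟩ := exists_abs_expect_pinnedLaw_sub_le hδ hm hp hp1 k
  refine ⟨C, hC, fun d n r hcap hr a b t hab hinj α hαn hα => ?_⟩
  have := isProb_area d
  set M := (∏ j ∈ Finset.Ico α n, stepFactor δ p m a b j) *
          ∏ c, rise ((1 + δ) * m) (Finset.univ.filter fun q => a q = c).card with hM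
  set A : Set (Fin n → Sphere d) := {ξ | ∀ q, dist (ξ (a q)) (ξ (b q)) ≤ r} with hA
  have hAm : MeasurableSet A := by
    rw [hA, Set.ofPred_forall]
    exact MeasurableSet.iInter fun q =>
      measurableSet_dist_le (measurable_pi_apply _) (measurable_pi_apply _)
  have hpos : (law d n m δ r).real {ω | ∀ q, dist (ω.1 (a q)) (ω.1 (b q)) ≤ r} =
      (Measure.pi fun _ : Fin n => area d).real A := law_real_position hδ hr hAm
  have hG : Nice fun (_ : Fin n → Sphere d) (e : Edges n m) =>
      if ∀ q, e (b q) (t q) = a q then (1 : ℝ) else 0 :=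
    ⟨fun e => measurable_const, 1, fun x e => by split_ifs <;> simp⟩
  have hS : MeasurableSet {ω : (Fin n → Sphere d) × Edges n m | ∀ q, ω.2 (b q) (t q) = a q} :=
    measurable_snd (MeasurableSet.of_discrete (s := {e : Edges n m | ∀ q, e (b q) (t q) = a q}))
  obtain ⟨hint, hev⟩ := expect_eq_integral_pinnedLaw hδ hr a b (j := n) hG
  have hlaw : (law d n m δ r).real {ω | ∀ q, ω.2 (b q) (t q) = a q} =
      expect δ r (fun _ : Fin n => area d) n
        fun _ (e : Edges n m) => if ∀ q, e (b q) (t q) = a q then (1 : ℝ) else 0 := by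
    rw [law_real_eq hδ hr hS]
    rfl
  rw [hpos, hlaw, hev]
  have h1 : (Measure.pi fun _ : Fin n => area d).real A * M =
      ∫ ξ, A.indicator 1 ξ * M ∂Measure.pi fun _ : Fin n => area d := by
    rw [integral_mul_const, integral_indicator_one hAm]
  have hind : Integrable (fun ξ => A.indicator (1 : (Fin n → Sphere d) → ℝ) ξ)
      (Measure.pi fun _ : Fin n => area d) :=
    (integrable_const (1 : ℝ)).indicator hAm
  rw [h1, ← integral_sub hint (hind.mul_const M)]
  refine abs_integral_le_integral_abs.trans ?_
  rw [← integral_const_mul]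
  refine integral_mono (hint.sub (hind.mul_const M)).abs ((hind.mul_const M).const_mul _) fun ξ => ?_
  dsimp only
  by_cases hξ : ξ ∈ A
  · rw [Set.indicator_of_mem hξ, Pi.one_apply, one_mul]
    exact H d n r hcap hr a b t hab hinj ξ hξ α hαn hα
  · rw [Set.indicator_of_notMem hξ, zero_mul, mul_zero, sub_zero]
    simp only [hA, Set.mem_ofPred_eq, not_forall, not_le] at hξ
    obtain ⟨q, hq⟩ := hξ
    rw [expect_pinnedLaw_eq_zero hr hq, abs_zero]

/-- The explicit form of the main term. -/
lemma mainTerm_eq (hδ : 0 < δ) (hm : 1 ≤ m) (hp : 0 < p) (hab : ∀ q, a q ≤ b q) {α : ℕ}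
    (hα : ∀ q, α ≤ (a q : ℕ)) :
    (∏ j ∈ Finset.Ico α n, stepFactor δ p m a b j) *
      ∏ c, rise ((1 + δ) * m) (Finset.univ.filter fun q => a q = c).card =
    ∏ i : Fin k,
      ((1 + δ) * m + (Finset.univ.filter fun j => j < i ∧ a j = a i).card)
        / ((2 + δ) * m) * p⁻¹
        * (label (b i) : ℝ) ^ (-((1 + δ) / (2 + δ)))
        * (label (a i) : ℝ) ^ (-(1 / (2 + δ))) := by
  have hm0 : (0 : ℝ) < m := by exact_mod_cast hm
  rw [prod_stepFactor hab hα, prod_rise_eq, ← Finset.prod_mul_distrib]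
  refine Finset.prod_congr rfl fun q _ => ?_
  have hA : (0 : ℝ) < (a q : ℝ) + 1 := by positivity
  have hB : (0 : ℝ) < (b q : ℝ) + 1 := by positivity
  have hd : 0 < 2 + δ := by linarith
  have he : -((1 + δ) / (2 + δ)) = 1 / (2 + δ) - 1 := by
    field_simp
    ring
  unfold label typical
  push_cast
  rw [Real.div_rpow hB.le hA.le, he, Real.rpow_sub_one hB.ne', Real.rpow_neg hA.le]
  have := Real.rpow_pos_of_pos hA (1 / (2 + δ))
  have := Real.rpow_pos_of_pos hB (1 / (2 + δ))
  field_simp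

lemma capArea_of_measure_closedBall (hp : 0 ≤ p)
    (h : ∀ x : Sphere d, area d (Metric.closedBall x r) = ENNReal.ofReal p) : CapArea d r p := by
  classical
  intro y
  have h1 : ∀ z, (if dist y z ≤ r then (1 : ℝ) else 0) =
      (Metric.closedBall y r).indicator (1 : Sphere d → ℝ) z := by
    intro z
    rw [Set.indicator_apply, Pi.one_apply]
    exact if_congr (by rw [Metric.mem_closedBall, dist_comm]) rfl rfl
  rw [integral_congr_ae (Filter.Eventually.of_forall h1),
    integral_indicator_one Metric.isClosed_closedBall.measurableSet, Measure.real, h,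
    ENNReal.toReal_ofReal hp]

lemma nonneg_of_measure_closedBall (hp : 0 < p)
    (h : ∀ x : Sphere d, area d (Metric.closedBall x r) = ENNReal.ofReal p) : 0 ≤ r := by
  have := isProb_area d
  obtain ⟨x⟩ := nonempty_of_isProbabilityMeasure (area d)
  by_contra! hr
  have h1 := h x
  rw [Metric.closedBall_eq_empty.2 hr, measure_empty, eq_comm, ENNReal.ofReal_eq_zero] at h1
  linarith

end Disintegration

end GPM

end

theorem theorem3p1 (m : ℕ) (δ : ℝ) (hδ : 0 < δ) :
    ∃ c : ℝ, 0 < c ∧ ∀ p : ℝ, 0 < p → p < 1 → ∀ k : ℕ, 1 ≤ k → ∃ C : ℝ,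
      ∀ (d : ℕ) (r : ℝ), 1 ≤ d →
        (∀ x : GPM.Sphere d, GPM.area d (Metric.closedBall x r) = ENNReal.ofReal p) →
        ∀ (n : ℕ) (a b : Fin k → Fin n) (t : Fin k → Fin m),
          (∀ i, a i ≤ b i) → Function.Injective (fun i => (b i, t i)) →
          ∃ ε : ℝ, |ε| ≤ C * ((⨅ i, GPM.label (a i) : ℕ) : ℝ) ^ (-c) ∧
            (GPM.law d n m δ r).real {ω | ∀ i, ω.2 (b i) (t i) = a i} =
              (1 + ε) *
                (GPM.law d n m δ r).real {ω | ∀ i, dist (ω.1 (a i)) (ω.1 (b i)) ≤ r} *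
                ∏ i : Fin k,
                  ((1 + δ) * m + (Finset.univ.filter fun j => j < i ∧ a j = a i).card)
                    / ((2 + δ) * m) * p⁻¹
                    * (GPM.label (b i) : ℝ) ^ (-((1 + δ) / (2 + δ)))
                    * (GPM.label (a i) : ℝ) ^ (-(1 / (2 + δ))) := by
  refine ⟨GPM.errExp δ, GPM.errExp_pos hδ, fun p hp hp1 k hk => ?_⟩
  rcases Nat.eq_zero_or_pos m with rfl | hm
  · exact ⟨0, fun d r _ _ n a b t => (t ⟨0, hk⟩).elim0⟩
  obtain ⟨C, hC, H⟩ := GPM.exists_abs_law_sub_le hδ hm hp hp1.le k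
  refine ⟨C, fun d r _ hball n a b t hab hinj => ?_⟩
  have hm0 : (0 : ℝ) < m := by exact_mod_cast hm
  have hcap := GPM.capArea_of_measure_closedBall hp.le hball
  have hr := GPM.nonneg_of_measure_closedBall hp hball
  have : Nonempty (Fin k) := ⟨⟨0, hk⟩⟩
  obtain ⟨q₀, hq₀⟩ : ∃ q, GPM.label (a q) = ⨅ i, GPM.label (a i) :=
    Nat.sInf_mem (Set.range_nonempty fun i => GPM.label (a i))
  have hmin : ∀ q, (a q₀ : ℕ) ≤ a q := by
    intro q
    have h1 : GPM.label (a q₀) ≤ GPM.label (a q) := by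
      rw [hq₀]
      exact Nat.sInf_le ⟨q, rfl⟩
    unfold GPM.label at h1
    omega
  have hmain := H d n r hcap hr a b t hab hinj (a q₀) (a q₀).2.le hmin
  rw [GPM.mainTerm_eq hδ hm hp hab hmin] at hmain
  have hlabel : ((⨅ i, GPM.label (a i) : ℕ) : ℝ) = ((a q₀ : ℕ) : ℝ) + 1 := by
    rw [← hq₀]
    simp [GPM.label]
  rw [hlabel]
  set P := (GPM.law d n m δ r).real {ω | ∀ i, ω.2 (b i) (t i) = a i}
  set A := (GPM.law d n m δ r).real {ω | ∀ i, dist (ω.1 (a i)) (ω.1 (b i)) ≤ r}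
  set M := ∏ i : Fin k,
                  ((1 + δ) * m + (Finset.univ.filter fun j => j < i ∧ a j = a i).card)
                    / ((2 + δ) * m) * p⁻¹
                    * (GPM.label (b i) : ℝ) ^ (-((1 + δ) / (2 + δ)))
                    * (GPM.label (a i) : ℝ) ^ (-(1 / (2 + δ))) with hM
  have hA0 : 0 ≤ A := measureReal_nonneg
  have hM0 : 0 < M := by
    refine Finset.prod_pos fun i _ => ?_
    have h1 : (0 : ℝ) < GPM.label (a i) := by simp [GPM.label]; positivity
    have h2 : (0 : ℝ) < GPM.label (b i) := by simp [GPM.label]; positivity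
    positivity
  -- If the prescribed edges are impossible, then both sides vanish and the error is immaterial.
  rcases hA0.eq_or_lt with hA | hA
  · refine ⟨0, by rw [abs_zero]; positivity, ?_⟩
    rw [← hA] at hmain ⊢
    simp only [zero_mul, mul_zero, sub_zero] at hmain ⊢
    exact abs_eq_zero.1 (le_antisymm hmain (abs_nonneg _))
  · have hAM : 0 < A * M := mul_pos hA hM0
    refine ⟨(P - A * M) / (A * M), ?_, ?_⟩
    · rw [abs_div, abs_of_pos hAM, div_le_iff₀ hAM]
      exact hmain
    · field_simp
      ring
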